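/- Write $X=(R,Z)\in\mathbb{R}^2$, with polar coordinates $R=\rho\cos\vartheta$, $Z=\rho\sin\vartheta$, and $\{\phi,\eta\}=\partial_R\phi\,\partial_Z\eta-\partial_Z\phi\,\partial_R\eta$. Let $\mathcal{Y}$ be the space of (classes of) functions $\eta:\mathbb{R}^2\to\mathbb{R}$ with $\|\eta\|_{\mathcal{Y}}^2=\int_{\mathbb{R}^2}|\eta(X)|^2e^{|X|^2/4}\,dX<\infty$. For $n\ge1$ let $\mathcal{Y}_n\subset\mathcal{Y}$ be the subspace of all $\eta$ of the form $a_1(\rho)\cos(n\vartheta)+a_2(\rho)\sin(n\vartheta)$, and let $\mathcal{Y}_1'=\{\eta\in\mathcal{Y}_1 : \int\eta R\,dX=\int\eta Z\,dX=0\}$. Let $\mathcal{Z}\subset\mathcal{Y}$ be the space of all $\eta$ such that $w=e^{|X|^2/4}\eta$ is smooth and, for every multi-index $\alpha$, there are $C>0$, $N\in\mathbb{N}$ with $|\partial^\alpha w(X)|\le C(1+|X|)^N$ on $\mathbb{R}^2$. Set $$\mathcal{L}\eta=\Delta\eta+\tfrac12X\cdot\nabla\eta+\eta,\qquad D(\mathcal{L})=\{\eta\in\mathcal{Y}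 : \Delta\eta\in\mathcal{Y},\ X\cdot\nabla\eta\in\mathcal{Y}\},$$ $$\Lambda\eta=\tfrac1{2\pi}\bigl(\{L\eta_0,\eta\}+\{L\eta,\eta_0\}\bigr),\qquad D(\Lambda)=\{\eta\in\mathcal{Y} : \{L\eta_0,\eta\}\in\mathcal{Y}\},$$ where $\eta_0(X)=\frac1{4\pi}e^{-|X|^2/4}$, $(L\eta)(X)=\int_{\mathbb{R}^2}\log\bigl(\tfrac{8}{|X-X'|}\bigr)\eta(X')\,dX'$, and derivatives are taken in the sense of distributions. **Proposition 3.3.** Assume that $n\ge2$ and $f\in\mathcal{Y}_n\cap\mathcal{Z}$, or that $n=1$ and $f\in\mathcal{Y}_1'\cap\mathcal{Z}$. Let $\kappa>0$. For any $\delta>0$ the equation $$\delta(\kappa-\mathcal{L})\eta^\delta+\Lambda\eta^\delta=f$$ has a unique solution $\eta^\delta\in\mathcal{Y}_n$ (respectively, $\eta^\delta\in\mathcal{Y}_1'$), where solutions are sought in $D(\mathcal{L})\cap D(\Lambda)$. Moreover there is a unique sequence of profiles $\hat\eta_m\in\mathcal{Y}_n\cap\mathcal{Z}$ (respectively, $\hat\eta_m\in\mathcal{Y}_1'\cap\mathcal{Z}$),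 $m\ge0$, such that $\Lambda\hat\eta_0=f$ and $\Lambda\hat\eta_m=(\mathcal{L}-\kappa)\hat\eta_{m-1}$ for all $m\ge1$, and for each integer $N\ge1$ there exists a constant $C>0$, depending only on $f$, $\kappa$ and $N$, such that for all $\delta>0$ $$\Bigl\|\eta^\delta-\sum_{m=0}^{N-1}\delta^m\hat\eta_m\Bigr\|_{\mathcal{Y}}\le C\,\delta^N.$$ -/

import Mathlib

open MeasureTheory
open scoped ContDiff Laplacian

noncomputable section

namespace VortexRing

/-- The plane `ℝ²`, with points `X = (R, Z)`, Euclidean norm `‖X‖ = |X|` and Lebesgue measure. -/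
abbrev Plane : Type := EuclideanSpace ℝ (Fin 2)

/-- The measure `e^{|X|²/4} dX`. -/
def gaussWeight : Measure Plane :=
  (volume : Measure Plane).withDensity fun X => ENNReal.ofReal (Real.exp (‖X‖ ^ 2 / 4))

/-- The weighted space `𝒴`: (classes of) real functions `η` with `∫ |η|² e^{|X|²/4} dX < ∞`,
with the corresponding Hilbert space norm. -/
abbrev Y : Type := Lp ℝ 2 gaussWeight

/-- The norm of `𝒴` is the one given by the weight `e^{|X|²/4}`. -/
theorem Y_norm_sq (η : Y) :
    ‖η‖ ^ 2 = ∫ X : Plane, (η X) ^ 2 * Real.exp (‖X‖ ^ 2 / 4) := by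
  have h : ∫ X, (η X) ^ 2 ∂gaussWeight =
      ∫ X : Plane, (η X) ^ 2 * Real.exp (‖X‖ ^ 2 / 4) := by
    unfold gaussWeight
    rw [integral_withDensity_eq_integral_toReal_smul (by fun_prop)
      (Filter.Eventually.of_forall fun _ => ENNReal.ofReal_lt_top)]
    refine integral_congr_ae (Filter.Eventually.of_forall fun X => ?_)
    simp only [smul_eq_mul, ENNReal.toReal_ofReal (Real.exp_pos _).le]
    ring
  rw [← h, ← real_inner_self_eq_norm_sq, L2.inner_def]
  refine integral_congr_ae (Filter.Eventually.of_forall fun X => ?_)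
  simp

/-- The weighted measure and Lebesgue measure have the same null sets. -/
theorem volume_ac_gaussWeight : (volume : Measure Plane) ≪ gaussWeight :=
  withDensity_absolutelyContinuous' (by fun_prop)
    (Filter.Eventually.of_forall fun X => by simp [Real.exp_pos])

/-- Test functions on the plane: `C_c^∞`. -/
def IsTest (χ : Plane → ℝ) : Prop := ContDiff ℝ ∞ χ ∧ HasCompactSupport χ

/-- Classical partial derivatives; `i = 0` is `∂_R` and `i = 1` is `∂_Z`. -/
def pd (i : Fin 2) (u : Plane → ℝ) (X : Plane) : ℝ :=
  fderiv ℝ u X (EuclideanSpace.single i 1)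

/-- The Poisson bracket `{φ, χ} = ∂_R φ ∂_Z χ - ∂_Z φ ∂_R χ` of differentiable functions. -/
def bracket (φ χ : Plane → ℝ) (X : Plane) : ℝ :=
  pd 0 φ X * pd 1 χ X - pd 1 φ X * pd 0 χ X

/-- `g = {φ, u}` in the sense of distributions, for a smooth function `φ` and a locally integrable
function `u`. (Integrating by parts, `∫ {φ, u} χ = - ∫ u {φ, χ}`.) -/
def IsWeakBracket (φ u g : Plane → ℝ) : Prop :=
  ∀ χ : Plane → ℝ, IsTest χ → ∫ X, g X * χ X = - ∫ X, u X * bracket φ χ X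

/-- `g = Δ u` in the sense of distributions. -/
def IsWeakLaplacian (u g : Plane → ℝ) : Prop :=
  ∀ χ : Plane → ℝ, IsTest χ → ∫ X, g X * χ X = ∫ X, u X * (Δ χ) X

/-- `g = X · ∇u` in the sense of distributions; the formal adjoint of `X · ∇` is
`χ ↦ - div (χ X) = - (X · ∇χ + 2 χ)`. -/
def IsWeakEuler (u g : Plane → ℝ) : Prop :=
  ∀ χ : Plane → ℝ, IsTest χ →
    ∫ X, g X * χ X = - ∫ X, u X * (fderiv ℝ χ X X + 2 * χ X)

/-- `η ∈ D(ℒ)` and `ℒ η = g`, where `ℒ η = Δη + ½ X · ∇η + η` and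
`D(ℒ) = {η ∈ 𝒴 | Δη ∈ 𝒴, X · ∇η ∈ 𝒴}`. -/
def IsL (η g : Y) : Prop :=
  ∃ a b : Y, IsWeakLaplacian η a ∧ IsWeakEuler η b ∧ g = a + (1 / 2 : ℝ) • b + η

/-- The Gaussian vortex `η₀ = (4π)⁻¹ e^{-|X|²/4}`. -/
def eta0 (X : Plane) : ℝ := 1 / (4 * Real.pi) * Real.exp (-‖X‖ ^ 2 / 4)

/-- The integral operator `(L η)(X) = ∫ log (8 / |X - X'|) η(X') dX'`. -/
def logPot (η : Plane → ℝ) (X : Plane) : ℝ := ∫ X', Real.log (8 / ‖X - X'‖) * η X'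

/-- `η ∈ D(Λ)` and `Λ η = g`, where `Λ η = (2π)⁻¹ ({L η₀, η} + {L η, η₀})` and
`D(Λ) = {η ∈ 𝒴 | {L η₀, η} ∈ 𝒴}`. As `L η` need not be continuously differentiable, the second
bracket is also taken in the sense of distributions, through `{L η, η₀} = - {η₀, L η}`. -/
def IsLambda (η g : Y) : Prop :=
  ∃ a b : Y, IsWeakBracket (logPot eta0) η a ∧ IsWeakBracket eta0 (logPot η) (-b : Y) ∧
    g = (1 / (2 * Real.pi)) • (a + b)

/-- The subspace `𝒴_n`: elements of `𝒴` of the form `a₁(ρ) cos (nϑ) + a₂(ρ) sin (nϑ)` in polar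
coordinates. -/
def Yn (n : ℕ) : Set Y :=
  {η | ∃ a₁ a₂ : ℝ → ℝ, ∀ᵐ X : Plane, ∀ ρ ϑ : ℝ, 0 < ρ →
    X = !₂[ρ * Real.cos ϑ, ρ * Real.sin ϑ] →
      η X = a₁ ρ * Real.cos (n * ϑ) + a₂ ρ * Real.sin (n * ϑ)}

/-- The subspace `𝒴₁'` of elements of `𝒴₁` with vanishing first moments. -/
def Y1' : Set Y :=
  {η | η ∈ Yn 1 ∧ ∫ X : Plane, η X * X 0 = 0 ∧ ∫ X : Plane, η X * X 1 = 0}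

/-- The space `𝒵 ⊂ 𝒴`: elements with a representative `u` such that `e^{|X|²/4} u` is smooth and
all its derivatives grow at most polynomially. -/
def Z : Set Y :=
  {η | ∃ u : Plane → ℝ, (∀ᵐ X : Plane, η X = u X) ∧
    Function.HasTemperateGrowth fun X : Plane => Real.exp (‖X‖ ^ 2 / 4) * u X}

/-- `η ∈ D(ℒ) ∩ D(Λ)` and `δ (κ - ℒ) η + Λ η = f`. -/
def Solves (κ δ : ℝ) (f η : Y) : Prop :=
  ∃ l v : Y, IsL η l ∧ IsLambda η v ∧ δ • (κ • η - l) + v = f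

/-- The profiles `p₀, p₁, …` all lie in `W ∩ 𝒵` and satisfy `Λ p₀ = f` and
`Λ p_{m+1} = (ℒ - κ) p_m` for all `m`. -/
def IsProfileSeq (κ : ℝ) (W : Set Y) (f : Y) (p : ℕ → Y) : Prop :=
  (∀ m, p m ∈ W ∩ Z) ∧ IsLambda (p 0) f ∧
    ∀ m, ∃ l : Y, IsL (p m) l ∧ IsLambda (p (m + 1)) (l - κ • p m)

end VortexRing

end

open MeasureTheory
open scoped ContDiff Laplacian

noncomputable section

namespace VortexRing

/-! Everything rests on two facts: on a single angular mode `Λ` is a bounded skew operator, and `ℒ`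
is dissipative with a well-behaved resolvent.

Let φ = (1 - e^{-|X|²/4})/|X|². Since `∂_i L η₀ = -φ X_i` and `∂_i η₀ = -(X_i/2) η₀`, both brackets
are angular derivatives and `Λ = -(2π)⁻¹ ∂_ϑ S` with `S η = φ η - ½ η₀ L η`. The operator `S` is
bounded, symmetric and commutes with rotations. On the `n`-th mode `∂_ϑ = n J`, where `J` is
rotation by a quarter period and `J² = -1`; this gives `LamOp` and its skewness (`isLambda_iff`,
`inner_LamOp`).

Writing `η = e^{-|X|²/4} w` turns `ℒ` into the Ornstein-Uhlenbeck operator `ou`. Polynomials are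
dense in `𝒴` and `κ - ou` is triangular on them. With dissipativity and a second-order estimate this
solves the resolvent equation in the strong domain (`exists_resolvent`); testing against polynomials
gives uniqueness, so weak solutions are strong (`IsWeakL.isL_and_inner_nonpos`). As `Λ` does not
contribute to the energy, solutions of the full equation satisfy `‖η‖ ≤ ‖g‖/(δκ)` (`Eqn.norm_le`),
and two contraction arguments give existence (`IsMode.exists_eqn`).

For the profiles, `Λ` must be inverted inside `𝒵`. That amounts to `φ w - ψ/(8π) = G` with `ψ =
L(e^{-|X|²/4} w)`. For `n ≥ 2` the map sending ψ to the potential of the corresponding `w` is a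
contraction in the sup norm (`exists_fixed_point`), because the `n`-th Fourier coefficient of the
logarithm is small. For `n = 1` there is a kernel, spanned by the `X_i e^{-|X|²/4}` (translations of
the vortex); vanishing first moments of `G` are the solvability condition, and reduction of order
from the kernel gives ψ by quadrature (`exists_fixed_point_one`). In both cases regularity is a
bootstrap, since `L` gains a derivative (`tg_logPot`). Injectivity on the mode follows from
surjectivity and skewness (`IsMode.lamOp_injOn`).

Finally the truncated sum leaves a remainder solving the same equation with source `δ^N Λ p_N`. The
a priori bound loses a factor `δ`, which is recovered by expanding one term further
(`IsMode.exists_remainder_le`). -/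

/-- The Gaussian factor `e^{-|X|²/4}`. -/
def gs (X : Plane) : ℝ := Real.exp (-(‖X‖ ^ 2 / 4))

/-! ### Polynomial growth against the Gaussian. -/

/-- Polynomially bounded functions. -/
def PB (u : Plane → ℝ) : Prop := ∃ (C : ℝ) (N : ℕ), ∀ X, |u X| ≤ C * (1 + ‖X‖) ^ N

theorem gs_pos (X : Plane) : 0 < gs X := Real.exp_pos _

theorem continuous_gs : Continuous gs := by unfold gs; fun_prop

theorem exp_mul_gs (X : Plane) : Real.exp (‖X‖ ^ 2 / 4) * gs X = 1 := by
  rw [gs, ← Real.exp_add]; simp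

theorem gs_mul_exp (X : Plane) : gs X * Real.exp (‖X‖ ^ 2 / 4) = 1 := by
  rw [mul_comm, exp_mul_gs]

theorem gs_le_one (X : Plane) : gs X ≤ 1 := by
  rw [gs, Real.exp_le_one_iff]; have := sq_nonneg ‖X‖; linarith

theorem eta0_eq (X : Plane) : eta0 X = 1 / (4 * Real.pi) * gs X := by
  simp only [eta0, gs]; congr 2; ring

/-- One term of the exponential series dominates the power, and completing the square absorbs the
linear exponent `1 + r` into `c r²`. -/
theorem one_add_pow_le (N : ℕ) {c : ℝ} (hc : 0 < c) :
    ∃ C : ℝ, 0 < C ∧ ∀ r : ℝ, 0 ≤ r → (1 + r) ^ N ≤ C * Real.exp (c * r ^ 2) := by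
  refine ⟨N.factorial * Real.exp (1 + 1 / (4 * c)), by positivity, fun r hr => ?_⟩
  have h1 := Real.pow_div_factorial_le_exp (1 + r) (by linarith) N
  rw [div_le_iff₀ (by positivity)] at h1
  have h2 : 1 + r ≤ 1 + 1 / (4 * c) + c * r ^ 2 := by
    have : 0 ≤ c * (r - 1 / (2 * c)) ^ 2 := by positivity
    have e : c * (r - 1 / (2 * c)) ^ 2 = c * r ^ 2 - r + 1 / (4 * c) := by
      field_simp; ring
    linarith
  calc (1 + r) ^ N ≤ Real.exp (1 + r) * N.factorial := h1
    _ ≤ Real.exp (1 + 1 / (4 * c) + c * r ^ 2) * N.factorial := by gcongr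
    _ = _ := by rw [Real.exp_add]; ring

theorem integrable_exp_neg_sq {c : ℝ} (hc : 0 < c) :
    Integrable (fun X : Plane => Real.exp (-(c * ‖X‖ ^ 2))) := by
  have h := (GaussianFourier.integrable_cexp_neg_mul_sq_norm_add (b := (c : ℂ)) (V := Plane)
    (by simpa using hc) 0 0).re
  refine h.congr (Filter.Eventually.of_forall fun X => ?_)
  simp only [zero_mul, add_zero]
  have : -(c : ℂ) * (‖X‖ : ℂ) ^ 2 = ((-(c * ‖X‖ ^ 2) : ℝ) : ℂ) := by push_cast; ring
  rw [this, ← Complex.ofReal_exp]; rfl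

theorem integrable_one_add_pow_mul_exp (N : ℕ) {c : ℝ} (hc : 0 < c) :
    Integrable (fun X : Plane => (1 + ‖X‖) ^ N * Real.exp (-(c * ‖X‖ ^ 2))) := by
  obtain ⟨C, hC, h⟩ := one_add_pow_le N (half_pos hc)
  refine ((integrable_exp_neg_sq (half_pos hc)).const_mul C).mono'
    (by fun_prop) (Filter.Eventually.of_forall fun X => ?_)
  rw [Real.norm_of_nonneg (by positivity)]
  calc _ ≤ C * Real.exp (c / 2 * ‖X‖ ^ 2) * Real.exp (-(c * ‖X‖ ^ 2)) := by
        gcongr; exact h _ (norm_nonneg _)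
    _ = _ := by rw [mul_assoc, ← Real.exp_add]; congr 2; ring

namespace PB

variable {u v : Plane → ℝ}

theorem exists_pos (h : PB u) : ∃ (C : ℝ) (N : ℕ), 0 < C ∧ ∀ X, |u X| ≤ C * (1 + ‖X‖) ^ N := by
  obtain ⟨C, N, h⟩ := h
  refine ⟨|C| + 1, N, by positivity, fun X => (h X).trans ?_⟩
  gcongr
  linarith [le_abs_self C]

theorem mono (h : PB u) (hv : ∀ X, |v X| ≤ |u X|) : PB v := by
  obtain ⟨C, N, h⟩ := h
  exact ⟨C, N, fun X => (hv X).trans (h X)⟩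

theorem const (c : ℝ) : PB fun _ => c := ⟨|c|, 0, fun X => by simp⟩

theorem of_bound {C : ℝ} (h : ∀ X, |u X| ≤ C) : PB u := ⟨C, 0, fun X => by simpa using h X⟩

theorem add (hu : PB u) (hv : PB v) : PB fun X => u X + v X := by
  obtain ⟨C, N, hC, hu⟩ := hu.exists_pos
  obtain ⟨D, M, hD, hv⟩ := hv.exists_pos
  refine ⟨C + D, N + M, fun X => (abs_add_le _ _).trans ?_⟩
  have h1 : (1 + ‖X‖) ^ N ≤ (1 + ‖X‖) ^ (N + M) :=
    pow_le_pow_right₀ (by linarith [norm_nonneg X]) (by omega)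
  have h2 : (1 + ‖X‖) ^ M ≤ (1 + ‖X‖) ^ (N + M) :=
    pow_le_pow_right₀ (by linarith [norm_nonneg X]) (by omega)
  rw [add_mul]
  exact add_le_add ((hu X).trans (by gcongr)) ((hv X).trans (by gcongr))

theorem mul (hu : PB u) (hv : PB v) : PB fun X => u X * v X := by
  obtain ⟨C, N, hC, hu⟩ := hu.exists_pos
  obtain ⟨D, M, hD, hv⟩ := hv.exists_pos
  refine ⟨C * D, N + M, fun X => ?_⟩
  rw [abs_mul, pow_add]
  calc _ ≤ (C * (1 + ‖X‖) ^ N) * (D * (1 + ‖X‖) ^ M) := by gcongr; exacts [hu X, hv X]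
    _ = _ := by ring

theorem norm : PB fun X => ‖X‖ := ⟨1, 1, fun X => by simp⟩

theorem coord (i : Fin 2) : PB fun X => X i :=
  norm.mono fun X => by simpa using PiLp.norm_apply_le X i

theorem integrable (hu : PB u) (hm : AEStronglyMeasurable u) :
    Integrable fun X => gs X * u X := by
  obtain ⟨C, N, hC, hu⟩ := hu.exists_pos
  refine ((integrable_one_add_pow_mul_exp N (c := 1 / 4) (by norm_num)).const_mul C).mono'
    (continuous_gs.aestronglyMeasurable.mul hm) (Filter.Eventually.of_forall fun X => ?_)
  rw [norm_mul, Real.norm_of_nonneg (gs_pos X).le, Real.norm_eq_abs]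
  calc gs X * |u X| ≤ gs X * (C * (1 + ‖X‖) ^ N) := by
        have := gs_pos X; gcongr; exact hu X
    _ = _ := by rw [gs]; ring_nf

end PB

/-! ### The weighted space, with elements written as `e^{-|X|²/4} w`. -/

theorem ae_gaussWeight : ae gaussWeight = ae (volume : Measure Plane) :=
  le_antisymm (Measure.AbsolutelyContinuous.ae_le (withDensity_absolutelyContinuous _ _))
    (Measure.AbsolutelyContinuous.ae_le volume_ac_gaussWeight)

theorem integrable_gaussWeight {f : Plane → ℝ} :
    Integrable f gaussWeight ↔ Integrable fun X => f X * Real.exp (‖X‖ ^ 2 / 4) := by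
  unfold gaussWeight
  rw [integrable_withDensity_iff_integrable_smul' (by fun_prop)
    (Filter.Eventually.of_forall fun _ => ENNReal.ofReal_lt_top)]
  refine integrable_congr (Filter.Eventually.of_forall fun X => ?_)
  simp only [smul_eq_mul, ENNReal.toReal_ofReal (Real.exp_pos _).le]
  ring

theorem integral_gaussWeight (f : Plane → ℝ) :
    ∫ X, f X ∂gaussWeight = ∫ X, f X * Real.exp (‖X‖ ^ 2 / 4) := by
  unfold gaussWeight
  rw [integral_withDensity_eq_integral_toReal_smul (by fun_prop)
    (Filter.Eventually.of_forall fun _ => ENNReal.ofReal_lt_top)]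
  refine integral_congr_ae (Filter.Eventually.of_forall fun X => ?_)
  simp only [smul_eq_mul, ENNReal.toReal_ofReal (Real.exp_pos _).le]
  ring

theorem aestronglyMeasurable_gaussWeight {f : Plane → ℝ} :
    AEStronglyMeasurable f gaussWeight ↔ AEStronglyMeasurable f volume := by
  constructor
  · exact fun h => h.mono_ac volume_ac_gaussWeight
  · exact fun h => h.mono_ac (withDensity_absolutelyContinuous _ _)

theorem Y_aesm (η : Y) : AEStronglyMeasurable η (volume : Measure Plane) :=
  aestronglyMeasurable_gaussWeight.1 (Lp.memLp η).1

theorem Y_ext {η ζ : Y} (h : ∀ᵐ X : Plane, η X = ζ X) : η = ζ := by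
  apply Lp.ext
  rw [Filter.EventuallyEq, ae_gaussWeight]
  exact h

/-- Functions `w` for which `e^{-|X|²/4} w` belongs to `𝒴`. -/
def Adm (w : Plane → ℝ) : Prop := MemLp (fun X => gs X * w X) 2 gaussWeight

open Classical in
/-- The element `e^{-|X|²/4} w` of `𝒴`. -/
def toY (w : Plane → ℝ) : Y := if h : Adm w then h.toLp _ else 0

theorem adm_iff {w : Plane → ℝ} (hw : AEStronglyMeasurable w) :
    Adm w ↔ Integrable fun X => gs X * w X ^ 2 := by
  have hm : AEStronglyMeasurable (fun X => gs X * w X) gaussWeight :=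
    aestronglyMeasurable_gaussWeight.2 (continuous_gs.aestronglyMeasurable.mul hw)
  unfold Adm
  rw [memLp_two_iff_integrable_sq hm, integrable_gaussWeight]
  refine integrable_congr (Filter.Eventually.of_forall fun X => ?_)
  simp only
  linear_combination (gs X * w X ^ 2) * gs_mul_exp X

theorem PB.adm {w : Plane → ℝ} (hw : PB w) (hm : AEStronglyMeasurable w) : Adm w :=
  (adm_iff hm).2 (by simpa only [sq] using (hw.mul hw).integrable (hm.mul hm))

theorem toY_ae {w : Plane → ℝ} (hw : Adm w) : ∀ᵐ X : Plane, toY w X = gs X * w X := by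
  rw [← ae_gaussWeight, toY, dif_pos hw]
  exact MemLp.coeFn_toLp hw

theorem integrable_Y_mul (η ζ : Y) :
    Integrable fun X => η X * ζ X * Real.exp (‖X‖ ^ 2 / 4) := by
  have := L2.integrable_inner (𝕜 := ℝ) η ζ
  rw [integrable_gaussWeight] at this
  refine this.congr (Filter.Eventually.of_forall fun X => ?_)
  simp [mul_comm]

theorem inner_Y (η ζ : Y) :
    inner ℝ η ζ = ∫ X, η X * ζ X * Real.exp (‖X‖ ^ 2 / 4) := by
  rw [L2.inner_def, integral_gaussWeight]
  refine integral_congr_ae (Filter.Eventually.of_forall fun X => ?_)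
  simp [mul_comm]

theorem integrable_mul_adm (η : Y) {w : Plane → ℝ} (hw : Adm w) :
    Integrable fun X => η X * w X := by
  refine (integrable_Y_mul η (toY w)).congr ?_
  filter_upwards [toY_ae hw] with X hX
  rw [hX]; linear_combination (η X * w X) * gs_mul_exp X

/-- The Gaussian in `toY w` cancels the weight. Pairings with test functions and moments thus become
inner products in `𝒴`, to which continuity and Cauchy-Schwarz apply. -/
theorem inner_toY (η : Y) {w : Plane → ℝ} (hw : Adm w) :
    inner ℝ η (toY w) = ∫ X, η X * w X := by
  rw [inner_Y]
  refine integral_congr_ae ?_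
  filter_upwards [toY_ae hw] with X hX
  rw [hX]; linear_combination (η X * w X) * gs_mul_exp X

theorem inner_toY_toY {u w : Plane → ℝ} (hu : Adm u) (hw : Adm w) :
    inner ℝ (toY u) (toY w) = ∫ X, gs X * (u X * w X) := by
  rw [inner_toY _ hw]
  refine integral_congr_ae ?_
  filter_upwards [toY_ae hu] with X hX
  rw [hX]; ring

theorem eq_toY {η : Y} {w : Plane → ℝ} (h : ∀ᵐ X : Plane, η X = gs X * w X) :
    Adm w ∧ η = toY w := by
  have hw : Adm w := by
    refine (memLp_congr_ae ?_).1 (Lp.memLp η)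
    rw [Filter.EventuallyEq, ae_gaussWeight]; exact h
  refine ⟨hw, Y_ext ?_⟩
  filter_upwards [h, toY_ae hw] with X h1 h2
  rw [h1, h2]

theorem toY_congr {u w : Plane → ℝ} (h : ∀ᵐ X : Plane, u X = w X) : toY u = toY w := by
  have e : (fun X => gs X * u X) =ᵐ[gaussWeight] fun X => gs X * w X := by
    rw [Filter.EventuallyEq, ae_gaussWeight]; filter_upwards [h] with X hX; rw [hX]
  have ha : Adm u ↔ Adm w := memLp_congr_ae e
  by_cases hu : Adm u
  · exact Y_ext (by filter_upwards [toY_ae hu, toY_ae (ha.1 hu), h] with X h1 h2 h3; rw [h1, h2, h3])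
  · rw [toY, toY, dif_neg hu, dif_neg (fun h => hu (ha.2 h))]

theorem toY_add {u w : Plane → ℝ} (hu : Adm u) (hw : Adm w) :
    toY (fun X => u X + w X) = toY u + toY w := by
  refine ((eq_toY ?_).2).symm
  filter_upwards [toY_ae hu, toY_ae hw, (ae_gaussWeight ▸ Lp.coeFn_add (toY u) (toY w) :
    ∀ᵐ X : Plane, (toY u + toY w : Y) X = toY u X + toY w X)] with X h1 h2 h3
  rw [h3, h1, h2]; ring

theorem Y_add_ae (η ζ : Y) : ∀ᵐ X : Plane, (η + ζ : Y) X = η X + ζ X :=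
  ae_gaussWeight ▸ Lp.coeFn_add η ζ

theorem Y_sub_ae (η ζ : Y) : ∀ᵐ X : Plane, (η - ζ : Y) X = η X - ζ X :=
  ae_gaussWeight ▸ Lp.coeFn_sub η ζ

theorem Y_smul_ae (c : ℝ) (η : Y) : ∀ᵐ X : Plane, (c • η : Y) X = c * η X :=
  ae_gaussWeight ▸ Lp.coeFn_smul c η

theorem toY_smul (c : ℝ) {u : Plane → ℝ} (hu : Adm u) :
    toY (fun X => c * u X) = c • toY u := by
  refine ((eq_toY ?_).2).symm
  filter_upwards [toY_ae hu, Y_smul_ae c (toY u)] with X h1 h3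
  rw [h3, h1]; ring

theorem toY_sub {u w : Plane → ℝ} (hu : Adm u) (hw : Adm w) :
    toY (fun X => u X - w X) = toY u - toY w := by
  refine ((eq_toY ?_).2).symm
  filter_upwards [toY_ae hu, toY_ae hw, Y_sub_ae (toY u) (toY w)] with X h1 h2 h3
  rw [h3, h1, h2]; ring

theorem Y_locallyIntegrable (η : Y) : LocallyIntegrable (fun X => η X) := by
  have := (integrable_mul_adm η ((PB.const 1).adm aestronglyMeasurable_const))
  simpa using this.locallyIntegrable

theorem Y_eq_of_test {η ζ : Y} (h : ∀ χ, IsTest χ → ∫ X, η X * χ X = ∫ X, ζ X * χ X) : η = ζ :=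
  Y_ext <| ae_eq_of_integral_contDiff_smul_eq (Y_locallyIntegrable η) (Y_locallyIntegrable ζ)
    fun g hg hs => by simpa [mul_comm] using h g ⟨hg, hs⟩

/-! ### Smooth functions of polynomial growth and the space `𝒵`. -/

/-- `u` is of class `C^k` and its partial derivatives up to order `k` grow at most polynomially. -/
def TG : ℕ → (Plane → ℝ) → Prop
  | 0, u => Continuous u ∧ PB u
  | k + 1, u => Differentiable ℝ u ∧ PB u ∧ ∀ i, TG k (pd i u)

/-- Smooth functions all of whose partial derivatives grow at most polynomially. -/
def SM (u : Plane → ℝ) : Prop := ∀ k, TG k u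

section pd

variable {u v : Plane → ℝ} {X : Plane} (i : Fin 2)

theorem pd_add (hu : DifferentiableAt ℝ u X) (hv : DifferentiableAt ℝ v X) :
    pd i (fun X => u X + v X) X = pd i u X + pd i v X := by
  simp only [pd]; rw [fderiv_fun_add hu hv]; rfl

theorem pd_sub (hu : DifferentiableAt ℝ u X) (hv : DifferentiableAt ℝ v X) :
    pd i (fun X => u X - v X) X = pd i u X - pd i v X := by
  simp only [pd]; rw [fderiv_fun_sub hu hv]; rfl

theorem pd_mul (hu : DifferentiableAt ℝ u X) (hv : DifferentiableAt ℝ v X) :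
    pd i (fun X => u X * v X) X = u X * pd i v X + pd i u X * v X := by
  simp only [pd]; rw [fderiv_fun_mul hu hv]; simp [mul_comm]

theorem pd_const (c : ℝ) : pd i (fun _ => c) X = 0 := by
  simp [pd]

theorem pd_const_mul (c : ℝ) (hu : DifferentiableAt ℝ u X) :
    pd i (fun X => c * u X) X = c * pd i u X := by
  simp only [pd]; rw [fderiv_const_mul hu]; simp

theorem hasFDerivAt_coord (j : Fin 2) (X : Plane) :
    HasFDerivAt (fun X : Plane => X j) (EuclideanSpace.proj j : Plane →L[ℝ] ℝ) X :=
  (EuclideanSpace.proj j : Plane →L[ℝ] ℝ).hasFDerivAt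

theorem differentiable_coord (j : Fin 2) : Differentiable ℝ fun X : Plane => X j :=
  fun X => (hasFDerivAt_coord j X).differentiableAt

theorem pd_coord (j : Fin 2) : pd i (fun X => X j) X = if j = i then 1 else 0 := by
  simp only [pd]; rw [(hasFDerivAt_coord j X).fderiv]; simp

theorem hasFDerivAt_norm_sq (X : Plane) :
    HasFDerivAt (fun X : Plane => ‖X‖ ^ 2) (2 • (innerSL ℝ X)) X :=
  (hasStrictFDerivAt_norm_sq X).hasFDerivAt

theorem inner_single (X : Plane) : inner ℝ X (EuclideanSpace.single i (1 : ℝ)) = X i := by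
  simp [EuclideanSpace.inner_single_right]

theorem hasFDerivAt_exp_norm_sq (c : ℝ) (X : Plane) :
    HasFDerivAt (fun X : Plane => Real.exp (c * ‖X‖ ^ 2))
      ((2 * c * Real.exp (c * ‖X‖ ^ 2)) • (innerSL ℝ X)) X := by
  have := ((hasFDerivAt_norm_sq X).const_mul c).exp
  refine this.congr_fderiv ?_
  ext v; simp; ring

theorem hasFDerivAt_gs (X : Plane) :
    HasFDerivAt gs ((-(1 / 2) * gs X) • (innerSL ℝ X)) X := by
  have h := hasFDerivAt_exp_norm_sq (-(1 / 4)) X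
  have e : gs = fun X : Plane => Real.exp (-(1 / 4) * ‖X‖ ^ 2) := by
    funext Y; rw [gs]; congr 1; ring
  rw [e]; refine h.congr_fderiv ?_
  congr 1; ring

theorem differentiable_gs : Differentiable ℝ gs := fun X => (hasFDerivAt_gs X).differentiableAt

theorem pd_gs : pd i gs X = -(X i / 2) * gs X := by
  simp only [pd]; rw [(hasFDerivAt_gs X).fderiv]
  simp [inner_single]; ring

theorem fderiv_eq_pd (u : Plane → ℝ) (X : Plane) :
    fderiv ℝ u X = ∑ i, pd i u X • (EuclideanSpace.proj i : Plane →L[ℝ] ℝ) := by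
  ext v
  have hv : v = ∑ i, v i • EuclideanSpace.single i (1 : ℝ) := by
    ext j; fin_cases j <;> simp
  conv_lhs => rw [hv, map_sum]
  simp [pd, mul_comm]

end pd

namespace TG

variable {u v : Plane → ℝ} {k : ℕ}

theorem pb (h : TG k u) : PB u := by
  cases k with
  | zero => exact h.2
  | succ k => exact h.2.1

theorem continuous (h : TG k u) : Continuous u := by
  cases k with
  | zero => exact h.1
  | succ k => exact h.1.continuous

theorem adm (h : TG k u) : Adm u := h.pb.adm h.continuous.aestronglyMeasurable

theorem integrable (h : TG k u) : Integrable fun X => gs X * u X :=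
  h.pb.integrable h.continuous.aestronglyMeasurable

theorem zero_of (h : TG k u) : TG 0 u := ⟨h.continuous, h.pb⟩

theorem of_succ (h : TG (k + 1) u) : TG k u := by
  induction k generalizing u with
  | zero => exact h.zero_of
  | succ k ih => exact ⟨h.1, h.2.1, fun i => ih (h.2.2 i)⟩

theorem differentiable (h : TG (k + 1) u) : Differentiable ℝ u := h.1

theorem pd (h : TG (k + 1) u) (i : Fin 2) : TG k (pd i u) := h.2.2 i

theorem const (c : ℝ) : TG k fun _ => c := by
  induction k generalizing c with
  | zero => exact ⟨continuous_const, PB.const c⟩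
  | succ k ih =>
    refine ⟨differentiable_const c, PB.const c, fun i => ?_⟩
    have : VortexRing.pd i (fun _ => c) = fun _ => 0 := funext fun X => pd_const i c
    rw [this]; exact ih 0

theorem coord (j : Fin 2) : TG k fun X => X j := by
  cases k with
  | zero => exact ⟨(differentiable_coord j).continuous, PB.coord j⟩
  | succ k =>
    refine ⟨differentiable_coord j, PB.coord j, fun i => ?_⟩
    have : VortexRing.pd i (fun X => X j) = fun _ => if j = i then 1 else 0 :=
      funext fun X => pd_coord i j
    rw [this]; exact const _

theorem add (hu : TG k u) (hv : TG k v) : TG k fun X => u X + v X := by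
  induction k generalizing u v with
  | zero => exact ⟨hu.1.add hv.1, hu.2.add hv.2⟩
  | succ k ih =>
    refine ⟨hu.1.add hv.1, hu.2.1.add hv.2.1, fun i => ?_⟩
    have : VortexRing.pd i (fun X => u X + v X) =
      fun X => VortexRing.pd i u X + VortexRing.pd i v X :=
      funext fun X => pd_add i (hu.1 X) (hv.1 X)
    rw [this]; exact ih (hu.2.2 i) (hv.2.2 i)

theorem mul (hu : TG k u) (hv : TG k v) : TG k fun X => u X * v X := by
  induction k generalizing u v with
  | zero => exact ⟨hu.1.mul hv.1, hu.2.mul hv.2⟩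
  | succ k ih =>
    refine ⟨hu.1.mul hv.1, hu.2.1.mul hv.2.1, fun i => ?_⟩
    have : VortexRing.pd i (fun X => u X * v X) =
      fun X => u X * VortexRing.pd i v X + VortexRing.pd i u X * v X :=
      funext fun X => pd_mul i (hu.1 X) (hv.1 X)
    rw [this]; exact (ih hu.of_succ (hv.2.2 i)).add (ih (hu.2.2 i) hv.of_succ)

theorem smul (c : ℝ) (hu : TG k u) : TG k fun X => c * u X := (const c).mul hu

theorem neg (hu : TG k u) : TG k fun X => -u X := by simpa using hu.smul (-1)

theorem sub (hu : TG k u) (hv : TG k v) : TG k fun X => u X - v X := by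
  simpa [sub_eq_add_neg] using hu.add hv.neg

theorem normSq : TG k fun X => ‖X‖ ^ 2 := by
  have : (fun X : Plane => ‖X‖ ^ 2) = fun X => X 0 * X 0 + X 1 * X 1 := by
    funext X; rw [EuclideanSpace.real_norm_sq_eq]; simp [sq]
  rw [this]
  exact ((coord 0).mul (coord 0)).add ((coord 1).mul (coord 1))

theorem contDiff (h : TG k u) : ContDiff ℝ k u ∧
    ∃ (N : ℕ) (C : ℝ), ∀ X, ‖iteratedFDeriv ℝ k u X‖ ≤ C * (1 + ‖X‖) ^ N := by
  induction k generalizing u with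
  | zero =>
    obtain ⟨C, N, hC⟩ := h.pb
    exact ⟨contDiff_zero.2 h.1, N, C, fun X => by simpa using hC X⟩
  | succ k ih =>
    have hd : fderiv ℝ u = fun X => ∑ i, ContinuousLinearMap.smulRight
        (1 : ℝ →L[ℝ] ℝ) (EuclideanSpace.proj i : Plane →L[ℝ] ℝ) (VortexRing.pd i u X) := by
      funext X; rw [fderiv_eq_pd]; simp
    have hc := fun i => ih (h.2.2 i)
    have hci : ∀ i, ContDiff ℝ k fun X => ContinuousLinearMap.smulRight
        (1 : ℝ →L[ℝ] ℝ) (EuclideanSpace.proj i : Plane →L[ℝ] ℝ) (VortexRing.pd i u X) :=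
      fun i => (ContinuousLinearMap.contDiff _).comp (hc i).1
    refine ⟨?_, ?_⟩
    · rw [Nat.cast_succ, contDiff_succ_iff_fderiv, hd]
      exact ⟨h.1, by simp, ContDiff.sum fun i _ => hci i⟩
    · have hb : PB fun X => ‖iteratedFDeriv ℝ (k + 1) u X‖ := by
        have h2 : ∀ i, PB fun X => ‖iteratedFDeriv ℝ k (VortexRing.pd i u) X‖ := fun i => by
          obtain ⟨N, C, h⟩ := (hc i).2
          exact ⟨C, N, fun X => by simpa using h X⟩
        refine ((((PB.const _).mul (h2 0)).add ((PB.const _).mul (h2 1)))).mono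
          (u := fun X => ‖ContinuousLinearMap.smulRight (1 : ℝ →L[ℝ] ℝ)
            (EuclideanSpace.proj 0 : Plane →L[ℝ] ℝ)‖ * ‖iteratedFDeriv ℝ k (VortexRing.pd 0 u) X‖
            + ‖ContinuousLinearMap.smulRight (1 : ℝ →L[ℝ] ℝ)
            (EuclideanSpace.proj 1 : Plane →L[ℝ] ℝ)‖ * ‖iteratedFDeriv ℝ k (VortexRing.pd 1 u) X‖)
          fun X => ?_
        rw [abs_norm, ← norm_iteratedFDeriv_fderiv, hd]
        simp only [Fin.sum_univ_two]
        rw [fun_iteratedFDeriv_add_apply (hci 0).contDiffAt (hci 1).contDiffAt]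
        refine (norm_add_le _ _).trans ((add_le_add ?_ ?_).trans (le_abs_self _))
        · exact ContinuousLinearMap.norm_iteratedFDeriv_comp_left _ (hc 0).1.contDiffAt le_rfl
        · exact ContinuousLinearMap.norm_iteratedFDeriv_comp_left _ (hc 1).1.contDiffAt le_rfl
      obtain ⟨C, N, hC⟩ := hb
      exact ⟨N, C, fun X => by simpa using hC X⟩

end TG

theorem SM.hasTemperateGrowth {u : Plane → ℝ} (h : SM u) : Function.HasTemperateGrowth u :=
  ⟨contDiff_infty.2 fun n => (h n).contDiff.1, fun n => (h n).contDiff.2⟩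

theorem hasTemperateGrowth_pd {u : Plane → ℝ} (h : Function.HasTemperateGrowth u) (i : Fin 2) :
    Function.HasTemperateGrowth (pd i u) := by
  have hf : Function.HasTemperateGrowth (fderiv ℝ u) := by
    refine ⟨h.1.fderiv_right (by simp), fun n => ?_⟩
    obtain ⟨k, C, hC⟩ := h.2 (n + 1)
    exact ⟨k, C, fun x => by rw [norm_iteratedFDeriv_fderiv]; exact hC x⟩
  exact (ContinuousLinearMap.hasTemperateGrowth
    (ContinuousLinearMap.apply ℝ ℝ (EuclideanSpace.single i (1 : ℝ) : Plane))).comp hf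

theorem SM.of_hasTemperateGrowth {u : Plane → ℝ} (h : Function.HasTemperateGrowth u) : SM u := by
  intro k
  have hp : ∀ {u : Plane → ℝ}, Function.HasTemperateGrowth u → PB u := fun {u} h => by
    obtain ⟨k, C, hC⟩ := h.2 0
    exact ⟨C, k, fun X => by simpa using hC X⟩
  induction k generalizing u with
  | zero => exact ⟨h.1.continuous, hp h⟩
  | succ k ih => exact ⟨h.1.differentiable (by simp), hp h, fun i => ih (hasTemperateGrowth_pd h i)⟩

theorem mem_Z_iff {η : Y} : η ∈ Z ↔ ∃ w, SM w ∧ η = toY w := by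
  constructor
  · rintro ⟨u, hu, ht⟩
    refine ⟨_, SM.of_hasTemperateGrowth ht, (eq_toY ?_).2⟩
    filter_upwards [hu] with X hX
    rw [hX]; linear_combination (-u X) * gs_mul_exp X
  · rintro ⟨w, hw, rfl⟩
    refine ⟨fun X => gs X * w X, toY_ae (hw 0).adm, ?_⟩
    have : (fun X : Plane => Real.exp (‖X‖ ^ 2 / 4) * (gs X * w X)) = w := by
      funext X; linear_combination (w X) * gs_mul_exp X
    rw [this]; exact hw.hasTemperateGrowth

theorem IsTest.sm {χ : Plane → ℝ} (h : IsTest χ) : SM χ :=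
  SM.of_hasTemperateGrowth (HasCompactSupport.hasTemperateGrowth h.2 h.1)

theorem IsTest.pd {χ : Plane → ℝ} (h : IsTest χ) (i : Fin 2) : IsTest (pd i χ) :=
  ⟨(h.1.fderiv_right (m := ∞) (by simp)).clm_apply contDiff_const, h.2.fderiv_apply ℝ _⟩

theorem SM.pd {u : Plane → ℝ} (h : SM u) (i : Fin 2) : SM (pd i u) := fun k => (h (k + 1)).pd i

theorem pd_comm {u : Plane → ℝ} (h : TG 2 u) (i j : Fin 2) (X : Plane) :
    pd i (pd j u) X = pd j (pd i u) X := by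
  have hc : ContDiff ℝ 2 u := h.contDiff.1
  have hd : Differentiable ℝ (fderiv ℝ u) :=
    (hc.fderiv_right (m := 1) (by norm_num)).differentiable (by simp)
  have e : ∀ i j, pd i (pd j u) X = fderiv ℝ (fderiv ℝ u) X (EuclideanSpace.single i 1)
      (EuclideanSpace.single j 1) := fun i j => by
    have : pd j u = fun X => fderiv ℝ u X (EuclideanSpace.single j 1) := rfl
    rw [pd, this, fderiv_clm_apply (hd X) (by fun_prop)]; simp
  rw [e, e]
  exact (hc.contDiffAt.isSymmSndFDerivAt (by simp)).eq _ _

theorem laplacian_eq_pd {u : Plane → ℝ} (h : ContDiff ℝ 2 u) (X : Plane) :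
    (Δ u) X = pd 0 (pd 0 u) X + pd 1 (pd 1 u) X := by
  have hd : Differentiable ℝ (fderiv ℝ u) :=
    (h.fderiv_right (m := 1) (by norm_num)).differentiable (by simp)
  have e : ∀ i, pd i (pd i u) X = fderiv ℝ (fderiv ℝ u) X (EuclideanSpace.single i 1)
      (EuclideanSpace.single i 1) := fun i => by
    have : pd i u = fun X => fderiv ℝ u X (EuclideanSpace.single i 1) := rfl
    rw [pd, this, fderiv_clm_apply (hd X) (by fun_prop)]; simp
  rw [congrFun (InnerProductSpace.laplacian_eq_iteratedFDeriv_orthonormalBasis u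
    (EuclideanSpace.basisFun (Fin 2) ℝ)) X, Fin.sum_univ_two, e, e]
  simp [iteratedFDeriv_two_apply]

theorem fderiv_self_eq_pd (u : Plane → ℝ) (X : Plane) :
    fderiv ℝ u X X = X 0 * pd 0 u X + X 1 * pd 1 u X := by
  rw [fderiv_eq_pd]; simp [mul_comm]

/-! ### The angular velocity φ and its inverse. -/

/-- The functions `∫₀¹ t^j e^{-t|X|²/4} dt`. -/
def phj (j : ℕ) (X : Plane) : ℝ := ∫ t in (0 : ℝ)..1, t ^ j * Real.exp (-(t / 4) * ‖X‖ ^ 2)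

/-- The function `φ(X) = (1 - e^{-|X|²/4}) / |X|²`. -/
def phi (X : Plane) : ℝ := phj 0 X / 4

theorem continuous_phj_integrand (j : ℕ) (X : Plane) :
    Continuous fun t : ℝ => t ^ j * Real.exp (-(t / 4) * ‖X‖ ^ 2) := by fun_prop

theorem phj_nonneg (j : ℕ) (X : Plane) : 0 ≤ phj j X :=
  intervalIntegral.integral_nonneg (by norm_num) fun t ht =>
    mul_nonneg (pow_nonneg ht.1 _) (Real.exp_pos _).le

theorem phj_le_one (j : ℕ) (X : Plane) : phj j X ≤ 1 := by
  have : phj j X ≤ ∫ _ in (0 : ℝ)..1, (1 : ℝ) := by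
    refine intervalIntegral.integral_mono_on (by norm_num)
      ((continuous_phj_integrand j X).intervalIntegrable _ _)
      (continuous_const.intervalIntegrable _ _) fun t ht => ?_
    refine mul_le_one₀ (pow_le_one₀ ht.1 ht.2) (Real.exp_pos _).le (Real.exp_le_one_iff.2 ?_)
    have := mul_nonneg ht.1 (sq_nonneg ‖X‖)
    linarith
  simpa using this

theorem phj_zero_mul (X : Plane) : phj 0 X * (‖X‖ ^ 2 / 4) = 1 - gs X := by
  have h : ∀ t ∈ Set.uIcc (0 : ℝ) 1, HasDerivAt (fun t => -Real.exp (-(t / 4) * ‖X‖ ^ 2))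
      ((t ^ 0 * Real.exp (-(t / 4) * ‖X‖ ^ 2)) * (‖X‖ ^ 2 / 4)) t := fun t _ => by
    have h1 : HasDerivAt (fun t : ℝ => -(t / 4) * ‖X‖ ^ 2) (-(1 / 4) * ‖X‖ ^ 2) t :=
      (((hasDerivAt_id t).div_const 4).neg).mul_const _
    refine h1.exp.neg.congr_deriv ?_
    ring
  have := intervalIntegral.integral_eq_sub_of_hasDerivAt h (by
    apply Continuous.intervalIntegrable; fun_prop)
  rw [intervalIntegral.integral_mul_const] at this
  have e : -((1 : ℝ) / 4) * ‖X‖ ^ 2 = -(‖X‖ ^ 2 / 4) := by ring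
  rw [phj, this, gs, e]; simp [sub_eq_add_neg, add_comm]

theorem phi_mul (X : Plane) : phi X * ‖X‖ ^ 2 = 1 - gs X := by
  rw [← phj_zero_mul, phi]; ring

/-- Two facts are added: the integrand is smallest at `t = 1`, so `gs ≤ phj 0`, while `phj 0 ·
|X|²/4 = 1 - gs`. The resulting polynomial bound on `1/φ` keeps division by φ within `SM`. -/
theorem one_le_mul_phj (X : Plane) : 1 ≤ phj 0 X * (1 + ‖X‖ ^ 2 / 4) := by
  have hs : gs X ≤ phj 0 X := by
    have : ∫ _ in (0 : ℝ)..1, gs X ≤ phj 0 X := by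
      refine intervalIntegral.integral_mono_on (by norm_num)
        (continuous_const.intervalIntegrable _ _)
        ((continuous_phj_integrand 0 X).intervalIntegrable _ _) fun t ht => ?_
      simp only [pow_zero, one_mul]
      refine Real.exp_le_exp.2 ?_
      have := mul_le_mul_of_nonneg_right ht.2 (sq_nonneg ‖X‖)
      linarith
    simpa using this
  linarith [phj_zero_mul X]

theorem phj_zero_pos (X : Plane) : 0 < phj 0 X := by
  have := one_le_mul_phj X
  by_contra h
  have h0 : phj 0 X = 0 := le_antisymm (not_lt.1 h) (phj_nonneg 0 X)
  rw [h0] at this; linarith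

theorem phi_pos (X : Plane) : 0 < phi X := div_pos (phj_zero_pos X) (by norm_num)

theorem phi_le (X : Plane) : phi X ≤ 1 / 4 := by
  have := phj_le_one 0 X; unfold phi; linarith

/-- Differentiating under the integral only raises the power of `t`. The family `phj` is therefore
closed under differentiation up to coordinate factors, and φ is smooth at the origin without any
discussion of the quotient. -/
theorem hasFDerivAt_phj (j : ℕ) (X : Plane) :
    HasFDerivAt (phj j) ((-(1 / 2) * phj (j + 1) X) • innerSL ℝ X) X := by
  have hd : ∀ t : ℝ, ∀ X : Plane, HasFDerivAt
      (fun X : Plane => t ^ j * Real.exp (-(t / 4) * ‖X‖ ^ 2))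
      ((-(1 / 2) * (t ^ (j + 1) * Real.exp (-(t / 4) * ‖X‖ ^ 2))) • innerSL ℝ X) X := fun t X => by
    refine ((hasFDerivAt_exp_norm_sq (-(t / 4)) X).const_mul (t ^ j)).congr_fderiv ?_
    rw [smul_smul]; congr 1; ring
  have key := intervalIntegral.hasFDerivAt_integral_of_dominated_of_fderiv_le
    (μ := volume) (a := (0 : ℝ)) (b := 1) (𝕜 := ℝ) (x₀ := X) (s := Metric.ball X 1)
    (F := fun (X : Plane) (t : ℝ) => t ^ j * Real.exp (-(t / 4) * ‖X‖ ^ 2))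
    (F' := fun X t => (-(1 / 2) * (t ^ (j + 1) * Real.exp (-(t / 4) * ‖X‖ ^ 2))) • innerSL ℝ X)
    (bound := fun _ => ‖X‖ + 1) (Metric.ball_mem_nhds X one_pos)
    (Filter.Eventually.of_forall fun Z => (continuous_phj_integrand j Z).aestronglyMeasurable)
    ((continuous_phj_integrand j X).intervalIntegrable _ _)
    (Continuous.aestronglyMeasurable (by fun_prop))
    (Filter.Eventually.of_forall fun t ht Z hZ => ?_)
    (continuous_const.intervalIntegrable _ _)
    (Filter.Eventually.of_forall fun t _ Z _ => hd t Z)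
  · refine key.congr_fderiv ?_
    rw [intervalIntegral.integral_smul_const, intervalIntegral.integral_const_mul]
    rfl
  · rw [Set.uIoc_of_le (by norm_num)] at ht
    have hZ' : ‖Z‖ ≤ ‖X‖ + 1 := by
      have := norm_sub_norm_le Z X
      rw [Metric.mem_ball, dist_eq_norm] at hZ; linarith
    have h1 : t ^ (j + 1) * Real.exp (-(t / 4) * ‖Z‖ ^ 2) ≤ 1 := by
      refine mul_le_one₀ (pow_le_one₀ ht.1.le ht.2) (Real.exp_pos _).le (Real.exp_le_one_iff.2 ?_)
      have := mul_nonneg ht.1.le (sq_nonneg ‖Z‖)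
      linarith
    have h0 : 0 ≤ t ^ (j + 1) * Real.exp (-(t / 4) * ‖Z‖ ^ 2) :=
      mul_nonneg (pow_nonneg ht.1.le _) (Real.exp_pos _).le
    rw [norm_smul, innerSL_apply_norm, Real.norm_eq_abs, abs_mul, abs_of_nonneg h0,
      abs_neg, abs_of_pos (by norm_num : (0 : ℝ) < 1 / 2)]
    have := mul_le_mul_of_nonneg_right h1 (norm_nonneg Z)
    linarith [norm_nonneg Z]

theorem pd_phj (i : Fin 2) (j : ℕ) (X : Plane) :
    pd i (phj j) X = -(1 / 2) * X i * phj (j + 1) X := by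
  rw [pd, (hasFDerivAt_phj j X).fderiv]
  simp [inner_single]; ring

theorem SM.phj (j : ℕ) : SM (phj j) := by
  intro k
  have hd : ∀ j, Differentiable ℝ (VortexRing.phj j) :=
    fun j X => (hasFDerivAt_phj j X).differentiableAt
  have hb : ∀ j, PB (VortexRing.phj j) := fun j => PB.of_bound (C := 1) fun X => by
    rw [abs_of_nonneg (phj_nonneg j X)]; exact phj_le_one j X
  induction k generalizing j with
  | zero => exact ⟨(hd j).continuous, hb j⟩
  | succ k ih =>
    refine ⟨hd j, hb j, fun i => ?_⟩
    rw [funext (pd_phj i j)]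
    exact ((TG.coord i).smul _).mul (ih (j + 1))

theorem SM.inv_phj : SM fun X => (VortexRing.phj 0 X)⁻¹ := by
  intro k
  have hf : ∀ X, HasFDerivAt (fun X => (VortexRing.phj 0 X)⁻¹)
      ((-(VortexRing.phj 0 X ^ 2)⁻¹) • ((-(1 / 2) * VortexRing.phj 1 X) • innerSL ℝ X)) X := fun X =>
    (hasDerivAt_inv (phj_zero_pos X).ne').comp_hasFDerivAt X (hasFDerivAt_phj 0 X)
  have hd : Differentiable ℝ fun X => (VortexRing.phj 0 X)⁻¹ := fun X => (hf X).differentiableAt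
  have hb : PB fun X => (VortexRing.phj 0 X)⁻¹ := by
    refine PB.mono ((PB.const 1).add ((PB.norm.mul PB.norm).mul (PB.const (1 / 4)))) fun X => ?_
    rw [abs_of_nonneg (inv_nonneg.2 (phj_nonneg 0 X)), abs_of_nonneg (by positivity),
      inv_le_iff_one_le_mul₀ (phj_zero_pos X)]
    linarith [one_le_mul_phj X]
  induction k with
  | zero => exact ⟨hd.continuous, hb⟩
  | succ k ih =>
    refine ⟨hd, hb, fun i => ?_⟩
    have : VortexRing.pd i (fun X => (VortexRing.phj 0 X)⁻¹) = fun X =>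
        ((1 / 2 * X i) * VortexRing.phj 1 X) *
          ((VortexRing.phj 0 X)⁻¹ * (VortexRing.phj 0 X)⁻¹) := by
      funext X
      rw [VortexRing.pd, (hf X).fderiv]
      simp only [smul_apply, innerSL_apply_apply, inner_single, smul_eq_mul]
      rw [sq, mul_inv]; ring
    rw [this]
    exact (((TG.coord i).smul _).mul (SM.phj 1 k)).mul (ih.mul ih)

theorem SM.phi : SM phi := fun k => by
  have : VortexRing.phi = fun X => 1 / 4 * VortexRing.phj 0 X := by
    funext X; rw [VortexRing.phi]; ring
  rw [this]; exact (SM.phj 0 k).smul _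

theorem SM.inv_phi : SM fun X => (VortexRing.phi X)⁻¹ := fun k => by
  have : (fun X => (VortexRing.phi X)⁻¹) = fun X => 4 * (VortexRing.phj 0 X)⁻¹ := by
    funext X; rw [VortexRing.phi, inv_div, div_eq_mul_inv]
  rw [this]; exact (SM.inv_phj k).smul _

theorem gs_radial {X X' : Plane} (h : ‖X‖ = ‖X'‖) : gs X = gs X' := by
  rw [gs, gs, h]

theorem phi_radial {X X' : Plane} (h : ‖X‖ = ‖X'‖) : phi X = phi X' := by
  rw [phi, phi, phj, phj, h]

/-! ### Rotations and the angular modes. -/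

/-- The linear rotation map of angle `θ`. -/
def rotL (θ : ℝ) : Plane →ₗ[ℝ] Plane where
  toFun X := !₂[Real.cos θ * X 0 - Real.sin θ * X 1, Real.sin θ * X 0 + Real.cos θ * X 1]
  map_add' X X' := by ext i; fin_cases i <;> simp <;> ring
  map_smul' c X := by ext i; fin_cases i <;> simp <;> ring

/-- The rotation of angle `θ`. -/
def rot (θ : ℝ) : Plane ≃ₗᵢ[ℝ] Plane where
  toLinearEquiv := LinearEquiv.ofLinearMap (rotL θ) (rotL (-θ))
    (by
      ext X i; fin_cases i <;> simp [rotL]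
      · linear_combination (X 0) * Real.sin_sq_add_cos_sq θ
      · linear_combination (X 1) * Real.sin_sq_add_cos_sq θ)
    (by
      ext X i; fin_cases i <;> simp [rotL]
      · linear_combination (X 0) * Real.sin_sq_add_cos_sq θ
      · linear_combination (X 1) * Real.sin_sq_add_cos_sq θ)
  norm_map' X := by
    simp only [LinearEquiv.coe_ofLinearMap]
    rw [← sq_eq_sq₀ (norm_nonneg _) (norm_nonneg _), EuclideanSpace.real_norm_sq_eq,
      EuclideanSpace.real_norm_sq_eq]
    simp [rotL]
    linear_combination (X 0 ^ 2 + X 1 ^ 2) * Real.sin_sq_add_cos_sq θ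

theorem rot_zero_coord (θ : ℝ) (X : Plane) : rot θ X 0 = Real.cos θ * X 0 - Real.sin θ * X 1 := rfl

theorem rot_one_coord (θ : ℝ) (X : Plane) : rot θ X 1 = Real.sin θ * X 0 + Real.cos θ * X 1 := rfl

theorem rot_rot (θ θ' : ℝ) (X : Plane) : rot θ (rot θ' X) = rot (θ + θ') X := by
  ext i; fin_cases i <;>
  simp [rot_zero_coord, rot_one_coord, Real.cos_add, Real.sin_add] <;> ring

theorem rot_zero (X : Plane) : rot 0 X = X := by
  ext i; fin_cases i <;> simp [rot_zero_coord, rot_one_coord]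

theorem norm_rot (θ : ℝ) (X : Plane) : ‖rot θ X‖ = ‖X‖ := (rot θ).norm_map X

theorem continuous_rot_uncurry : Continuous fun p : Plane × ℝ => rot p.2 p.1 := by
  rw [← (PiLp.homeomorph 2 fun _ : Fin 2 => ℝ).comp_continuous_iff]
  refine continuous_pi fun i => ?_
  fin_cases i
  · change Continuous fun p : Plane × ℝ => Real.cos p.2 * p.1 0 - Real.sin p.2 * p.1 1
    fun_prop
  · change Continuous fun p : Plane × ℝ => Real.sin p.2 * p.1 0 + Real.cos p.2 * p.1 1
    fun_prop

theorem measurePreserving_rot (θ : ℝ) : MeasurePreserving (rot θ) (volume : Measure Plane) volume :=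
  (rot θ).measurePreserving

theorem measurePreserving_rot_gaussWeight (θ : ℝ) :
    MeasurePreserving (rot θ) gaussWeight gaussWeight := by
  refine ⟨(rot θ).continuous.measurable, ?_⟩
  ext s hs
  rw [Measure.map_apply (rot θ).continuous.measurable hs, gaussWeight,
    withDensity_apply _ ((rot θ).continuous.measurable hs), withDensity_apply _ hs,
    ← (measurePreserving_rot θ).setLIntegral_comp_preimage hs (by fun_prop)]
  simp only [norm_rot]

theorem ae_rot (θ : ℝ) {p : Plane → Prop} (h : ∀ᵐ X : Plane, p X) : ∀ᵐ X : Plane, p (rot θ X) :=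
  (measurePreserving_rot θ).quasiMeasurePreserving.ae h

theorem integral_rot (θ : ℝ) (f : Plane → ℝ) : ∫ X, f (rot θ X) = ∫ X, f X :=
  (measurePreserving_rot θ).integral_comp (rot θ).toHomeomorph.measurableEmbedding f

/-- The action of the rotations on `𝒴`. -/
def U (θ : ℝ) : Y →ₗᵢ[ℝ] Y :=
  Lp.compMeasurePreservingₗᵢ ℝ (rot θ) (measurePreserving_rot_gaussWeight θ)

theorem U_ae (θ : ℝ) (η : Y) : ∀ᵐ X : Plane, U θ η X = η (rot θ X) :=
  ae_gaussWeight ▸ Lp.coeFn_compMeasurePreserving η (measurePreserving_rot_gaussWeight θ)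

theorem U_U (θ θ' : ℝ) (η : Y) : U θ (U θ' η) = U (θ + θ') η := by
  refine Y_ext ?_
  filter_upwards [U_ae θ (U θ' η), ae_rot θ (U_ae θ' η), U_ae (θ + θ') η] with X h1 h2 h3
  rw [h1, h2, h3, rot_rot, add_comm]

theorem U_eq_toY (θ : ℝ) {w : Plane → ℝ} (hw : Adm w) :
    Adm (fun X => w (rot θ X)) ∧ U θ (toY w) = toY fun X => w (rot θ X) := by
  refine eq_toY ?_
  filter_upwards [U_ae θ (toY w), ae_rot θ (toY_ae hw)] with X h1 h2
  rw [h1, h2, gs_radial (norm_rot θ X)]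

/-- The rotation by a quarter period of the `n`-th angular mode. -/
def Jn (n : ℕ) : Y →ₗᵢ[ℝ] Y := U (Real.pi / (2 * n))

/-- The `n`-th angular mode, as a linear subspace of `𝒴`. -/
def YnS (n : ℕ) : Submodule ℝ Y where
  carrier := {η | ∀ θ : ℝ, U θ η = Real.cos (n * θ) • η + Real.sin (n * θ) • Jn n η}
  add_mem' {η ζ} h1 h2 θ := by rw [map_add, map_add, h1, h2]; module
  zero_mem' θ := by simp
  smul_mem' c η h θ := by rw [map_smul, map_smul, h]; module

theorem isClosed_YnS (n : ℕ) : IsClosed (YnS n : Set Y) := by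
  have : (YnS n : Set Y) =
      ⋂ θ : ℝ, {η : Y | U θ η = Real.cos (n * θ) • η + Real.sin (n * θ) • Jn n η} := by
    ext η; simp [YnS]
  rw [this]
  refine isClosed_iInter fun θ => isClosed_eq (U θ).continuous ?_
  exact (continuous_id.const_smul (Real.cos (n * θ))).add
    ((Jn n).continuous.const_smul (Real.sin (n * θ)))

theorem U_mem_YnS {n : ℕ} {η : Y} (h : η ∈ YnS n) (θ : ℝ) : U θ η ∈ YnS n := by
  intro θ'
  rw [Jn, U_U, U_U, add_comm θ', add_comm _ θ, ← U_U, ← U_U, h θ', map_add, map_smul, map_smul]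
  rfl

/-- Two quarter periods make the angle `π / n`, where `cos (nθ) = -1` and `sin (nθ) = 0`. On the
mode, `J` is thus a complex structure. -/
theorem Jn_Jn {n : ℕ} (hn : 1 ≤ n) {η : Y} (h : η ∈ YnS n) : Jn n (Jn n η) = -η := by
  have hn' : (n : ℝ) ≠ 0 := by positivity
  have e : Real.pi / (2 * n) + Real.pi / (2 * n) = Real.pi / n := by field_simp; norm_num
  have e2 : (n : ℝ) * (Real.pi / n) = Real.pi := by field_simp
  have := h (Real.pi / n)
  rw [e2] at this
  rw [Jn, U_U, e, this]; simp

/-- The point of the plane with polar coordinates `ρ`, `ϑ`. -/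
def polar (ρ ϑ : ℝ) : Plane := !₂[ρ * Real.cos ϑ, ρ * Real.sin ϑ]

theorem polar_zero (ρ ϑ : ℝ) : polar ρ ϑ 0 = ρ * Real.cos ϑ := rfl

theorem polar_one (ρ ϑ : ℝ) : polar ρ ϑ 1 = ρ * Real.sin ϑ := rfl

theorem rot_polar (θ ρ ϑ : ℝ) : rot θ (polar ρ ϑ) = polar ρ (ϑ + θ) := by
  ext i; fin_cases i <;>
  simp [rot_zero_coord, rot_one_coord, polar, Real.cos_add, Real.sin_add] <;> ring

theorem norm_polar {ρ : ℝ} (hρ : 0 ≤ ρ) (ϑ : ℝ) : ‖polar ρ ϑ‖ = ρ := by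
  rw [← sq_eq_sq₀ (norm_nonneg _) hρ, EuclideanSpace.real_norm_sq_eq]
  simp [polar]
  linear_combination ρ ^ 2 * Real.sin_sq_add_cos_sq ϑ

theorem exists_polar (X : Plane) : ∃ ϑ, X = polar ‖X‖ ϑ := by
  have h : ‖(⟨X 0, X 1⟩ : ℂ)‖ = ‖X‖ := by
    rw [← sq_eq_sq₀ (norm_nonneg _) (norm_nonneg _), EuclideanSpace.real_norm_sq_eq,
      Complex.sq_norm, Complex.normSq_mk]
    simp [sq]
  refine ⟨Complex.arg ⟨X 0, X 1⟩, ?_⟩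
  ext i; fin_cases i
  · simp [polar, ← h, Complex.norm_mul_cos_arg]
  · simp [polar, ← h, Complex.norm_mul_sin_arg]

theorem integral_cos_sq_nat {n : ℕ} (hn : 1 ≤ n) :
    ∫ θ in (0 : ℝ)..2 * Real.pi, Real.cos (n * θ) * Real.cos (n * θ) = Real.pi := by
  have hn' : (n : ℝ) ≠ 0 := by positivity
  have h := intervalIntegral.integral_comp_mul_left (a := 0) (b := 2 * Real.pi)
    (fun x => Real.cos x ^ 2) hn'
  have h2 : Real.sin (n * (2 * Real.pi)) = 0 := by
    have := Real.sin_nat_mul_pi (2 * n); push_cast at this; rw [← this]; ring_nf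
  simp only [← sq]
  rw [h, integral_cos_sq, h2]; simp; field_simp

theorem integral_sin_sq_nat {n : ℕ} (hn : 1 ≤ n) :
    ∫ θ in (0 : ℝ)..2 * Real.pi, Real.sin (n * θ) * Real.sin (n * θ) = Real.pi := by
  have hn' : (n : ℝ) ≠ 0 := by positivity
  have h := intervalIntegral.integral_comp_mul_left (a := 0) (b := 2 * Real.pi)
    (fun x => Real.sin x ^ 2) hn'
  have h2 : Real.sin (n * (2 * Real.pi)) = 0 := by
    have := Real.sin_nat_mul_pi (2 * n); push_cast at this; rw [← this]; ring_nf
  simp only [← sq]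
  rw [h, integral_sin_sq, h2]; simp; field_simp

theorem integral_sin_mul_cos_nat {n : ℕ} (hn : 1 ≤ n) :
    ∫ θ in (0 : ℝ)..2 * Real.pi, Real.sin (n * θ) * Real.cos (n * θ) = 0 := by
  have hn' : (n : ℝ) ≠ 0 := by positivity
  have h := intervalIntegral.integral_comp_mul_left (a := 0) (b := 2 * Real.pi)
    (fun x => Real.sin x * Real.cos x) hn'
  have h2 : Real.sin (n * (2 * Real.pi)) = 0 := by
    have := Real.sin_nat_mul_pi (2 * n); push_cast at this; rw [← this]; ring_nf
  rw [h, integral_sin_mul_cos₁, h2]; simp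

theorem mem_YnS_of_mem_Yn {n : ℕ} (hn : 1 ≤ n) {η : Y} (h : η ∈ Yn n) : η ∈ YnS n := by
  obtain ⟨a₁, a₂, h⟩ := h
  intro θ
  have hn' : (n : ℝ) ≠ 0 := by positivity
  have h0 : ∀ᵐ X : Plane, X ≠ 0 := by simp [ae_iff]
  refine Y_ext ?_
  filter_upwards [h0, h, ae_rot θ h, ae_rot (Real.pi / (2 * n)) h, U_ae θ η,
    U_ae (Real.pi / (2 * n)) η, Y_add_ae (Real.cos (n * θ) • η) (Real.sin (n * θ) • Jn n η),
    Y_smul_ae (Real.cos (n * θ)) η, Y_smul_ae (Real.sin (n * θ)) (Jn n η)]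
    with X h0 h1 h2 h3 h4 h5 h6 h7 h8
  obtain ⟨ϑ, hϑ⟩ := exists_polar X
  have hρ : 0 < ‖X‖ := norm_pos_iff.2 h0
  rw [h4, h6, h7, h8]
  have h5' : (Jn n η) X = η (rot (Real.pi / (2 * n)) X) := h5
  rw [h5', h1 ‖X‖ ϑ hρ hϑ, h2 ‖X‖ (ϑ + θ) hρ ((congrArg (rot _) hϑ).trans (rot_polar _ _ ϑ)),
    h3 ‖X‖ (ϑ + Real.pi / (2 * n)) hρ ((congrArg (rot _) hϑ).trans (rot_polar _ _ ϑ))]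
  have e : (n : ℝ) * (ϑ + Real.pi / (2 * n)) = n * ϑ + Real.pi / 2 := by field_simp
  rw [e, mul_add, Real.cos_add, Real.sin_add, Real.cos_add_pi_div_two, Real.sin_add_pi_div_two]
  ring

/-- The rotation law holds almost everywhere for each angle. The radial amplitudes are recovered
from it as Fourier coefficients on circles. -/
theorem mem_Yn_of_mem_YnS {n : ℕ} (hn : 1 ≤ n) {η : Y} (h : η ∈ YnS n) : η ∈ Yn n := by
  set ζ := Jn n η with hζ
  have hms : Measurable fun X => η X := (Lp.stronglyMeasurable η).measurable
  have hmz : Measurable fun X => ζ X := (Lp.stronglyMeasurable ζ).measurable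
  -- Exchanging the order of the null sets: for almost every `X` the law holds at almost every point
  -- of the circle through `X`.
  have key : ∀ᵐ X : Plane, ∀ᵐ θ : ℝ,
      η (rot θ X) = Real.cos (n * θ) * η X + Real.sin (n * θ) * ζ X := by
    rw [Measure.ae_ae_comm]
    · refine Filter.Eventually.of_forall fun θ => ?_
      have h1 := U_ae θ η
      rw [h θ] at h1
      filter_upwards [h1, Y_add_ae (Real.cos (n * θ) • η) (Real.sin (n * θ) • Jn n η),
        Y_smul_ae (Real.cos (n * θ)) η, Y_smul_ae (Real.sin (n * θ)) (Jn n η)] with X h1 h2 h3 h4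
      rw [← h1, h2, h3, h4]
    · refine measurableSet_eq_fun (hms.comp continuous_rot_uncurry.measurable) ?_
      have h1 : Measurable fun p : Plane × ℝ => Real.cos (n * p.2) := by fun_prop
      have h2 : Measurable fun p : Plane × ℝ => Real.sin (n * p.2) := by fun_prop
      exact (h1.mul (hms.comp measurable_fst)).add (h2.mul (hmz.comp measurable_fst))
  -- These integrals depend on the circle only, whichever good point `X` on it is used to evaluate
  -- them.
  refine ⟨fun ρ => 1 / Real.pi * ∫ t in (0 : ℝ)..2 * Real.pi, η (polar ρ t) * Real.cos (n * t),
    fun ρ => 1 / Real.pi * ∫ t in (0 : ℝ)..2 * Real.pi, η (polar ρ t) * Real.sin (n * t), ?_⟩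
  filter_upwards [key] with X hX ρ ϑ hρ hXp
  change X = polar ρ ϑ at hXp
  have hper : ∀ t, polar ρ (t + 2 * Real.pi) = polar ρ t := fun t => by
    simp [polar]
  have hpc : ∀ t : ℝ, Real.cos (n * (t + 2 * Real.pi)) = Real.cos (n * t) := fun t => by
    rw [mul_add]; exact Real.cos_add_nat_mul_two_pi _ n
  have hps : ∀ t : ℝ, Real.sin (n * (t + 2 * Real.pi)) = Real.sin (n * t) := fun t => by
    rw [mul_add]; exact Real.sin_add_nat_mul_two_pi _ n
  have shift : ∀ g : ℝ → ℝ, (∀ t, g (t + 2 * Real.pi) = g t) →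
      ∫ t in (0 : ℝ)..2 * Real.pi, η (polar ρ t) * g t =
      ∫ θ in (0 : ℝ)..2 * Real.pi,
        (Real.cos (n * θ) * η X + Real.sin (n * θ) * ζ X) * g (ϑ + θ) := fun g hg => by
    have hp : Function.Periodic (fun t => η (polar ρ t) * g t) (2 * Real.pi) := fun t => by
      simp only [hper, hg]
    have h1 := hp.intervalIntegral_add_eq 0 ϑ
    rw [zero_add] at h1
    rw [h1]
    have h2 := intervalIntegral.integral_comp_add_left (a := 0) (b := 2 * Real.pi)
      (fun t => η (polar ρ t) * g t) ϑ
    rw [add_zero] at h2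
    rw [← h2]
    refine intervalIntegral.integral_congr_ae ?_
    filter_upwards [hX] with θ hθ _
    rw [← hθ, hXp, rot_polar]
  have lin : ∀ c d : ℝ, ∀ f₁ f₂ : ℝ → ℝ, Continuous f₁ → Continuous f₂ →
      ∫ θ in (0 : ℝ)..2 * Real.pi, (c * f₁ θ + d * f₂ θ) =
        c * (∫ θ in (0 : ℝ)..2 * Real.pi, f₁ θ) + d * ∫ θ in (0 : ℝ)..2 * Real.pi, f₂ θ :=
    fun c d f₁ f₂ h1 h2 => by
      rw [intervalIntegral.integral_add ((h1.const_mul c).intervalIntegrable _ _)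
        ((h2.const_mul d).intervalIntegrable _ _), intervalIntegral.integral_const_mul,
        intervalIntegral.integral_const_mul]
  have full : ∀ p q r : ℝ, ∫ θ in (0 : ℝ)..2 * Real.pi,
      (p * (Real.cos (n * θ) * Real.cos (n * θ)) + (q * (Real.sin (n * θ) * Real.sin (n * θ)) +
        r * (Real.sin (n * θ) * Real.cos (n * θ)))) = (p + q) * Real.pi := fun p q r => by
    have h1 := lin p 1 (fun θ => Real.cos (n * θ) * Real.cos (n * θ))
      (fun θ => q * (Real.sin (n * θ) * Real.sin (n * θ)) +
        r * (Real.sin (n * θ) * Real.cos (n * θ))) (by fun_prop) (by fun_prop)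
    have h2 := lin q r (fun θ => Real.sin (n * θ) * Real.sin (n * θ))
      (fun θ => Real.sin (n * θ) * Real.cos (n * θ)) (by fun_prop) (by fun_prop)
    simp only [one_mul] at h1
    rw [h1, h2, integral_cos_sq_nat hn, integral_sin_sq_nat hn, integral_sin_mul_cos_nat hn]
    ring
  have e1 := full (η X * Real.cos (n * ϑ)) (-(ζ X * Real.sin (n * ϑ)))
    (ζ X * Real.cos (n * ϑ) - η X * Real.sin (n * ϑ))
  have e2 := full (η X * Real.sin (n * ϑ)) (ζ X * Real.cos (n * ϑ))
    (η X * Real.cos (n * ϑ) + ζ X * Real.sin (n * ϑ))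
  have i1 := shift (fun t => Real.cos (n * t)) hpc
  have i2 := shift (fun t => Real.sin (n * t)) hps
  have j1 : ∫ t in (0 : ℝ)..2 * Real.pi, η (polar ρ t) * Real.cos (n * t) =
      (η X * Real.cos (n * ϑ) + -(ζ X * Real.sin (n * ϑ))) * Real.pi := by
    rw [i1, ← e1]
    refine intervalIntegral.integral_congr fun θ _ => ?_
    simp only [mul_add, Real.cos_add]; ring
  have j2 : ∫ t in (0 : ℝ)..2 * Real.pi, η (polar ρ t) * Real.sin (n * t) =
      (η X * Real.sin (n * ϑ) + ζ X * Real.cos (n * ϑ)) * Real.pi := by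
    rw [i2, ← e2]
    refine intervalIntegral.integral_congr fun θ _ => ?_
    simp only [mul_add, Real.sin_add]; ring
  have hpi := Real.pi_ne_zero
  rw [j1, j2]
  field_simp
  linear_combination (-η X) * Real.sin_sq_add_cos_sq (n * ϑ)

theorem mem_Yn_iff {n : ℕ} (hn : 1 ≤ n) {η : Y} : η ∈ Yn n ↔ η ∈ YnS n :=
  ⟨mem_YnS_of_mem_Yn hn, mem_Yn_of_mem_YnS hn⟩

/-! ### The logarithmic potential as a bounded symmetric operator. -/

/-- The logarithmic kernel. -/
def kl (x : Plane) : ℝ := Real.log (8 / ‖x‖)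

theorem measurable_kl : Measurable kl := by unfold kl; fun_prop

/-- The inequality `log² t ≤ 4 t` for `t ≥ 1` is applied to `8/|x|` inside the disk of radius 8 and
to `|x|/8` outside. -/
theorem kl_sq_le (x : Plane) : kl x ^ 2 ≤ 32 * ‖x‖ ^ (-1 : ℝ) + ‖x‖ := by
  rcases eq_or_ne x 0 with rfl | hx
  · simp [kl]
  have hr : 0 < ‖x‖ := norm_pos_iff.2 hx
  have aux : ∀ t : ℝ, 1 ≤ t → Real.log t ^ 2 ≤ 4 * t := fun t ht => by
    have h1 := Real.log_le_rpow_div (x := t) (by linarith) (ε := 1 / 2) (by norm_num)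
    have h2 : (t ^ (1 / 2 : ℝ) / (1 / 2)) ^ 2 = 4 * t := by
      rw [div_pow, ← Real.rpow_natCast, ← Real.rpow_mul (by linarith)]; norm_num; ring
    rw [← h2]
    exact pow_le_pow_left₀ (Real.log_nonneg ht) h1 2
  rw [Real.rpow_neg_one, kl]
  rcases le_total ‖x‖ 8 with h | h
  · refine (aux _ ((one_le_div hr).2 h)).trans ?_
    have : 4 * (8 / ‖x‖) = 32 * ‖x‖⁻¹ := by field_simp; norm_num
    linarith
  · have e : Real.log (8 / ‖x‖) = -Real.log (‖x‖ / 8) := by rw [← Real.log_inv, inv_div]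
    rw [e, neg_sq]
    refine (aux _ ((one_le_div (by norm_num)).2 h)).trans ?_
    have : 0 < ‖x‖⁻¹ := inv_pos.2 hr
    linarith

/-- The integral of `|x|^{-α}` over the unit disk. -/
def diskInt (α : ℝ) : ℝ := ∫ x in Metric.ball (0 : Plane) 1, ‖x‖ ^ (-α)

theorem integrableOn_rpow_neg {α : ℝ} (hα : α < 2) :
    IntegrableOn (fun x : Plane => ‖x‖ ^ (-α)) (Metric.ball 0 1) := by
  refine integrableOn_ball_of_norm_le_rpow (C := 1) (α := α) (by simp) (by simpa using hα)
    (Filter.Eventually.of_forall fun x => ?_) (Measurable.aestronglyMeasurable (by fun_prop))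
  rw [one_mul, Real.norm_of_nonneg (by positivity)]

/-- Within distance 1 of `X` the density is bounded by `M` and the kernel is integrable; farther
away the kernel is at most 1. The bound is uniform in `X`. -/
theorem singular_integral {α : ℝ} (h0 : 0 ≤ α) (hα : α < 2) {g : Plane → ℝ} {M : ℝ}
    (hM : ∀ X, |g X| ≤ M) (hg : Integrable g) (X : Plane) :
    Integrable (fun X' => ‖X - X'‖ ^ (-α) * |g X'|) ∧
      ∫ X', ‖X - X'‖ ^ (-α) * |g X'| ≤ M * diskInt α + ∫ X', |g X'| := by
  set b : Plane → ℝ := (Metric.ball (0 : Plane) 1).indicator fun x => ‖x‖ ^ (-α) with hb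
  have hbi : Integrable b := (integrableOn_rpow_neg hα).integrable_indicator
    Metric.isOpen_ball.measurableSet
  have hbX : Integrable fun X' => b (X - X') := hbi.comp_sub_left X
  have hM0 : 0 ≤ M := (abs_nonneg _).trans (hM 0)
  have hle : ∀ X', ‖X - X'‖ ^ (-α) * |g X'| ≤ M * b (X - X') + |g X'| := fun X' => by
    by_cases h : X - X' ∈ Metric.ball (0 : Plane) 1
    · rw [hb, Set.indicator_of_mem h, mul_comm M]
      have : 0 ≤ ‖X - X'‖ ^ (-α) := by positivity
      have := mul_le_mul_of_nonneg_left (hM X') this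
      linarith [abs_nonneg (g X')]
    · rw [hb, Set.indicator_of_notMem h, mul_zero, zero_add]
      rw [mem_ball_zero_iff, not_lt] at h
      have : ‖X - X'‖ ^ (-α) ≤ 1 := Real.rpow_le_one_of_one_le_of_nonpos h (by linarith)
      exact mul_le_of_le_one_left (abs_nonneg _) this
  have hint : Integrable fun X' => M * b (X - X') + |g X'| := (hbX.const_mul M).add hg.abs
  have hI : Integrable (fun X' => ‖X - X'‖ ^ (-α) * |g X'|) := by
    refine hint.mono' ?_ (Filter.Eventually.of_forall fun X' => ?_)
    · exact AEStronglyMeasurable.mul (Measurable.aestronglyMeasurable (by fun_prop))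
        hg.1.norm
    · rw [Real.norm_of_nonneg (by positivity)]; exact hle X'
  refine ⟨hI, (integral_mono hI hint hle).trans (le_of_eq ?_)⟩
  rw [integral_add (hbX.const_mul M) hg.abs, integral_const_mul, integral_sub_left_eq_self b,
    hb, integral_indicator Metric.isOpen_ball.measurableSet, diskInt]

theorem integrable_gs : Integrable gs := by
  simpa using (PB.const 1).integrable aestronglyMeasurable_const

theorem abs_gs_le (X : Plane) : |gs X| ≤ 1 := by rw [abs_of_pos (gs_pos X)]; exact gs_le_one X

theorem exists_kl_bound : ∃ C : ℝ, 0 < C ∧ ∀ X,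
    Integrable (fun X' => gs X' * kl (X - X') ^ 2) ∧
      ∫ X', gs X' * kl (X - X') ^ 2 ≤ C * (1 + ‖X‖) := by
  set G := ∫ X', gs X' with hG
  set G1 := ∫ X', gs X' * ‖X'‖ with hG1
  have hG0 : 0 ≤ G := integral_nonneg fun X => (gs_pos X).le
  have hG10 : 0 ≤ G1 := integral_nonneg fun X => mul_nonneg (gs_pos X).le (norm_nonneg _)
  have hn : Integrable fun X' : Plane => gs X' * ‖X'‖ :=
    PB.norm.integrable (by fun_prop)
  have hD : 0 ≤ diskInt 1 := integral_nonneg fun X => by positivity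
  refine ⟨32 * (diskInt 1 + G) + G + G1 + 1, by positivity, fun X => ?_⟩
  obtain ⟨h1, h2⟩ := singular_integral (α := 1) (by norm_num) (by norm_num) abs_gs_le
    integrable_gs X
  simp only [abs_of_pos (gs_pos _)] at h1 h2
  have hle : ∀ X', gs X' * kl (X - X') ^ 2 ≤
      32 * (‖X - X'‖ ^ (-1 : ℝ) * gs X') + (‖X‖ * gs X' + gs X' * ‖X'‖) := fun X' => by
    have a1 := kl_sq_le (X - X')
    have a2 := norm_sub_le X X'
    have := mul_le_mul_of_nonneg_left (a1.trans (add_le_add_right a2 _)) (gs_pos X').le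
    linarith
  have hint : Integrable fun X' =>
      32 * (‖X - X'‖ ^ (-1 : ℝ) * gs X') + (‖X‖ * gs X' + gs X' * ‖X'‖) :=
    (h1.const_mul 32).add ((integrable_gs.const_mul _).add hn)
  have hI : Integrable (fun X' => gs X' * kl (X - X') ^ 2) := by
    refine hint.mono' ?_ (Filter.Eventually.of_forall fun X' => ?_)
    · exact continuous_gs.aestronglyMeasurable.mul
        ((measurable_kl.comp (measurable_const.sub measurable_id)).pow_const 2).aestronglyMeasurable
    · rw [Real.norm_of_nonneg (mul_nonneg (gs_pos _).le (sq_nonneg _))]; exact hle X'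
  refine ⟨hI, (integral_mono hI hint hle).trans ?_⟩
  have e1 : Integrable fun X' => ‖X‖ * gs X' := integrable_gs.const_mul _
  have e2 : Integrable fun X' => ‖X‖ * gs X' + gs X' * ‖X'‖ := e1.add hn
  rw [integral_add (h1.const_mul 32) e2, integral_add e1 hn,
    integral_const_mul, integral_const_mul, ← hG, ← hG1]
  rw [← hG] at h2
  nlinarith [norm_nonneg X, mul_nonneg (norm_nonneg X) hG0, mul_nonneg (norm_nonneg X) hG10,
    mul_nonneg (norm_nonneg X) hD]

theorem adm_kl (X : Plane) : Adm fun X' => kl (X - X') := by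
  obtain ⟨C, _, h⟩ := exists_kl_bound
  exact (adm_iff (measurable_kl.comp (measurable_const.sub measurable_id)).aestronglyMeasurable).2
    (h X).1

theorem logPot_eq (f : Plane → ℝ) (X : Plane) : logPot f X = ∫ X', kl (X - X') * f X' := rfl

theorem logPot_congr {f g : Plane → ℝ} (h : ∀ᵐ X, f X = g X) : logPot f = logPot g := by
  funext X
  refine integral_congr_ae ?_
  filter_upwards [h] with X' h
  rw [h]

theorem logPot_toY {w : Plane → ℝ} (hw : Adm w) :
    logPot (toY w) = logPot fun X => gs X * w X := logPot_congr (toY_ae hw)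

theorem integrable_kl_mul (η : Y) (X : Plane) : Integrable fun X' => kl (X - X') * η X' := by
  simpa [mul_comm] using integrable_mul_adm η (adm_kl X)

theorem logPot_eq_inner (η : Y) (X : Plane) :
    logPot η X = inner ℝ η (toY fun X' => kl (X - X')) := by
  rw [inner_toY η (adm_kl X), logPot_eq]; simp [mul_comm]

theorem norm_toY_sq {w : Plane → ℝ} (hw : Adm w) : ‖toY w‖ ^ 2 = ∫ X, gs X * w X ^ 2 := by
  rw [← real_inner_self_eq_norm_sq, inner_toY_toY hw hw]; simp only [sq]

theorem norm_Y_sq (η : Y) : ‖η‖ ^ 2 = ∫ X, η X * η X * Real.exp (‖X‖ ^ 2 / 4) := by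
  rw [← real_inner_self_eq_norm_sq, inner_Y]

/-- The value at `X` is an inner product with the translated kernel, whose squared norm in `𝒴` grows
at most linearly. So `L η` makes sense pointwise for every `η ∈ 𝒴`. -/
theorem exists_logPot_bound : ∃ C : ℝ, 0 < C ∧ ∀ (η : Y) (X : Plane),
    logPot η X ^ 2 ≤ C * (1 + ‖X‖) * ‖η‖ ^ 2 := by
  obtain ⟨C, hC, h⟩ := exists_kl_bound
  refine ⟨C, hC, fun η X => ?_⟩
  have h1 := (h X).2
  rw [← norm_toY_sq (adm_kl X)] at h1
  rw [logPot_eq_inner, ← sq_abs]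
  calc _ ≤ (‖η‖ * ‖toY fun X' => kl (X - X')‖) ^ 2 :=
        pow_le_pow_left₀ (abs_nonneg _) (abs_real_inner_le_norm _ _) 2
    _ = ‖toY fun X' => kl (X - X')‖ ^ 2 * ‖η‖ ^ 2 := by ring
    _ ≤ _ := by gcongr

theorem pb_logPot (η : Y) : PB (logPot η) := by
  obtain ⟨C, hC, h⟩ := exists_logPot_bound
  refine PB.mono (u := fun X => (1 : ℝ) + (C * ‖η‖ ^ 2) * (1 + ‖X‖))
    ((PB.const 1).add ((PB.const _).mul ((PB.const 1).add PB.norm))) fun X => ?_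
  rw [abs_of_nonneg (a := (1 : ℝ) + _) (by positivity)]
  have := h η X
  rw [← sq_abs] at this
  nlinarith [sq_nonneg (|logPot η X| - 1), abs_nonneg (logPot η X)]

theorem stronglyMeasurable_logPot (η : Y) : StronglyMeasurable (logPot η) := by
  have : StronglyMeasurable (Function.uncurry fun X X' : Plane => kl (X - X') * η X') := by
    refine StronglyMeasurable.mul ?_ ((Lp.stronglyMeasurable η).comp_measurable measurable_snd)
    exact (measurable_kl.comp (measurable_fst.sub measurable_snd)).stronglyMeasurable
  exact this.integral_prod_right

theorem adm_logPot (η : Y) : Adm (logPot η) :=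
  (pb_logPot η).adm (stronglyMeasurable_logPot η).aestronglyMeasurable

theorem adm_const_mul {w : Plane → ℝ} (c : ℝ) (hw : Adm w) : Adm fun X => c * w X := by
  have := MemLp.const_mul hw c
  refine (memLp_congr_ae (Filter.Eventually.of_forall fun X => ?_)).1 this
  ring

theorem logPot_add (η ζ : Y) (X : Plane) : logPot (η + ζ : Y) X = logPot η X + logPot ζ X := by
  simp only [logPot_eq_inner, inner_add_left]

theorem logPot_smul (c : ℝ) (η : Y) (X : Plane) : logPot (c • η : Y) X = c * logPot η X := by
  simp only [logPot_eq_inner, inner_smul_left]; rfl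

theorem exists_toY_logPot_bound : ∃ C : ℝ, 0 ≤ C ∧ ∀ η : Y, ‖toY (logPot η)‖ ≤ C * ‖η‖ := by
  obtain ⟨C, hC, h⟩ := exists_logPot_bound
  have hi : Integrable fun X : Plane => gs X * (1 + ‖X‖) :=
    ((PB.const 1).add PB.norm).integrable (by fun_prop)
  have hI0 : 0 ≤ ∫ X : Plane, gs X * (1 + ‖X‖) :=
    integral_nonneg fun X => mul_nonneg (gs_pos X).le (by positivity)
  refine ⟨√(C * ∫ X : Plane, gs X * (1 + ‖X‖)), Real.sqrt_nonneg _, fun η => ?_⟩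
  refine abs_le_of_sq_le_sq' ?_ (by positivity) |>.2
  rw [mul_pow, Real.sq_sqrt (by positivity), norm_toY_sq (adm_logPot η), ← integral_const_mul,
    ← integral_mul_const]
  refine integral_mono ((adm_iff (stronglyMeasurable_logPot η).aestronglyMeasurable).1
    (adm_logPot η)) ((hi.const_mul _).mul_const _) fun X => ?_
  have := mul_le_mul_of_nonneg_left (h η X) (gs_pos X).le
  simp only; linarith

/-- The bounded operator `η ↦ η₀ L η` on `𝒴`. -/
def Kop : Y →L[ℝ] Y :=
  ((1 / (4 * Real.pi)) : ℝ) • LinearMap.mkContinuousOfExistsBound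
    { toFun := fun η : Y => toY (logPot η)
      map_add' := fun (η ζ : Y) => by
        rw [← toY_add (adm_logPot η) (adm_logPot ζ)]; congr 1; funext X; exact logPot_add η ζ X
      map_smul' := fun c (η : Y) => by
        rw [RingHom.id_apply, ← toY_smul c (adm_logPot η)]; congr 1; funext X
        exact logPot_smul c η X }
    (by obtain ⟨C, _, h⟩ := exists_toY_logPot_bound; exact ⟨C, h⟩)

theorem Kop_apply (η : Y) : Kop η = toY fun X => 1 / (4 * Real.pi) * logPot η X := by
  rw [toY_smul _ (adm_logPot η)]; rfl

/-- Absolute convergence of the double integral, needed to apply Fubini in the symmetry of `Kop`. -/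
theorem integrable_kl_mul_mul (η ζ : Y) : Integrable
    (Function.uncurry fun X X' : Plane => kl (X - X') * η X' * ζ X) (volume.prod volume) := by
  obtain ⟨C, hC, h⟩ := exists_kl_bound
  have hm : AEStronglyMeasurable (Function.uncurry fun X X' : Plane => kl (X - X') * η X' * ζ X)
      (volume.prod volume) := by
    refine StronglyMeasurable.aestronglyMeasurable ?_
    refine StronglyMeasurable.mul (StronglyMeasurable.mul ?_
      ((Lp.stronglyMeasurable η).comp_measurable measurable_snd))
      ((Lp.stronglyMeasurable ζ).comp_measurable measurable_fst)
    exact (measurable_kl.comp (measurable_fst.sub measurable_snd)).stronglyMeasurable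
  rw [integrable_prod_iff hm]
  refine ⟨Filter.Eventually.of_forall fun X => (integrable_kl_mul η X).mul_const (ζ X), ?_⟩
  have hz : Integrable fun X : Plane => ζ X * (C * (1 + ‖X‖) + ‖η‖ ^ 2) :=
    integrable_mul_adm ζ ((((PB.const C).mul ((PB.const 1).add PB.norm)).add
      (PB.const _)).adm (by fun_prop))
  refine hz.norm.mono' hm.norm.integral_prod_right' (Filter.Eventually.of_forall fun X => ?_)
  have e : ∀ X', ‖Function.uncurry (fun X X' : Plane => kl (X - X') * η X' * ζ X) (X, X')‖ =
      |ζ X| * |kl (X - X') * η X'| := fun X' => by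
    simp [Function.uncurry, abs_mul]; ring
  simp only [e]
  rw [integral_const_mul, Real.norm_of_nonneg (mul_nonneg (abs_nonneg _)
    (integral_nonneg fun _ => abs_nonneg _)), norm_mul, Real.norm_eq_abs]
  have h0 : (0 : ℝ) ≤ C * (1 + ‖X‖) + ‖η‖ ^ 2 := by positivity
  rw [Real.norm_of_nonneg h0]
  refine mul_le_mul_of_nonneg_left ?_ (abs_nonneg _)
  have hη := integrable_Y_mul η η
  calc ∫ X', |kl (X - X') * η X'|
      ≤ ∫ X', (gs X' * kl (X - X') ^ 2 + η X' * η X' * Real.exp (‖X'‖ ^ 2 / 4)) := by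
        refine integral_mono (integrable_kl_mul η X).abs ((h X).1.add hη) fun X' => ?_
        simp only
        set a := kl (X - X')
        set b := η X'
        set g := gs X'
        set e := Real.exp (‖X'‖ ^ 2 / 4)
        have hg : 0 < g := gs_pos X'
        have hge : g * e = 1 := gs_mul_exp X'
        have he : 0 < e := Real.exp_pos _
        rw [abs_mul]
        -- Weighted arithmetic-geometric mean: with `g e = 1` this gives `2|ab| ≤ g a² + e b²`.
        have h1 : 0 ≤ g * (|a| - e * |b|) ^ 2 := by positivity
        have h2 : g * (|a| - e * |b|) ^ 2 = g * a ^ 2 - 2 * (|a| * |b|) + b * b * e := by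
          rw [← sq_abs a, ← abs_mul_abs_self b]
          linear_combination (e * |b| ^ 2 - 2 * |a| * |b|) * hge
        have h3 : 0 ≤ |a| * |b| := by positivity
        linarith
    _ = (∫ X', gs X' * kl (X - X') ^ 2) + ‖η‖ ^ 2 := by
        rw [integral_add (h X).1 hη, norm_Y_sq]
    _ ≤ _ := by linarith [(h X).2]

theorem kl_symm (X X' : Plane) : kl (X - X') = kl (X' - X) := by
  rw [kl, kl, norm_sub_rev]

theorem inner_Kop (η ζ : Y) : inner ℝ (Kop η) ζ = inner ℝ η (Kop ζ) := by
  have key : ∀ η ζ : Y, inner ℝ ζ (Kop η) =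
      1 / (4 * Real.pi) * ∫ X, ∫ X', kl (X - X') * η X' * ζ X := fun η ζ => by
    rw [Kop_apply, inner_toY _ (adm_const_mul _ (adm_logPot η)), ← integral_const_mul]
    refine integral_congr_ae (Filter.Eventually.of_forall fun X => ?_)
    simp only
    rw [integral_mul_const, ← logPot_eq]; ring
  rw [real_inner_comm, key, key, integral_integral_swap (integrable_kl_mul_mul η ζ)]
  congr 1
  refine integral_congr_ae (Filter.Eventually.of_forall fun X => ?_)
  refine integral_congr_ae (Filter.Eventually.of_forall fun X' => ?_)
  simp only
  rw [kl_symm]; ring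

theorem logPot_comp_rot (θ : ℝ) (f : Plane → ℝ) (X : Plane) :
    logPot (fun X => f (rot θ X)) X = logPot f (rot θ X) := by
  rw [logPot_eq, logPot_eq, ← integral_rot θ fun X' => kl (rot θ X - X') * f X']
  refine integral_congr_ae (Filter.Eventually.of_forall fun X' => ?_)
  simp only [kl]
  rw [← map_sub, norm_rot]

theorem U_Kop (θ : ℝ) (η : Y) : U θ (Kop η) = Kop (U θ η) := by
  rw [Kop_apply, Kop_apply, (U_eq_toY θ (adm_const_mul _ (adm_logPot η))).2]
  congr 1; funext X
  rw [logPot_congr (U_ae θ η), logPot_comp_rot]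

/-! ### The operators `S` and `Λ` on an angular mode. -/

theorem adm_phi_mul (η : Y) : Adm fun X => phi X * (Real.exp (‖X‖ ^ 2 / 4) * η X) := by
  have hm : AEStronglyMeasurable (fun X => phi X * (Real.exp (‖X‖ ^ 2 / 4) * η X)) volume :=
    (SM.phi 0).continuous.aestronglyMeasurable.mul
      ((Continuous.aestronglyMeasurable (by fun_prop)).mul (Y_aesm η))
  rw [adm_iff hm]
  have h := (integrable_Y_mul η η).bdd_mul (c := 1) (f := fun X => phi X ^ 2)
    ((SM.phi 0).continuous.pow 2).aestronglyMeasurable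
    (Filter.Eventually.of_forall fun X => by
      rw [Real.norm_of_nonneg (sq_nonneg _)]
      have := phi_le X; have := phi_pos X; nlinarith)
  refine h.congr (Filter.Eventually.of_forall fun X => ?_)
  simp only
  linear_combination (-(phi X ^ 2 * η X ^ 2 * Real.exp (‖X‖ ^ 2 / 4))) * gs_mul_exp X

theorem toY_phi_ae (η : Y) : ∀ᵐ X : Plane,
    toY (fun X => phi X * (Real.exp (‖X‖ ^ 2 / 4) * η X)) X = phi X * η X := by
  filter_upwards [toY_ae (adm_phi_mul η)] with X h
  rw [h]; linear_combination (phi X * η X) * gs_mul_exp X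

/-- The bounded operator `η ↦ φ η` on `𝒴`. -/
def PhiOp : Y →L[ℝ] Y :=
  LinearMap.mkContinuous
    { toFun := fun η => toY fun X => phi X * (Real.exp (‖X‖ ^ 2 / 4) * η X)
      map_add' := fun η ζ => by
        rw [← toY_add (adm_phi_mul η) (adm_phi_mul ζ)]
        refine toY_congr ?_
        filter_upwards [Y_add_ae η ζ] with X h
        rw [h]; ring
      map_smul' := fun c η => by
        rw [RingHom.id_apply, ← toY_smul c (adm_phi_mul η)]
        refine toY_congr ?_
        filter_upwards [Y_smul_ae c η] with X h
        rw [h]; ring }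
    1 (fun η => by
      rw [one_mul]
      refine Lp.norm_le_norm_of_ae_le ?_
      rw [ae_gaussWeight]
      filter_upwards [toY_phi_ae η] with X h
      simp only [LinearMap.coe_mk, AddHom.coe_mk]
      rw [h, norm_mul, Real.norm_of_nonneg (phi_pos X).le]
      exact mul_le_of_le_one_left (norm_nonneg _) ((phi_le X).trans (by norm_num)))

theorem PhiOp_ae (η : Y) : ∀ᵐ X : Plane, PhiOp η X = phi X * η X := toY_phi_ae η

theorem inner_PhiOp (η ζ : Y) : inner ℝ (PhiOp η) ζ = inner ℝ η (PhiOp ζ) := by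
  rw [inner_Y, inner_Y]
  refine integral_congr_ae ?_
  filter_upwards [PhiOp_ae η, PhiOp_ae ζ] with X h1 h2
  rw [h1, h2]; ring

theorem U_PhiOp (θ : ℝ) (η : Y) : U θ (PhiOp η) = PhiOp (U θ η) := by
  refine Y_ext ?_
  filter_upwards [U_ae θ (PhiOp η), PhiOp_ae (U θ η), ae_rot θ (PhiOp_ae η), U_ae θ η]
    with X h1 h2 h3 h4
  rw [h1, h2, h3, h4, phi_radial (norm_rot θ X)]

/-- The operator `η ↦ φ η - ½ η₀ L η`. -/
def Sop : Y →L[ℝ] Y := PhiOp - (1 / 2 : ℝ) • Kop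

theorem Sop_apply (η : Y) : Sop η = PhiOp η - (1 / 2 : ℝ) • Kop η := rfl

theorem inner_Sop (η ζ : Y) : inner ℝ (Sop η) ζ = inner ℝ η (Sop ζ) := by
  simp only [Sop_apply, inner_sub_left, inner_sub_right, inner_smul_left, inner_smul_right,
    inner_PhiOp, inner_Kop]; rfl

theorem U_Sop (θ : ℝ) (η : Y) : U θ (Sop η) = Sop (U θ η) := by
  simp only [Sop_apply, map_sub, map_smul, U_PhiOp, U_Kop]

theorem mem_YnS_of_commute {T : Y →L[ℝ] Y} (hT : ∀ θ η, U θ (T η) = T (U θ η)) {n : ℕ} {η : Y}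
    (h : η ∈ YnS n) : T η ∈ YnS n := fun θ => by
  rw [hT, h θ, map_add, map_smul, map_smul, Jn, hT]

/-- The operator `Λ` on the `n`-th angular mode. -/
def LamOp (n : ℕ) : Y →L[ℝ] Y :=
  (-(n / (2 * Real.pi)) : ℝ) • ((Jn n).toContinuousLinearMap ∘L Sop)

theorem LamOp_apply (n : ℕ) (η : Y) : LamOp n η = (-(n / (2 * Real.pi)) : ℝ) • Jn n (Sop η) := rfl

theorem LamOp_mem {n : ℕ} {η : Y} (h : η ∈ YnS n) : LamOp n η ∈ YnS n :=
  (YnS n).smul_mem _ (U_mem_YnS (mem_YnS_of_commute U_Sop h) _)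

/-- An isometry whose square is `-1` is skew. Only the left argument has to lie in the mode. -/
theorem inner_Jn {n : ℕ} (hn : 1 ≤ n) {η ζ : Y} (h : η ∈ YnS n) :
    inner ℝ (Jn n η) ζ = -inner ℝ η (Jn n ζ) := by
  have := (Jn n).inner_map_map (Jn n η) ζ
  rw [Jn_Jn hn h, inner_neg_left] at this
  linarith

/-- `S` is symmetric and commutes with the skew operator `J`. This skewness drives the energy bound,
the injectivity of `Λ` and the preservation of first moments. -/
theorem inner_LamOp {n : ℕ} (hn : 1 ≤ n) {η ζ : Y} (h : η ∈ YnS n) :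
    inner ℝ (LamOp n η) ζ = -inner ℝ η (LamOp n ζ) := by
  rw [LamOp_apply, LamOp_apply, inner_smul_left, inner_smul_right,
    inner_Jn hn (mem_YnS_of_commute U_Sop h), inner_Sop]
  have : Sop (Jn n ζ) = Jn n (Sop ζ) := (U_Sop _ _).symm
  rw [this]; simp

theorem inner_LamOp_self {n : ℕ} (hn : 1 ≤ n) {η : Y} (h : η ∈ YnS n) :
    inner ℝ (LamOp n η) η = 0 := by
  have := inner_LamOp hn (ζ := η) h
  rw [real_inner_comm (LamOp n η) η] at this
  linarith [real_inner_comm (LamOp n η) η]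

/-! ### The Ornstein-Uhlenbeck form of `ℒ` and its weak formulation. -/

/-- The operator `D_i w = ∂_i w - (x_i / 2) w`, so that `∂_i (e^{-|X|²/4} w) = e^{-|X|²/4} D_i w`. -/
def Dg (i : Fin 2) (w : Plane → ℝ) (X : Plane) : ℝ := pd i w X - X i / 2 * w X

/-- The Ornstein-Uhlenbeck operator `Δ w - ½ X · ∇w`. -/
def ou (w : Plane → ℝ) (X : Plane) : ℝ :=
  pd 0 (pd 0 w) X + pd 1 (pd 1 w) X - 1 / 2 * (X 0 * pd 0 w X + X 1 * pd 1 w X)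

theorem pd_gs_mul (i : Fin 2) {w : Plane → ℝ} {X : Plane} (h : DifferentiableAt ℝ w X) :
    pd i (fun X => gs X * w X) X = gs X * Dg i w X := by
  rw [pd_mul i (differentiable_gs X) h, pd_gs, Dg]; ring

theorem TG.dg {k : ℕ} {w : Plane → ℝ} (h : TG (k + 1) w) (i : Fin 2) : TG k (Dg i w) := by
  have : Dg i w = fun X => VortexRing.pd i w X - 1 / 2 * X i * w X := by
    funext X; rw [Dg]; ring
  rw [this]; exact (h.pd i).sub (((TG.coord i).smul _).mul h.of_succ)

theorem TG.ou {k : ℕ} {w : Plane → ℝ} (h : TG (k + 2) w) : TG k (ou w) :=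
  (((h.pd 0).pd 0).add ((h.pd 1).pd 1)).sub
    ((((TG.coord 0).mul (h.pd 0).of_succ).add ((TG.coord 1).mul (h.pd 1).of_succ)).smul _)

theorem SM.dg {w : Plane → ℝ} (h : SM w) (i : Fin 2) : SM (Dg i w) := fun k => (h (k + 1)).dg i

theorem SM.ou {w : Plane → ℝ} (h : SM w) : SM (ou w) := fun k => (h (k + 2)).ou

theorem SM.adm {w : Plane → ℝ} (h : SM w) : Adm w := (h 0).adm

/-- Lebesgue integration by parts for the product of `gs * u` and `v`: in the Gaussian pairing,
`-D_i` is the adjoint of `∂_i`. -/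
theorem integral_Dg_mul (i : Fin 2) {u v : Plane → ℝ} (hu : TG 1 u) (hv : TG 1 v) :
    ∫ X, gs X * (Dg i u X * v X) = -∫ X, gs X * (u X * pd i v X) := by
  have e : ∀ X, fderiv ℝ (fun X => gs X * u X) X (EuclideanSpace.single i 1) = gs X * Dg i u X :=
    fun X => pd_gs_mul i (hu.1 X)
  have hd : Differentiable ℝ fun X => gs X * u X := differentiable_gs.mul hu.1
  have := integral_mul_fderiv_eq_neg_fderiv_mul_of_integrable (μ := (volume : Measure Plane))
    (f := v) (g := fun X => gs X * u X) (v := EuclideanSpace.single i (1 : ℝ)) ?_ ?_ ?_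
    (fun X _ => hv.1 X) (fun X _ => hd X)
  · simp only [e] at this
    calc _ = ∫ X, v X * (gs X * Dg i u X) := integral_congr_ae
          (Filter.Eventually.of_forall fun X => by simp only; ring)
      _ = _ := this
      _ = _ := congrArg _ (integral_congr_ae (Filter.Eventually.of_forall fun X => by
          simp only [pd]; ring))
  · refine (((hv.pd i).mul hu.of_succ).integrable).congr
      (Filter.Eventually.of_forall fun X => by simp only [pd]; ring)
  · simp only [e]
    refine ((hv.of_succ.mul (hu.dg i)).integrable).congr
      (Filter.Eventually.of_forall fun X => by simp only; ring)
  · refine ((hv.of_succ.mul hu.of_succ).integrable).congr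
      (Filter.Eventually.of_forall fun X => by simp only; ring)

theorem inner_toY_Dg (i : Fin 2) {u v : Plane → ℝ} (hu : TG 1 u) (hv : TG 1 v) :
    inner ℝ (toY (Dg i u)) (toY v) = -inner ℝ (toY u) (toY (pd i v)) := by
  rw [inner_toY_toY (hu.dg i).adm hv.adm, inner_toY_toY hu.adm (hv.pd i).adm,
    integral_Dg_mul i hu hv]

theorem integral_toY_mul {u χ : Plane → ℝ} (hu : Adm u) :
    ∫ X, toY u X * χ X = ∫ X, gs X * (u X * χ X) := by
  refine integral_congr_ae ?_
  filter_upwards [toY_ae hu] with X h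
  rw [h]; ring

theorem Dg_Dg (i : Fin 2) {w : Plane → ℝ} (h : TG 2 w) (X : Plane) :
    Dg i (Dg i w) X = pd i (pd i w) X - 1 / 2 * w X - X i * pd i w X + X i ^ 2 / 4 * w X := by
  have e : pd i (Dg i w) X = pd i (pd i w) X - (1 / 2 * w X + X i / 2 * pd i w X) := by
    have e0 : Dg i w = fun X => pd i w X - 1 / 2 * (X i * w X) := by
      funext X; rw [Dg]; ring
    have hd1 := (h.pd i).differentiable X
    have hd2 : DifferentiableAt ℝ (fun X : Plane => X i * w X) X :=
      (differentiable_coord i X).mul (h.1 X)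
    rw [e0, pd_sub i hd1 (hd2.const_mul _), pd_const_mul i _ hd2,
      pd_mul i (differentiable_coord i X) (h.1 X), pd_coord]
    simp; ring
  rw [Dg, e, Dg]; ring

theorem isWeakLaplacian_toY {w : Plane → ℝ} (h : TG 2 w) :
    IsWeakLaplacian (toY w) (toY fun X => Dg 0 (Dg 0 w) X + Dg 1 (Dg 1 w) X) := by
  intro χ hχ
  have hs := hχ.sm
  have ht : ∀ i, TG 0 (Dg i (Dg i w)) := fun i => (h.dg i).dg i
  have key : ∀ i, ∫ X, gs X * (Dg i (Dg i w) X * χ X) = ∫ X, gs X * (w X * pd i (pd i χ) X) :=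
    fun i => by
      rw [integral_Dg_mul i (h.dg i) (hs 1), integral_Dg_mul i h.of_succ (hs.pd i 1), neg_neg]
  rw [integral_toY_mul ((ht 0).add (ht 1)).adm, integral_toY_mul h.adm]
  have e1 : ∀ X, gs X * ((Dg 0 (Dg 0 w) X + Dg 1 (Dg 1 w) X) * χ X) =
    gs X * (Dg 0 (Dg 0 w) X * χ X) + gs X * (Dg 1 (Dg 1 w) X * χ X) := fun X => by ring
  have e2 : ∀ X, gs X * (w X * (Δ χ) X) =
    gs X * (w X * pd 0 (pd 0 χ) X) + gs X * (w X * pd 1 (pd 1 χ) X) := fun X => by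
    rw [laplacian_eq_pd (hs 2).contDiff.1 X]; ring
  simp only [e1, e2]
  rw [integral_add ((ht 0).mul (hs 0)).integrable ((ht 1).mul (hs 0)).integrable,
    integral_add (h.zero_of.mul ((hs.pd 0).pd 0 0)).integrable
      (h.zero_of.mul ((hs.pd 1).pd 1 0)).integrable, key, key]

theorem isWeakEuler_toY {w : Plane → ℝ} (h : TG 1 w) :
    IsWeakEuler (toY w) (toY fun X => X 0 * Dg 0 w X + X 1 * Dg 1 w X) := by
  intro χ hχ
  have hs := hχ.sm
  have ht : ∀ i, TG 0 (Dg i w) := fun i => h.dg i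
  have hxc : ∀ i, TG 1 fun X => X i * χ X := fun i => (TG.coord i).mul (hs 1)
  have key : ∀ i, ∫ X, gs X * (X i * Dg i w X * χ X) =
      -∫ X, gs X * (w X * (X i * pd i χ X + χ X)) := fun i => by
    have := integral_Dg_mul i h (hxc i)
    have e : ∀ X, pd i (fun X => X i * χ X) X = X i * pd i χ X + χ X := fun X => by
      rw [pd_mul i (differentiable_coord i X) ((hs 1).1 X), pd_coord]; simp
    simp only [e] at this
    rw [← this]
    exact integral_congr_ae (Filter.Eventually.of_forall fun X => by simp only; ring)
  have ha : ∀ i, TG 0 fun X => X i * Dg i w X := fun i => (TG.coord i).mul (ht i)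
  have hb : ∀ i, TG 0 fun X => X i * pd i χ X + χ X := fun i =>
    ((TG.coord i).mul (hs.pd i 0)).add (hs 0)
  rw [integral_toY_mul ((ha 0).add (ha 1)).adm, integral_toY_mul h.adm]
  have e1 : ∀ X, gs X * ((X 0 * Dg 0 w X + X 1 * Dg 1 w X) * χ X) =
    gs X * (X 0 * Dg 0 w X * χ X) + gs X * (X 1 * Dg 1 w X * χ X) := fun X => by ring
  have e2 : ∀ X, gs X * (w X * (fderiv ℝ χ X X + 2 * χ X)) =
    gs X * (w X * (X 0 * pd 0 χ X + χ X)) + gs X * (w X * (X 1 * pd 1 χ X + χ X)) := fun X => by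
    rw [fderiv_self_eq_pd]; ring
  simp only [e1, e2]
  rw [integral_add ((ha 0).mul (hs 0)).integrable ((ha 1).mul (hs 0)).integrable,
    integral_add (h.zero_of.mul (hb 0)).integrable (h.zero_of.mul (hb 1)).integrable, key, key]
  ring

/-- Conjugation by the Gaussian: `ℒ (e^{-|X|²/4} w) = e^{-|X|²/4} ou w`. -/
theorem toY_ou {w : Plane → ℝ} (h : TG 2 w) :
    toY (ou w) = toY (fun X => Dg 0 (Dg 0 w) X + Dg 1 (Dg 1 w) X) +
      (1 / 2 : ℝ) • toY (fun X => X 0 * Dg 0 w X + X 1 * Dg 1 w X) + toY w := by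
  have ht : ∀ i, TG 0 (Dg i (Dg i w)) := fun i => (h.dg i).dg i
  have ha : ∀ i, TG 0 fun X => X i * Dg i w X := fun i => (TG.coord i).mul (h.of_succ.dg i)
  have h1 := (ht 0).add (ht 1)
  have h2 := ((ha 0).add (ha 1)).smul (1 / 2)
  rw [← toY_smul _ ((ha 0).add (ha 1)).adm, ← toY_add h1.adm h2.adm,
    ← toY_add (h1.add h2).adm h.adm]
  congr 1
  funext X
  rw [Dg_Dg 0 h, Dg_Dg 1 h, Dg, Dg, ou]; ring

theorem isL_toY {w : Plane → ℝ} (h : TG 2 w) : IsL (toY w) (toY (ou w)) :=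
  ⟨_, _, isWeakLaplacian_toY h, isWeakEuler_toY h.of_succ, toY_ou h⟩

/-- The weak form of `ℒ η = l`. -/
def IsWeakL (η l : Y) : Prop := ∀ χ, IsTest χ → ∫ X, l X * χ X = ∫ X, η X * ou χ X

/-- The Lebesgue adjoint of `ℒ` is `ou` again: the divergence of `X/2` equals 1 and cancels the
zero-order term. -/
theorem IsL.isWeakL {η l : Y} (h : IsL η l) : IsWeakL η l := by
  obtain ⟨a, b, ha, hb, rfl⟩ := h
  intro χ hχ
  have hs := hχ.sm
  have e : ∀ᵐ X : Plane, (a + (1 / 2 : ℝ) • b + η : Y) X * χ X =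
      a X * χ X + (1 / 2 * (b X * χ X) + η X * χ X) := by
    filter_upwards [Y_add_ae (a + (1 / 2 : ℝ) • b) η, Y_add_ae a ((1 / 2 : ℝ) • b),
      Y_smul_ae (1 / 2 : ℝ) b] with X h1 h2 h3
    rw [h1, h2, h3]; ring
  have hb' := (integrable_mul_adm b hs.adm).const_mul (1 / 2)
  have hη := integrable_mul_adm η hs.adm
  have hbη : Integrable fun X => 1 / 2 * (b X * χ X) + η X * χ X := hb'.add hη
  rw [integral_congr_ae e, integral_add (integrable_mul_adm a hs.adm) hbη,
    integral_add hb' hη, integral_const_mul, ha χ hχ, hb χ hχ]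
  have l2 : ∀ X, (Δ χ) X = pd 0 (pd 0 χ) X + pd 1 (pd 1 χ) X :=
    laplacian_eq_pd (hs 2).contDiff.1
  simp only [l2, fderiv_self_eq_pd]
  have i1 := integrable_mul_adm η (((hs.pd 0).pd 0 0).add ((hs.pd 1).pd 1 0)).adm
  have i2 := (integrable_mul_adm η (((((TG.coord 0).mul (hs.pd 0 0)).add
    ((TG.coord 1).mul (hs.pd 1 0))).add ((hs 0).smul 2))).adm).const_mul (1 / 2)
  have : ∫ X, η X * ou χ X = ∫ X, (η X * (pd 0 (pd 0 χ) X + pd 1 (pd 1 χ) X) -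
      1 / 2 * (η X * (X 0 * pd 0 χ X + X 1 * pd 1 χ X + 2 * χ X)) + η X * χ X) :=
    integral_congr_ae (Filter.Eventually.of_forall fun X => by simp only [ou]; ring)
  have i3 : Integrable fun X => η X * (pd 0 (pd 0 χ) X + pd 1 (pd 1 χ) X) -
      1 / 2 * (η X * (X 0 * pd 0 χ X + X 1 * pd 1 χ X + 2 * χ X)) := i1.sub i2
  rw [this, integral_add i3 hη, integral_sub i1 i2, integral_const_mul]
  ring

theorem pd_congr {u v : Plane → ℝ} {X : Plane} (h : u =ᶠ[nhds X] v) (i : Fin 2) :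
    pd i u =ᶠ[nhds X] pd i v := h.fderiv.fun_comp fun L => L (EuclideanSpace.single i 1)

theorem ou_congr {u v : Plane → ℝ} {X : Plane} (h : u =ᶠ[nhds X] v) : ou u X = ou v X := by
  rw [ou, ou, (pd_congr h 0).eq_of_nhds, (pd_congr h 1).eq_of_nhds,
    (pd_congr (pd_congr h 0) 0).eq_of_nhds, (pd_congr (pd_congr h 1) 1).eq_of_nhds]

theorem pd_comp_smul (i : Fin 2) (c : ℝ) {u : Plane → ℝ} (h : Differentiable ℝ u) :
    pd i (fun X => u (c • X)) = fun X => c * pd i u (c • X) := by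
  funext X
  have : HasFDerivAt (fun X => u (c • X)) ((fderiv ℝ u (c • X)).comp
      (c • ContinuousLinearMap.id ℝ Plane)) X :=
    (h (c • X)).hasFDerivAt.comp X ((hasFDerivAt_id X).const_smul c)
  rw [pd, this.fderiv]; simp [pd]

theorem ou_mul {u v : Plane → ℝ} (hu : SM u) (hv : SM v) (X : Plane) :
    ou (fun X => u X * v X) X = v X * ou u X + u X * ou v X +
      2 * (pd 0 u X * pd 0 v X + pd 1 u X * pd 1 v X) := by
  have e : ∀ i, pd i (fun X => u X * v X) = fun X => u X * pd i v X + pd i u X * v X :=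
    fun i => funext fun X => pd_mul i ((hu 1).1 X) ((hv 1).1 X)
  have e2 : ∀ i, pd i (pd i fun X => u X * v X) X =
      u X * pd i (pd i v) X + pd i u X * pd i v X + (pd i u X * pd i v X +
        pd i (pd i u) X * v X) := fun i => by
    have d1 := (hu 1).1 X
    have d2 := (hv 1).1 X
    have d3 := (hu.pd i 1).1 X
    have d4 := (hv.pd i 1).1 X
    have d5 : DifferentiableAt ℝ (fun X => u X * pd i v X) X := d1.mul d4
    have d6 : DifferentiableAt ℝ (fun X => pd i u X * v X) X := d3.mul d2
    rw [e, pd_add i d5 d6, pd_mul i d1 d4, pd_mul i d3 d2]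
  rw [ou, e2, e2, e, e, ou, ou]; ring

/-- Cutoffs extend the weak equation from compactly supported test functions to all of `SM`.
Polynomials in particular become admissible, and the uniqueness argument depends on that. -/
theorem IsWeakL.of_sm {η l : Y} (h : IsWeakL η l) {w : Plane → ℝ} (hw : SM w) :
    ∫ X, l X * w X = ∫ X, η X * ou w X := by
  let f : ContDiffBump (0 : Plane) := ⟨1, 2, one_pos, one_lt_two⟩
  have hf : IsTest f := ⟨f.contDiff, f.hasCompactSupport⟩
  let ζ : ℕ → Plane → ℝ := fun m X => f (((m + 1 : ℝ)⁻¹) • X)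
  have hc0 : ∀ m : ℕ, 0 < ((m + 1 : ℝ)⁻¹) := fun m => by positivity
  have hc1 : ∀ m : ℕ, ((m + 1 : ℝ)⁻¹) ≤ 1 := fun m => inv_le_one_of_one_le₀ (by simp)
  have hζ : ∀ m, IsTest (ζ m) := fun m =>
    ⟨f.contDiff.comp (contDiff_const_smul _), f.hasCompactSupport.comp_smul (hc0 m).ne'⟩
  have hpd : ∀ m i, pd i (ζ m) = fun X => (m + 1 : ℝ)⁻¹ * pd i f ((m + 1 : ℝ)⁻¹ • X) :=
    fun m i => pd_comp_smul i _ (hf.sm 1).1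
  have hpd2 : ∀ m i, pd i (pd i (ζ m)) = fun X =>
      (m + 1 : ℝ)⁻¹ * ((m + 1 : ℝ)⁻¹ * pd i (pd i f) ((m + 1 : ℝ)⁻¹ • X)) := fun m i => by
    rw [hpd]
    funext X
    have hd : Differentiable ℝ fun X => pd i f ((m + 1 : ℝ)⁻¹ • X) :=
      (hf.sm.pd i 1).1.comp (f := fun X : Plane => (m + 1 : ℝ)⁻¹ • X)
        (by fun_prop)
    rw [pd_const_mul i _ (hd X), pd_comp_smul i _ (hf.sm.pd i 1).1]
  have bd : ∀ g : Plane → ℝ, IsTest g → ∃ C, 0 ≤ C ∧ ∀ X, |g X| ≤ C := fun g hg => by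
    obtain ⟨C, hC⟩ := hg.2.exists_bound_of_continuous hg.1.continuous
    exact ⟨C, (norm_nonneg _).trans (hC 0), hC⟩
  obtain ⟨A, hA0, hA⟩ : ∃ A, 0 ≤ A ∧ ∀ i X, |pd i f X| ≤ A := by
    obtain ⟨A, h1, h2⟩ := bd _ (hf.pd 0)
    obtain ⟨B, h3, h4⟩ := bd _ (hf.pd 1)
    refine ⟨A + B, by positivity, fun i X => ?_⟩
    fin_cases i
    · exact (h2 X).trans (by simpa using h3)
    · exact (h4 X).trans (by simpa using h1)
  obtain ⟨B, hB0, hB⟩ : ∃ A, 0 ≤ A ∧ ∀ i X, |pd i (pd i f) X| ≤ A := by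
    obtain ⟨A, h1, h2⟩ := bd _ ((hf.pd 0).pd 0)
    obtain ⟨B, h3, h4⟩ := bd _ ((hf.pd 1).pd 1)
    refine ⟨A + B, by positivity, fun i X => ?_⟩
    fin_cases i
    · exact (h2 X).trans (by simpa using h3)
    · exact (h4 X).trans (by simpa using h1)
  have hA' : ∀ m i X, |pd i (ζ m) X| ≤ A := fun m i X => by
    rw [hpd, abs_mul, abs_of_pos (hc0 m)]
    exact (mul_le_of_le_one_left (abs_nonneg _) (hc1 m)).trans (hA _ _)
  have hB' : ∀ m i X, |pd i (pd i (ζ m)) X| ≤ B := fun m i X => by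
    rw [hpd2, abs_mul, abs_mul, abs_of_pos (hc0 m)]
    refine (mul_le_of_le_one_left (by have := hc0 m; positivity) (hc1 m)).trans ?_
    exact (mul_le_of_le_one_left (abs_nonneg _) (hc1 m)).trans (hB _ _)
  have h01 : ∀ m X, |ζ m X| ≤ 1 := fun m X => by
    rw [abs_of_nonneg f.nonneg]; exact f.le_one
  -- The cutoff is eventually constant on a whole neighbourhood, so its derivatives drop out of the
  -- pointwise limit.
  have hev : ∀ X, ∀ᶠ m : ℕ in Filter.atTop, ζ m =ᶠ[nhds X] fun _ => 1 := fun X => by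
    obtain ⟨m0, hm0⟩ := exists_nat_ge (‖X‖ + 1)
    filter_upwards [Filter.eventually_ge_atTop m0] with m hm
    filter_upwards [Metric.ball_mem_nhds X one_pos] with X' hX'
    refine f.one_of_mem_closedBall ?_
    have hX1 : ‖X'‖ ≤ ‖X‖ + 1 := by
      have := norm_sub_norm_le X' X
      rw [Metric.mem_ball, dist_eq_norm] at hX'; linarith
    rw [mem_closedBall_zero_iff, norm_smul, Real.norm_of_nonneg (hc0 m).le]
    change _ ≤ (1 : ℝ)
    rw [inv_mul_le_one₀ (by positivity)]
    have : (m0 : ℝ) ≤ m := by exact_mod_cast hm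
    linarith
  have hwt : ∀ m, IsTest fun X => w X * ζ m X := fun m =>
    ⟨hw.hasTemperateGrowth.1.mul (hζ m).1, (hζ m).2.mul_left⟩
  have hint : ∀ m, ∫ X, l X * (w X * ζ m X) = ∫ X, η X * ou (fun X => w X * ζ m X) X :=
    fun m => h _ (hwt m)
  have lim1 : Filter.Tendsto (fun m => ∫ X, l X * (w X * ζ m X)) Filter.atTop
      (nhds (∫ X, l X * w X)) := by
    refine tendsto_integral_of_dominated_convergence (fun X => ‖l X * w X‖)
      (fun m => (integrable_mul_adm l (hwt m).sm.adm).1) (integrable_mul_adm l hw.adm).norm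
      (fun m => Filter.Eventually.of_forall fun X => ?_)
      (Filter.Eventually.of_forall fun X => ?_)
    · rw [← mul_assoc, norm_mul]
      exact mul_le_of_le_one_right (norm_nonneg _) (h01 m X)
    · refine tendsto_const_nhds.congr' ?_
      filter_upwards [hev X] with m hm
      rw [hm.eq_of_nhds, mul_one]
  -- The majorant uses `|a| ≤ a² + 1` in place of absolute values, so that it visibly belongs to `TG
  -- 0` and pairs integrably with `η`.
  have hbt : TG 0 fun X => (ou w X * ou w X + 1) + (w X * w X + 1) * (2 * B + A * (‖X‖ ^ 2 + 1)) +
      2 * A * ((pd 0 w X * pd 0 w X + 1) + (pd 1 w X * pd 1 w X + 1)) :=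
    ((((hw.ou 0).mul (hw.ou 0)).add (TG.const 1)).add ((((hw 0).mul (hw 0)).add
      (TG.const 1)).mul ((TG.const _).add ((TG.normSq.add (TG.const 1)).smul A)))).add
      ((((((hw.pd 0 0).mul (hw.pd 0 0)).add (TG.const 1))).add
      (((hw.pd 1 0).mul (hw.pd 1 0)).add (TG.const 1))).smul _)
  have lim2 : Filter.Tendsto (fun m => ∫ X, η X * ou (fun X => w X * ζ m X) X) Filter.atTop
      (nhds (∫ X, η X * ou w X)) := by
    refine tendsto_integral_of_dominated_convergence _
      (fun m => (integrable_mul_adm η (hwt m).sm.ou.adm).1)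
      (integrable_mul_adm η hbt.adm).norm
      (fun m => Filter.Eventually.of_forall fun X => ?_)
      (Filter.Eventually.of_forall fun X => ?_)
    · rw [norm_mul, norm_mul]
      refine mul_le_mul_of_nonneg_left ?_ (norm_nonneg _)
      refine le_trans ?_ (le_abs_self _)
      rw [ou_mul hw (hζ m).sm, Real.norm_eq_abs]
      have ab : ∀ a : ℝ, |a| ≤ a * a + 1 := fun a => by
        rw [← abs_mul_abs_self]; nlinarith [sq_nonneg (|a| - 1), abs_nonneg a]
      have hou : |ou (ζ m) X| ≤ 2 * B + A * (‖X‖ ^ 2 + 1) := by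
        have x0 : |X 0| ≤ ‖X‖ := by simpa using PiLp.norm_apply_le X 0
        have x1 : |X 1| ≤ ‖X‖ := by simpa using PiLp.norm_apply_le X 1
        have t0 : |X 0 * pd 0 (ζ m) X| ≤ ‖X‖ * A := by
          rw [abs_mul]; exact mul_le_mul x0 (hA' m 0 X) (abs_nonneg _) (norm_nonneg _)
        have t1 : |X 1 * pd 1 (ζ m) X| ≤ ‖X‖ * A := by
          rw [abs_mul]; exact mul_le_mul x1 (hA' m 1 X) (abs_nonneg _) (norm_nonneg _)
        have b0 := abs_le.1 (hB' m 0 X)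
        have b1 := abs_le.1 (hB' m 1 X)
        have n1 : ‖X‖ ≤ ‖X‖ ^ 2 + 1 := by nlinarith [sq_nonneg (‖X‖ - 1), norm_nonneg X]
        have n2 := mul_le_mul_of_nonneg_left n1 hA0
        have t0 := abs_le.1 t0
        have t1 := abs_le.1 t1
        rw [ou, abs_le]
        constructor <;> linarith
      have s1 : |ζ m X * ou w X| ≤ ou w X * ou w X + 1 := by
        rw [abs_mul]
        exact (mul_le_of_le_one_left (abs_nonneg _) (h01 m X)).trans (ab _)
      have s2 : |w X * ou (ζ m) X| ≤ (w X * w X + 1) * (2 * B + A * (‖X‖ ^ 2 + 1)) := by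
        rw [abs_mul]
        exact mul_le_mul (ab _) hou (abs_nonneg _) (by nlinarith [mul_self_nonneg (w X)])
      have s3 : ∀ i, |pd i w X * pd i (ζ m) X| ≤ A * (pd i w X * pd i w X + 1) := fun i => by
        rw [abs_mul, mul_comm A]
        exact mul_le_mul (ab _) (hA' m i X) (abs_nonneg _)
          (by nlinarith [mul_self_nonneg (pd i w X)])
      have s30 := abs_le.1 (s3 0)
      have s31 := abs_le.1 (s3 1)
      have s1 := abs_le.1 s1
      have s2 := abs_le.1 s2
      rw [abs_le]
      constructor <;> linarith
    · refine tendsto_const_nhds.congr' ?_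
      filter_upwards [hev X] with m hm
      congr 1
      refine (ou_congr ?_).symm
      filter_upwards [hm] with X' h'
      rw [h', mul_one]
  exact tendsto_nhds_unique (lim1.congr hint) lim2

theorem IsWeakL.inner_eq {η l : Y} (h : IsWeakL η l) {w : Plane → ℝ} (hw : SM w) :
    inner ℝ l (toY w) = inner ℝ η (toY (ou w)) := by
  rw [inner_toY l hw.adm, inner_toY η hw.ou.adm, h.of_sm hw]

theorem IsWeakL.add_smul {η l η' l' : Y} (h : IsWeakL η l) (h' : IsWeakL η' l') (c c' : ℝ) :
    IsWeakL (c • η + c' • η') (c • l + c' • l') := by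
  intro χ hχ
  have key : ∀ (a b : Y) (w : Plane → ℝ), Adm w → ∫ X, (c • a + c' • b : Y) X * w X =
      c * (∫ X, a X * w X) + c' * ∫ X, b X * w X := fun a b w hw => by
    rw [← inner_toY _ hw, ← inner_toY _ hw, ← inner_toY _ hw, inner_add_left, inner_smul_left,
      inner_smul_left]; rfl
  rw [key _ _ _ hχ.sm.adm, key _ _ _ hχ.sm.ou.adm, h χ hχ, h' χ hχ]

/-! ### Rotation invariance of `ℒ`. -/

theorem pd_comp_rot (θ : ℝ) {u : Plane → ℝ} (h : Differentiable ℝ u) :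
    pd 0 (fun X => u (rot θ X)) = (fun X => Real.cos θ * pd 0 u (rot θ X) +
      Real.sin θ * pd 1 u (rot θ X)) ∧
    pd 1 (fun X => u (rot θ X)) = fun X => -Real.sin θ * pd 0 u (rot θ X) +
      Real.cos θ * pd 1 u (rot θ X) := by
  have hf : ∀ X, HasFDerivAt (fun X => u (rot θ X)) ((fderiv ℝ u (rot θ X)).comp
      ((rot θ).toContinuousLinearEquiv : Plane →L[ℝ] Plane)) X := fun X =>
    (h (rot θ X)).hasFDerivAt.comp X
      ((rot θ).toContinuousLinearEquiv : Plane →L[ℝ] Plane).hasFDerivAt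
  constructor <;>
  · funext X
    rw [pd, (hf X).fderiv]
    simp [fderiv_eq_pd u, rot_zero_coord, rot_one_coord, mul_comm]

theorem ou_comp_rot (θ : ℝ) {u : Plane → ℝ} (h : SM u) (X : Plane) :
    ou (fun X => u (rot θ X)) X = ou u (rot θ X) := by
  obtain ⟨e0, e1⟩ := pd_comp_rot θ (h 1).1
  have hd : ∀ i, Differentiable ℝ fun X => pd i u (rot θ X) := fun i =>
    (h.pd i 1).1.comp (rot θ).toContinuousLinearEquiv.differentiable
  have c := fun i => pd_comp_rot θ (h.pd i 1).1
  rw [ou, ou, e0, e1, pd_add 0 ((hd 0 X).const_mul _) ((hd 1 X).const_mul _),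
    pd_add 1 ((hd 0 X).const_mul _) ((hd 1 X).const_mul _), pd_const_mul 0 _ (hd 0 X),
    pd_const_mul 0 _ (hd 1 X), pd_const_mul 1 _ (hd 0 X), pd_const_mul 1 _ (hd 1 X),
    (c 0).1, (c 1).1, (c 0).2, (c 1).2]
  have hs := Real.sin_sq_add_cos_sq θ
  simp only [rot_zero_coord, rot_one_coord]
  linear_combination (pd 0 (pd 0 u) (rot θ X) + pd 1 (pd 1 u) (rot θ X)) * hs

theorem IsTest.comp_rot {χ : Plane → ℝ} (h : IsTest χ) (θ : ℝ) : IsTest fun X => χ (rot θ X) :=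
  ⟨h.1.comp (rot θ).toContinuousLinearEquiv.contDiff,
    h.2.comp_homeomorph (rot θ).toHomeomorph⟩

theorem integral_U_mul (θ : ℝ) (η : Y) (χ : Plane → ℝ) :
    ∫ X, U θ η X * χ X = ∫ X, η X * χ (rot (-θ) X) := by
  rw [← integral_rot θ fun X => η X * χ (rot (-θ) X)]
  refine integral_congr_ae ?_
  filter_upwards [U_ae θ η] with X h
  rw [h, rot_rot]; simp [rot_zero]

theorem IsWeakL.rot {η l : Y} (h : IsWeakL η l) (θ : ℝ) : IsWeakL (U θ η) (U θ l) := by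
  intro χ hχ
  rw [integral_U_mul, integral_U_mul, h _ (hχ.comp_rot _)]
  simp only [ou_comp_rot _ hχ.sm]

/-! ### Density of the polynomials. -/

theorem integrable_mul_exp_inner (η : Y) (ξ : Plane) :
    Integrable fun X => |η X| * Real.exp |inner ℝ X ξ| := by
  have h := integrable_mul_adm η (w := fun X => Real.exp |inner ℝ X ξ|) ?_
  · refine h.norm.congr (Filter.Eventually.of_forall fun X => ?_)
    simp [abs_of_pos (Real.exp_pos _)]
  · rw [adm_iff (Continuous.aestronglyMeasurable (by fun_prop))]
    refine ((integrable_exp_neg_sq (c := 1 / 8) (by norm_num)).const_mul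
      (Real.exp (8 * ‖ξ‖ ^ 2))).mono' (Continuous.aestronglyMeasurable
      (continuous_gs.mul (by fun_prop))) (Filter.Eventually.of_forall fun X => ?_)
    have h1 : |inner ℝ X ξ| ≤ ‖X‖ * ‖ξ‖ := abs_real_inner_le_norm X ξ
    rw [Real.norm_of_nonneg (mul_nonneg (gs_pos X).le (sq_nonneg _)), gs, ← Real.exp_nat_mul,
      ← Real.exp_add, ← Real.exp_add]
    refine Real.exp_le_exp.2 ?_
    push_cast
    nlinarith [sq_nonneg (‖X‖ - 8 * ‖ξ‖)]

/-- Monomials. -/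
def mono (a b : ℕ) (X : Plane) : ℝ := X 0 ^ a * X 1 ^ b

theorem TG.pow {k : ℕ} {u : Plane → ℝ} (h : TG k u) (a : ℕ) : TG k fun X => u X ^ a := by
  induction a with
  | zero => simpa using TG.const 1
  | succ a ih => simpa only [pow_succ] using ih.mul h

theorem SM.mono (a b : ℕ) : SM (mono a b) := fun _ => ((TG.coord 0).pow a).mul ((TG.coord 1).pow b)

/-- The Gaussian decay of `η` makes `|η| e^{|X·ξ|}` integrable, so the Fourier transform can be
expanded termwise in moments. -/
theorem hasSum_integral_cexp (η : Y) (ξ : Plane) :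
    HasSum (fun k : ℕ => ∫ X, (η X : ℂ) * ((inner ℝ X ξ : ℝ) * Complex.I) ^ k / (k.factorial : ℂ))
      (∫ X, (η X : ℂ) * Complex.exp ((inner ℝ X ξ : ℝ) * Complex.I)) := by
  refine hasSum_integral_of_dominated_convergence
    (fun k X => |η X| * (|inner ℝ X ξ| ^ k / k.factorial)) (fun k => ?_)
    (fun k => Filter.Eventually.of_forall fun X => ?_) (Filter.Eventually.of_forall fun X => ?_)
    ?_ (Filter.Eventually.of_forall fun X => ?_)
  · simp only [div_eq_mul_inv]
    exact ((Complex.continuous_ofReal.comp_aestronglyMeasurable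
      (Y_aesm η)).mul (Continuous.aestronglyMeasurable (by fun_prop))).mul_const _
  · simp [mul_div_assoc]
  · exact (Real.summable_pow_div_factorial _).mul_left _
  · refine (integrable_mul_exp_inner η ξ).congr (Filter.Eventually.of_forall fun X => ?_)
    simp only
    rw [tsum_mul_left, Real.exp_eq_exp_ℝ, NormedSpace.exp_eq_tsum_div]
  · have := (NormedSpace.expSeries_div_hasSum_exp (((inner ℝ X ξ : ℝ) : ℂ) * Complex.I)).mul_left
      (η X : ℂ)
    simp only [← mul_div_assoc] at this
    rw [Complex.exp_eq_exp_ℂ]; exact this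

theorem integral_inner_pow_eq_zero {η : Y} (h : ∀ a b, ∫ X, η X * mono a b X = 0) (ξ : Plane)
    (k : ℕ) : ∫ X, η X * (inner ℝ X ξ) ^ k = 0 := by
  have e : ∀ X : Plane, η X * (inner ℝ X ξ) ^ k = ∑ m ∈ Finset.range (k + 1),
      (ξ 0 ^ m * ξ 1 ^ (k - m) * k.choose m) * (η X * mono m (k - m) X) := fun X => by
    have : (inner ℝ X ξ : ℝ) = ξ 0 * X 0 + ξ 1 * X 1 := by
      simp [PiLp.inner_apply]
    rw [this, add_pow, Finset.mul_sum]
    refine Finset.sum_congr rfl fun m _ => ?_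
    rw [mul_pow, mul_pow, mono]; ring
  simp only [e]
  rw [integral_finsetSum _ fun m _ => (integrable_mul_adm η (SM.mono _ _).adm).const_mul _]
  refine Finset.sum_eq_zero fun m _ => ?_
  rw [integral_const_mul, h, mul_zero]

theorem integral_cexp_eq_zero {η : Y} (h : ∀ a b, ∫ X, η X * mono a b X = 0) (ξ : Plane) :
    ∫ X, (η X : ℂ) * Complex.exp ((inner ℝ X ξ : ℝ) * Complex.I) = 0 := by
  have hs := hasSum_integral_cexp η ξ
  have h0 : ∀ k : ℕ, ∫ X, (η X : ℂ) * ((inner ℝ X ξ : ℝ) * Complex.I) ^ k / (k.factorial : ℂ) = 0 :=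
    fun k => by
      have e : ∀ X : Plane, (η X : ℂ) * ((inner ℝ X ξ : ℝ) * Complex.I) ^ k / (k.factorial : ℂ) =
          (Complex.I ^ k / (k.factorial : ℂ)) * ((η X * (inner ℝ X ξ) ^ k : ℝ) : ℂ) := fun X => by
        push_cast; ring
      simp only [e]
      rw [integral_const_mul, integral_complex_ofReal, integral_inner_pow_eq_zero h ξ k]; simp
  simp only [h0] at hs
  exact hs.unique hasSum_zero

theorem Y_integrable (η : Y) : Integrable fun X => η X := by
  simpa using integrable_mul_adm η ((PB.const 1).adm aestronglyMeasurable_const)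

/-- Vanishing moments make the Fourier transform of `η` vanish. The positive and negative parts of
`η` are then densities of finite measures with the same characteristic function, hence coincide,
which forces `η = 0`. -/
theorem Y_eq_zero_of_moments {η : Y} (h : ∀ a b, ∫ X, η X * mono a b X = 0) : η = 0 := by
  have hms : Measurable fun X => η X := (Lp.stronglyMeasurable η).measurable
  have hi := Y_integrable η
  have hfin : ∀ g : Plane → ℝ, Integrable g →
      IsFiniteMeasure (volume.withDensity fun X => ENNReal.ofReal (g X)) := fun g hg =>
    isFiniteMeasure_withDensity_ofReal hg.2
  have := hfin _ hi
  have := hfin _ hi.neg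
  have hchar : ∀ g : Plane → ℝ, Measurable g → ∀ ξ,
      charFun (volume.withDensity fun X => ENNReal.ofReal (g X)) ξ =
        ∫ X, ((max (g X) 0 : ℝ) : ℂ) * Complex.exp ((inner ℝ X ξ : ℝ) * Complex.I) :=
    fun g hg ξ => by
      rw [charFun_apply, integral_withDensity_eq_integral_toReal_smul (by fun_prop)
        (Filter.Eventually.of_forall fun _ => ENNReal.ofReal_lt_top)]
      refine integral_congr_ae (Filter.Eventually.of_forall fun X => ?_)
      simp only [ENNReal.toReal_ofReal', Complex.real_smul]
  have hbi : ∀ g : Plane → ℝ, Integrable g → ∀ ξ : Plane, Integrable fun X =>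
      ((max (g X) 0 : ℝ) : ℂ) * Complex.exp ((inner ℝ X ξ : ℝ) * Complex.I) := fun g hg ξ => by
    refine (hg.pos_part.ofReal (𝕜 := ℂ)).mul_bdd (c := 1)
      (Continuous.aestronglyMeasurable (by fun_prop)) (Filter.Eventually.of_forall fun X => ?_)
    rw [Complex.norm_exp_ofReal_mul_I]
  have heq : (volume.withDensity fun X => ENNReal.ofReal (η X)) =
      volume.withDensity fun X => ENNReal.ofReal (-η X) := by
    refine Measure.ext_of_charFun (funext fun ξ => ?_)
    rw [hchar _ hms, hchar (fun X => -η X) hms.neg, ← sub_eq_zero,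
      ← integral_sub (hbi _ hi ξ) (hbi (fun X => -η X) hi.neg ξ), ← integral_cexp_eq_zero h ξ]
    refine integral_congr_ae (Filter.Eventually.of_forall fun X => ?_)
    simp only
    rw [← sub_mul]
    congr 1
    rcases le_total (η X) 0 with hX | hX
    · rw [max_eq_right hX, max_eq_left (by linarith : 0 ≤ -η X)]; push_cast; ring
    · rw [max_eq_left hX, max_eq_right (by linarith : -η X ≤ 0)]; push_cast; ring
  have hae := (withDensity_eq_iff (by fun_prop) (by fun_prop) (by
    have := isFiniteMeasure_withDensity_ofReal hi.2
    have h2 := measure_ne_top (volume.withDensity fun X => ENNReal.ofReal (η X)) Set.univ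
    rwa [withDensity_apply _ MeasurableSet.univ, setLIntegral_univ] at h2)).1 heq
  refine Y_ext ?_
  have hz : ∀ᵐ X : Plane, (0 : Y) X = 0 := ae_gaussWeight ▸ Lp.coeFn_zero ℝ 2 gaussWeight
  filter_upwards [hae, hz] with X h1 h2
  rw [h2]
  rcases le_total (η X) 0 with hX | hX
  · rw [ENNReal.ofReal_of_nonpos hX] at h1
    have := ENNReal.ofReal_eq_zero.1 h1.symm
    linarith
  · rw [ENNReal.ofReal_of_nonpos (by linarith : -η X ≤ 0)] at h1
    have := ENNReal.ofReal_eq_zero.1 h1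
    linarith

/-- Polynomial functions on the plane. -/
def Pol : Submodule ℝ (Plane → ℝ) := Submodule.span ℝ (Set.range fun p : ℕ × ℕ => mono p.1 p.2)

theorem mono_mem (a b : ℕ) : mono a b ∈ Pol := Submodule.subset_span ⟨(a, b), rfl⟩

theorem SM.of_pol {p : Plane → ℝ} (h : p ∈ Pol) : SM p := by
  induction h using Submodule.span_induction with
  | mem x h => obtain ⟨q, rfl⟩ := h; exact SM.mono _ _
  | zero => exact fun k => TG.const 0
  | add x y _ _ hx hy => exact fun k => (hx k).add (hy k)
  | smul c x _ hx => exact fun k => (hx k).smul c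

/-- The polynomials, as a subspace of `𝒴`. -/
def PolY : Submodule ℝ Y where
  carrier := {η | ∃ p ∈ Pol, η = toY p}
  add_mem' := by
    rintro _ _ ⟨p, hp, rfl⟩ ⟨q, hq, rfl⟩
    exact ⟨p + q, Pol.add_mem hp hq, (toY_add (SM.of_pol hp).adm (SM.of_pol hq).adm).symm⟩
  zero_mem' := ⟨0, Pol.zero_mem, by
    have := toY_smul 0 (u := fun _ => 0) (SM.of_pol Pol.zero_mem).adm
    simp only [mul_zero, zero_smul] at this
    exact this.symm⟩
  smul_mem' := by
    rintro c _ ⟨p, hp, rfl⟩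
    exact ⟨c • p, Pol.smul_mem c hp, (toY_smul c (SM.of_pol hp).adm).symm⟩

theorem Y_eq_zero_of_pol {η : Y} (h : ∀ p ∈ Pol, inner ℝ η (toY p) = 0) : η = 0 :=
  Y_eq_zero_of_moments fun a b => by
    rw [← inner_toY η (SM.mono a b).adm, h _ (mono_mem a b)]

theorem exists_pol_seq (f : Y) : ∃ q : ℕ → Plane → ℝ, (∀ k, q k ∈ Pol) ∧
    Filter.Tendsto (fun k => toY (q k)) Filter.atTop (nhds f) := by
  have hd : PolY.topologicalClosure = ⊤ := by
    rw [Submodule.topologicalClosure_eq_top_iff, Submodule.eq_bot_iff]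
    intro η hη
    refine Y_eq_zero_of_pol fun p hp => ?_
    rw [real_inner_comm]
    exact (Submodule.mem_orthogonal _ _).1 hη _ ⟨p, hp, rfl⟩
  have hf : f ∈ closure (PolY : Set Y) := by
    rw [← Submodule.topologicalClosure_coe, hd]; trivial
  obtain ⟨x, hx, hl⟩ := mem_closure_iff_seq_limit.1 hf
  choose q hq e using hx
  exact ⟨q, hq, by simpa only [← e] using hl⟩

/-! ### Solving the resolvent equation on polynomials. -/

theorem pd_mono_zero (a b : ℕ) : pd 0 (mono a b) = fun X => a * mono (a - 1) b X := by
  funext X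
  have h : HasFDerivAt (mono a b) _ X :=
    ((hasFDerivAt_coord 0 X).pow a).mul ((hasFDerivAt_coord 1 X).pow b)
  rw [pd, h.fderiv]
  simp [mono]; ring

theorem pd_mono_one (a b : ℕ) : pd 1 (mono a b) = fun X => b * mono a (b - 1) X := by
  funext X
  have h : HasFDerivAt (mono a b) _ X :=
    ((hasFDerivAt_coord 0 X).pow a).mul ((hasFDerivAt_coord 1 X).pow b)
  rw [pd, h.fderiv]
  simp [mono]; ring

theorem ou_mono (a b : ℕ) (X : Plane) : ou (mono a b) X =
    a * (a - 1 : ℕ) * mono (a - 2) b X + b * (b - 1 : ℕ) * mono a (b - 2) X -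
      (a + b) / 2 * mono a b X := by
  have hd : ∀ a b, DifferentiableAt ℝ (mono a b) X := fun a b => (SM.mono a b 1).1 X
  have e0 : X 0 * (a * mono (a - 1) b X) = a * mono a b X := by
    cases a with
    | zero => simp
    | succ a => simp [mono, pow_succ]; ring
  have e1 : X 1 * (b * mono a (b - 1) X) = b * mono a b X := by
    cases b with
    | zero => simp
    | succ b => simp [mono, pow_succ]; ring
  rw [ou, pd_mono_zero, pd_mono_one, pd_const_mul 0 _ (hd _ _), pd_const_mul 1 _ (hd _ _),
    pd_mono_zero, pd_mono_one]
  simp only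
  rw [e0, e1, Nat.sub_sub, Nat.sub_sub]
  ring

theorem ou_add {u v : Plane → ℝ} (hu : SM u) (hv : SM v) :
    ou (fun X => u X + v X) = fun X => ou u X + ou v X := by
  have e : ∀ i, pd i (fun X => u X + v X) = fun X => pd i u X + pd i v X :=
    fun i => funext fun X => pd_add i ((hu 1).1 X) ((hv 1).1 X)
  funext X
  rw [ou, e, e, pd_add 0 ((hu.pd 0 1).1 X) ((hv.pd 0 1).1 X),
    pd_add 1 ((hu.pd 1 1).1 X) ((hv.pd 1 1).1 X), ou, ou]; ring

theorem ou_smul (c : ℝ) {u : Plane → ℝ} (hu : SM u) :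
    ou (fun X => c * u X) = fun X => c * ou u X := by
  have e : ∀ i, pd i (fun X => c * u X) = fun X => c * pd i u X :=
    fun i => funext fun X => pd_const_mul i c ((hu 1).1 X)
  funext X
  rw [ou, e, e, pd_const_mul 0 c ((hu.pd 0 1).1 X), pd_const_mul 1 c ((hu.pd 1 1).1 X), ou]; ring

/-- On monomials of degree `d`, `κ - ou` is multiplication by `κ + d/2` modulo degree `d - 2`. This
triangular system with nonzero diagonal is solved by induction on the degree. -/
theorem exists_pol_solution {κ : ℝ} (hκ : 0 < κ) {q : Plane → ℝ} (hq : q ∈ Pol) :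
    ∃ p ∈ Pol, ∀ X, κ * p X - ou p X = q X := by
  let R : Submodule ℝ (Plane → ℝ) :=
    { carrier := {q | ∃ p ∈ Pol, ∀ X, κ * p X - ou p X = q X}
      add_mem' := by
        rintro _ _ ⟨p, hp, h⟩ ⟨p', hp', h'⟩
        refine ⟨p + p', Pol.add_mem hp hp', fun X => ?_⟩
        have := congrFun (ou_add (SM.of_pol hp) (SM.of_pol hp')) X
        simp only [Pi.add_apply, ← h, ← h']
        rw [show (p + p') = fun X => p X + p' X from rfl, this]; ring
      zero_mem' := ⟨0, Pol.zero_mem, fun X => by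
        have := congrFun (ou_smul 0 (SM.of_pol Pol.zero_mem)) X
        simp only [zero_mul] at this
        rw [show (0 : Plane → ℝ) = fun _ => 0 from rfl, this]; simp⟩
      smul_mem' := by
        rintro c _ ⟨p, hp, h⟩
        refine ⟨c • p, Pol.smul_mem c hp, fun X => ?_⟩
        have := congrFun (ou_smul c (SM.of_pol hp)) X
        simp only [Pi.smul_apply, smul_eq_mul, ← h]
        rw [show (c • p) = fun X => c * p X from rfl, this]; ring }
  suffices h : Pol ≤ R from h hq
  refine Submodule.span_le.2 ?_
  rintro _ ⟨⟨a, b⟩, rfl⟩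
  simp only
  have main : ∀ d a b, a + b = d → mono a b ∈ R := by
    intro d
    induction d using Nat.strong_induction_on with
    | _ d ih =>
      intro a b hab
      have hc : κ + (a + b) / 2 ≠ 0 := by positivity
      have m0 : (fun X => κ * mono a b X - ou (mono a b) X) ∈ R := ⟨_, mono_mem a b, fun X => rfl⟩
      -- For `a < 2` the exponent `a - 2` is truncated, but the coefficient then vanishes.
      have m1 : ((a * (a - 1 : ℕ) : ℝ) • mono (a - 2) b) ∈ R := by
        rcases Nat.lt_or_ge a 2 with h | h
        · have : (a * (a - 1 : ℕ) : ℝ) = 0 := by interval_cases a <;> simp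
          rw [this, zero_smul]; exact R.zero_mem
        · exact R.smul_mem _ (ih (a - 2 + b) (by omega) _ _ rfl)
      have m2 : ((b * (b - 1 : ℕ) : ℝ) • mono a (b - 2)) ∈ R := by
        rcases Nat.lt_or_ge b 2 with h | h
        · have : (b * (b - 1 : ℕ) : ℝ) = 0 := by interval_cases b <;> simp
          rw [this, zero_smul]; exact R.zero_mem
        · exact R.smul_mem _ (ih (a + (b - 2)) (by omega) _ _ rfl)
      have e : mono a b = (κ + (a + b) / 2)⁻¹ • ((fun X => κ * mono a b X - ou (mono a b) X) +
          (a * (a - 1 : ℕ) : ℝ) • mono (a - 2) b + (b * (b - 1 : ℕ) : ℝ) • mono a (b - 2)) := by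
        funext X
        simp only [Pi.smul_apply, Pi.add_apply, smul_eq_mul]
        rw [ou_mono, eq_inv_mul_iff_mul_eq₀ hc]; ring
      rw [e]
      exact R.smul_mem _ (R.add_mem (R.add_mem m0 m1) m2)
  exact main _ a b rfl

/-! ### Second-order estimates and the resolvent of `ℒ`. -/

theorem ou_eq_Dg {w : Plane → ℝ} (X : Plane) :
    ou w X = Dg 0 (pd 0 w) X + Dg 1 (pd 1 w) X := by
  rw [ou, Dg, Dg]; ring

theorem toY_ou_eq {w : Plane → ℝ} (h : SM w) :
    toY (ou w) = toY (Dg 0 (pd 0 w)) + toY (Dg 1 (pd 1 w)) := by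
  rw [← toY_add ((h.pd 0).dg 0).adm ((h.pd 1).dg 1).adm]
  congr 1; funext X; exact ou_eq_Dg X

theorem inner_toY_ou_self {w : Plane → ℝ} (h : SM w) :
    inner ℝ (toY (ou w)) (toY w) = -(‖toY (pd 0 w)‖ ^ 2 + ‖toY (pd 1 w)‖ ^ 2) := by
  rw [toY_ou_eq h, inner_add_left, inner_toY_Dg 0 (h.pd 0 1) (h 1), inner_toY_Dg 1 (h.pd 1 1) (h 1),
    real_inner_self_eq_norm_sq, real_inner_self_eq_norm_sq]
  ring

/-- The commutation relation `[∂_i, D_i] = -1/2` of the Hermite ladder operators; the norm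
identities below follow from it and the adjoint relation. -/
theorem pd_Dg_self (i : Fin 2) {w : Plane → ℝ} (h : SM w) :
    pd i (Dg i w) = fun X => Dg i (pd i w) X - 1 / 2 * w X := by
  funext X
  have e := Dg_Dg i (h 2) X
  rw [Dg, Dg] at e
  rw [Dg]; linarith

theorem pd_Dg_ne {i j : Fin 2} (hij : j ≠ i) {w : Plane → ℝ} (h : SM w) :
    pd i (Dg j w) = Dg j (pd i w) := by
  funext X
  have e0 : Dg j w = fun X => pd j w X - 1 / 2 * (X j * w X) := by
    funext X; rw [Dg]; ring
  have hd2 : DifferentiableAt ℝ (fun X : Plane => X j * w X) X :=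
    (differentiable_coord j X).mul ((h 1).1 X)
  rw [e0, pd_sub i ((h.pd j 1).1 X) (hd2.const_mul _), pd_const_mul i _ hd2,
    pd_mul i (differentiable_coord j X) ((h 1).1 X), pd_coord, if_neg hij, pd_comm (h 2) i j, Dg]
  ring

theorem norm_Dg_sq (i : Fin 2) {w : Plane → ℝ} (h : SM w) :
    ‖toY (Dg i w)‖ ^ 2 = ‖toY (pd i w)‖ ^ 2 + 1 / 2 * ‖toY w‖ ^ 2 := by
  rw [← real_inner_self_eq_norm_sq, inner_toY_Dg i (h 1) (h.dg i 1), pd_Dg_self i h,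
    toY_sub ((h.pd i).dg i).adm (adm_const_mul _ h.adm), toY_smul _ h.adm, inner_sub_right,
    real_inner_comm, inner_toY_Dg i (h.pd i 1) (h 1), inner_smul_right,
    real_inner_self_eq_norm_sq, real_inner_self_eq_norm_sq]
  ring

theorem norm_Dg_Dg_sq (i : Fin 2) {w : Plane → ℝ} (h : SM w) :
    ‖toY (Dg i (Dg i w))‖ ^ 2 =
      ‖toY (Dg i (pd i w))‖ ^ 2 + 3 / 2 * ‖toY (pd i w)‖ ^ 2 + 1 / 2 * ‖toY w‖ ^ 2 := by
  rw [norm_Dg_sq i (h.dg i), pd_Dg_self i h, norm_Dg_sq i h,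
    toY_sub ((h.pd i).dg i).adm (adm_const_mul _ h.adm), toY_smul _ h.adm, norm_sub_sq_real,
    inner_smul_right, inner_toY_Dg i (h.pd i 1) (h 1), real_inner_self_eq_norm_sq, norm_smul]
  norm_num
  ring

/-- Since `D(ℒ)` requires `Δη` and `X·∇η` to lie separately in `𝒴`, control of `ℒη` alone is not
enough. The commutation relations reduce `D_i² w` to `D_i ∂_i w` and terms of lower order, and `Σ
‖D_i ∂_i w‖² ≤ ‖ou w‖²` because the cross term is a square. -/
theorem norm_toY_laplacian_le {w : Plane → ℝ} (h : SM w) :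
    ‖toY fun X => Dg 0 (Dg 0 w) X + Dg 1 (Dg 1 w) X‖ ≤ 2 * (‖toY (ou w)‖ + ‖toY w‖) := by
  -- Two integrations by parts turn the cross term into `‖∂_0 ∂_1 w‖²`.
  have hcross : 0 ≤ inner ℝ (toY (Dg 0 (pd 0 w))) (toY (Dg 1 (pd 1 w))) := by
    rw [inner_toY_Dg 0 (h.pd 0 1) ((h.pd 1).dg 1 1), pd_Dg_ne (by decide) (h.pd 1),
      real_inner_comm, inner_toY_Dg 1 ((h.pd 1).pd 0 1) (h.pd 0 1), neg_neg]
    have : pd 0 (pd 1 w) = pd 1 (pd 0 w) := funext fun X => pd_comm (h 2) 0 1 X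
    rw [this]; exact real_inner_self_nonneg
  have hsum : ‖toY (Dg 0 (pd 0 w))‖ ^ 2 + ‖toY (Dg 1 (pd 1 w))‖ ^ 2 ≤ ‖toY (ou w)‖ ^ 2 := by
    rw [toY_ou_eq h, norm_add_sq_real]; linarith
  have hgrad : ‖toY (pd 0 w)‖ ^ 2 + ‖toY (pd 1 w)‖ ^ 2 ≤ ‖toY (ou w)‖ * ‖toY w‖ := by
    have h1 := inner_toY_ou_self h
    have h2 := abs_le.1 (abs_real_inner_le_norm (toY (ou w)) (toY w))
    linarith
  have h0 := norm_Dg_Dg_sq 0 h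
  have h1 := norm_Dg_Dg_sq 1 h
  rw [toY_add ((h.dg 0).dg 0).adm ((h.dg 1).dg 1).adm]
  have ht := norm_add_le (toY (Dg 0 (Dg 0 w))) (toY (Dg 1 (Dg 1 w)))
  refine abs_le_of_sq_le_sq' ?_ (by positivity) |>.2
  have hp := parallelogram_law_with_norm ℝ (toY (Dg 0 (Dg 0 w))) (toY (Dg 1 (Dg 1 w)))
  nlinarith [norm_nonneg (toY (ou w)), norm_nonneg (toY w), mul_nonneg (norm_nonneg (toY (ou w)))
    (norm_nonneg (toY w)), mul_self_nonneg ‖toY (Dg 0 (Dg 0 w)) - toY (Dg 1 (Dg 1 w))‖]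

/-- Dissipativity: pairing with `p` leaves the nonnegative Dirichlet energy, which is dropped. -/
theorem norm_toY_le_of_pol (κ : ℝ) {p : Plane → ℝ} (h : SM p) :
    κ * ‖toY p‖ ≤ ‖κ • toY p - toY (ou p)‖ := by
  have h1 := inner_toY_ou_self h
  have h2 := real_inner_le_norm (κ • toY p - toY (ou p)) (toY p)
  rw [inner_sub_left, inner_smul_left, h1, real_inner_self_eq_norm_sq] at h2
  simp only [conj_trivial] at h2
  rcases (norm_nonneg (toY p)).eq_or_lt with h0 | h0
  · rw [← h0, mul_zero]; exact norm_nonneg _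
  · have : κ * ‖toY p‖ * ‖toY p‖ ≤ ‖κ • toY p - toY (ou p)‖ * ‖toY p‖ := by
      nlinarith [sq_nonneg ‖toY (pd 0 p)‖, sq_nonneg ‖toY (pd 1 p)‖]
    exact le_of_mul_le_mul_right this h0

theorem toY_ou_sub {u v : Plane → ℝ} (hu : SM u) (hv : SM v) :
    toY (ou fun X => u X - v X) = toY (ou u) - toY (ou v) := by
  have e : (fun X => u X - v X) = fun X => u X + (-1) * v X := by funext X; ring
  have hv' : SM fun X => (-1) * v X := fun k => (hv k).smul _
  rw [e, ou_add hu hv', ou_smul _ hv, ← toY_sub hu.ou.adm hv.ou.adm]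
  congr 1; funext X; ring

theorem isWeakLaplacian_of_tendsto {p : ℕ → Y} {a : ℕ → Y} {η l : Y}
    (h : ∀ k, IsWeakLaplacian (p k) (a k)) (hp : Filter.Tendsto p Filter.atTop (nhds η))
    (ha : Filter.Tendsto a Filter.atTop (nhds l)) : IsWeakLaplacian η l := by
  intro χ hχ
  have hΔ : Adm (Δ χ) := by
    rw [funext (laplacian_eq_pd (hχ.sm 2).contDiff.1)]
    exact (((hχ.sm.pd 0).pd 0 0).add ((hχ.sm.pd 1).pd 1 0)).adm
  have h1 := ha.inner (𝕜 := ℝ) (tendsto_const_nhds (x := toY χ))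
  have h2 := hp.inner (𝕜 := ℝ) (tendsto_const_nhds (x := toY (Δ χ)))
  rw [← inner_toY l hχ.sm.adm, ← inner_toY η hΔ]
  refine tendsto_nhds_unique h1 (h2.congr fun k => ?_)
  rw [inner_toY _ hχ.sm.adm, inner_toY _ hΔ, h k χ hχ]

theorem isWeakEuler_of_tendsto {p : ℕ → Y} {a : ℕ → Y} {η l : Y}
    (h : ∀ k, IsWeakEuler (p k) (a k)) (hp : Filter.Tendsto p Filter.atTop (nhds η))
    (ha : Filter.Tendsto a Filter.atTop (nhds l)) : IsWeakEuler η l := by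
  intro χ hχ
  have hE : Adm fun X => fderiv ℝ χ X X + 2 * χ X := by
    simp only [fderiv_self_eq_pd]
    exact (((((TG.coord 0).mul (hχ.sm.pd 0 0)).add
      ((TG.coord 1).mul (hχ.sm.pd 1 0))).add ((hχ.sm 0).smul 2))).adm
  have h1 := ha.inner (𝕜 := ℝ) (tendsto_const_nhds (x := toY χ))
  have h2 := (hp.inner (𝕜 := ℝ) (tendsto_const_nhds
    (x := toY fun X => fderiv ℝ χ X X + 2 * χ X))).neg
  rw [← inner_toY l hχ.sm.adm, ← inner_toY η hE]
  refine tendsto_nhds_unique h1 (h2.congr fun k => ?_)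
  rw [inner_toY _ hχ.sm.adm, inner_toY _ hE, h k χ hχ]

/-- Approximate `f` by polynomials and solve exactly for each. Dissipativity makes the solutions
Cauchy, and the second-order estimate makes their Laplacians Cauchy, so the limit lies in the strong
domain. The sign of the quadratic form also passes to the limit. -/
theorem exists_resolvent {κ : ℝ} (hκ : 0 < κ) (f : Y) : ∃ η : Y, IsL η (κ • η - f) ∧
    inner ℝ (κ • η - f) η ≤ 0 := by
  obtain ⟨q, hq, hqf⟩ := exists_pol_seq f
  choose p hp hpq using fun k => exists_pol_solution hκ (hq k)
  have hs : ∀ k, SM (p k) := fun k => SM.of_pol (hp k)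
  have hou : ∀ k, toY (ou (p k)) = κ • toY (p k) - toY (q k) := fun k => by
    rw [← toY_smul _ (hs k).adm, ← toY_sub (adm_const_mul _ (hs k).adm) (SM.of_pol (hq k)).adm]
    congr 1; funext X; linarith [hpq k X]
  have hcq := hqf.cauchySeq
  have hsub : ∀ j k, SM fun X => p j X - p k X := fun j k m => (hs j m).sub (hs k m)
  have hcp : CauchySeq fun k => toY (p k) := by
    rw [Metric.cauchySeq_iff] at hcq ⊢
    intro ε hε
    obtain ⟨N, hN⟩ := hcq (κ * ε) (by positivity)
    refine ⟨N, fun j hj k hk => ?_⟩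
    have h1 := hN j hj k hk
    have h2 := norm_toY_le_of_pol κ (hsub j k)
    rw [toY_sub (hs j).adm (hs k).adm, toY_ou_sub (hs j) (hs k), hou, hou] at h2
    have e : κ • (toY (p j) - toY (p k)) - (κ • toY (p j) - toY (q j) -
        (κ • toY (p k) - toY (q k))) = toY (q j) - toY (q k) := by module
    rw [e] at h2
    rw [dist_eq_norm] at h1 ⊢
    exact lt_of_mul_lt_mul_left (h2.trans_lt h1) hκ.le
  obtain ⟨η, hη⟩ := cauchySeq_tendsto_of_complete hcp
  have hl : Filter.Tendsto (fun k => toY (ou (p k))) Filter.atTop (nhds (κ • η - f)) := by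
    simp only [hou]; exact (hη.const_smul κ).sub hqf
  have hcl := hl.cauchySeq
  set A : ℕ → Y := fun k => toY fun X => Dg 0 (Dg 0 (p k)) X + Dg 1 (Dg 1 (p k)) X with hA
  have hAs : ∀ k, SM fun X => Dg 0 (Dg 0 (p k)) X + Dg 1 (Dg 1 (p k)) X :=
    fun k m => (((hs k).dg 0).dg 0 m).add (((hs k).dg 1).dg 1 m)
  have hDsub : ∀ (i : Fin 2) {u v : Plane → ℝ}, SM u → SM v →
      Dg i (fun X => u X - v X) = fun X => Dg i u X - Dg i v X := fun i u v hu hv => by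
    funext X
    rw [Dg, pd_sub i ((hu 1).1 X) ((hv 1).1 X), Dg, Dg]; ring
  have hAsub : ∀ j k, A j - A k = toY fun X => Dg 0 (Dg 0 fun X => p j X - p k X) X +
      Dg 1 (Dg 1 fun X => p j X - p k X) X := fun j k => by
    rw [hA, ← toY_sub (hAs j).adm (hAs k).adm]
    congr 1; funext X
    simp only [hDsub _ (hs j) (hs k), hDsub _ ((hs j).dg _) ((hs k).dg _)]; ring
  have hcA : CauchySeq A := by
    rw [Metric.cauchySeq_iff] at hcp hcl ⊢
    intro ε hε
    obtain ⟨N, hN⟩ := hcp (ε / 4) (by positivity)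
    obtain ⟨M, hM⟩ := hcl (ε / 4) (by positivity)
    refine ⟨max N M, fun j hj k hk => ?_⟩
    have h1 := hN j (le_of_max_le_left hj) k (le_of_max_le_left hk)
    have h2 := hM j (le_of_max_le_right hj) k (le_of_max_le_right hk)
    have h3 := norm_toY_laplacian_le (hsub j k)
    rw [← hAsub, toY_sub (hs j).adm (hs k).adm, toY_ou_sub (hs j) (hs k)] at h3
    rw [dist_eq_norm] at h1 h2 ⊢
    linarith
  obtain ⟨a, ha⟩ := cauchySeq_tendsto_of_complete hcA
  -- The Euler term is whatever `ℒ` leaves after the Laplacian and the identity, so its convergence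
  -- needs no estimate of its own.
  have hB : ∀ k, toY (fun X => X 0 * Dg 0 (p k) X + X 1 * Dg 1 (p k) X) =
      (2 : ℝ) • (toY (ou (p k)) - A k - toY (p k)) := fun k => by
    rw [toY_ou (hs k 2), hA]; module
  have hBl : Filter.Tendsto (fun k => toY fun X => X 0 * Dg 0 (p k) X + X 1 * Dg 1 (p k) X)
      Filter.atTop (nhds ((2 : ℝ) • (κ • η - f - a - η))) := by
    simp only [hB]; exact ((hl.sub ha).sub hη).const_smul _
  refine ⟨η, ⟨a, (2 : ℝ) • (κ • η - f - a - η),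
    isWeakLaplacian_of_tendsto (fun k => isWeakLaplacian_toY (hs k 2)) hη ha,
    isWeakEuler_of_tendsto (fun k => isWeakEuler_toY (hs k 1)) hη hBl, by module⟩, ?_⟩
  refine le_of_tendsto (hl.inner (𝕜 := ℝ) hη) (Filter.Eventually.of_forall fun k => ?_)
  rw [inner_toY_ou_self (hs k)]
  nlinarith [sq_nonneg ‖toY (pd 0 (p k))‖, sq_nonneg ‖toY (pd 1 (p k))‖]

/-- Every polynomial has the form `κ p - ou p`, and the weak equation makes `η` orthogonal to it.
Density of the polynomials concludes. -/
theorem IsWeakL.eq_zero {κ : ℝ} (hκ : 0 < κ) {η : Y} (h : IsWeakL η (κ • η)) : η = 0 := by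
  refine Y_eq_zero_of_pol fun q hq => ?_
  obtain ⟨p, hp, hpq⟩ := exists_pol_solution hκ hq
  have hs := SM.of_pol hp
  have e : toY q = κ • toY p - toY (ou p) := by
    rw [← toY_smul _ hs.adm, ← toY_sub (adm_const_mul _ hs.adm) hs.ou.adm]
    congr 1; funext X; exact (hpq X).symm
  have := h.inner_eq hs
  rw [inner_smul_left] at this
  rw [e, inner_sub_right, inner_smul_right, ← this]; simp

/-- Let ζ be the strong solution of `ζ - ℒζ = η - l`. Then `η - ζ` is a weak solution of `ℒu = u`,
hence zero. So `η` inherits the strong domain and the dissipativity of ζ. -/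
theorem IsWeakL.isL_and_inner_nonpos {η l : Y} (h : IsWeakL η l) :
    IsL η l ∧ inner ℝ l η ≤ 0 := by
  obtain ⟨ζ, hζ, hi⟩ := exists_resolvent one_pos (η - l)
  have h2 := h.add_smul hζ.isWeakL 1 (-1)
  have e : (1 : ℝ) • l + (-1 : ℝ) • ((1 : ℝ) • ζ - (η - l)) = (1 : ℝ) • ((1 : ℝ) • η + (-1 : ℝ) • ζ) := by
    module
  rw [e] at h2
  have h3 := h2.eq_zero one_pos
  have h4 : η = ζ := by
    have : η - ζ = 0 := by rw [← h3]; module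
    exact sub_eq_zero.1 this
  subst h4
  have e2 : (1 : ℝ) • η - (η - l) = l := by module
  rw [e2] at hζ hi
  exact ⟨hζ, hi⟩

theorem IsWeakL.unique {η l l' : Y} (h : IsWeakL η l) (h' : IsWeakL η l') : l = l' :=
  Y_eq_of_test fun χ hχ => by rw [h χ hχ, h' χ hχ]

/-! ### Differentiability of the logarithmic potential. -/

/-- A smooth regularization of the logarithmic kernel. -/
def ke (ε : ℝ) (x : Plane) : ℝ := Real.log 8 - 1 / 2 * Real.log (‖x‖ ^ 2 + ε ^ 2)

/-- The differential of the regularized kernel; for `ε = 0`, that of the logarithmic kernel. -/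
def dke (ε : ℝ) (x : Plane) : Plane →L[ℝ] ℝ := (-(‖x‖ ^ 2 + ε ^ 2)⁻¹) • innerSL ℝ x

theorem hasFDerivAt_ke {ε : ℝ} (hε : 0 < ε) (x : Plane) : HasFDerivAt (ke ε) (dke ε x) x := by
  have hp : ‖x‖ ^ 2 + ε ^ 2 ≠ 0 := by positivity
  have := (((hasFDerivAt_norm_sq x).add_const (ε ^ 2)).log hp).const_mul (1 / 2) |>.const_sub
    (Real.log 8)
  refine this.congr_fderiv ?_
  ext v
  simp [dke]; ring

theorem norm_dke (ε : ℝ) (x : Plane) : ‖dke ε x‖ = (‖x‖ ^ 2 + ε ^ 2)⁻¹ * ‖x‖ := by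
  rw [dke, norm_smul, innerSL_apply_norm, norm_neg, Real.norm_of_nonneg (by positivity)]

theorem norm_dke_le {ε : ℝ} (hε : 0 < ε) (x : Plane) : ‖dke ε x‖ ≤ ε⁻¹ := by
  rw [norm_dke, inv_mul_le_iff₀ (by positivity), ← div_eq_mul_inv, le_div_iff₀ hε]
  nlinarith [sq_nonneg (‖x‖ - ε), norm_nonneg x]

theorem norm_dke_zero_le (x : Plane) : ‖dke 0 x‖ ≤ ‖x‖ ^ (-1 : ℝ) := by
  rw [norm_dke, Real.rpow_neg_one]
  rcases (norm_nonneg x).eq_or_lt with h | h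
  · rw [← h]; simp
  · apply le_of_eq; field_simp; simp

/-- The two gradients differ by at most order `|x|⁻¹`, with decay in `ε` away from the origin.
Trading half a power gives a rate `√ε` while the kernel `|x|^{-3/2}` is still integrable at the
origin in the plane. -/
theorem norm_dke_sub_le {ε : ℝ} (hε : 0 < ε) (x : Plane) :
    ‖dke ε x - dke 0 x‖ ≤ √ε * ‖x‖ ^ (-(3 / 2) : ℝ) := by
  rcases (norm_nonneg x).eq_or_lt with h | h
  · have : x = 0 := norm_eq_zero.1 h.symm
    subst this
    simp [dke]
  have e : dke ε x - dke 0 x = ((‖x‖ ^ 2)⁻¹ - (‖x‖ ^ 2 + ε ^ 2)⁻¹) • innerSL ℝ x := by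
    ext v; simp [dke]; ring
  have hle : (‖x‖ ^ 2 + ε ^ 2)⁻¹ ≤ (‖x‖ ^ 2)⁻¹ := by
    apply inv_anti₀ (by positivity); nlinarith
  rw [e, norm_smul, innerSL_apply_norm, Real.norm_of_nonneg (by linarith)]
  -- Square roots as variables make the inequality polynomial.
  set a := √‖x‖ with ha
  set b := √ε with hb
  have ha0 : 0 < a := Real.sqrt_pos.2 h
  have hb0 : 0 < b := Real.sqrt_pos.2 hε
  have ea : ‖x‖ = a ^ 2 := (Real.sq_sqrt h.le).symm
  have eb : ε = b ^ 2 := (Real.sq_sqrt hε.le).symm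
  have ep : ‖x‖ ^ (-(3 / 2) : ℝ) = (a ^ 3)⁻¹ := by
    rw [Real.rpow_neg h.le, ha, Real.sqrt_eq_rpow, ← Real.rpow_natCast, ← Real.rpow_mul h.le]
    norm_num
  rw [ep, ea, eb]
  have key : b ^ 3 * a ≤ a ^ 4 + b ^ 4 := by
    rcases le_total a b with hab | hab
    · have : b ^ 3 * a ≤ b ^ 3 * b := by gcongr
      nlinarith [pow_pos ha0 4]
    · have : b ^ 3 * a ≤ a ^ 3 * a := by gcongr
      nlinarith [pow_pos hb0 4]
  have e2 : ((a ^ 2) ^ 2)⁻¹ - ((a ^ 2) ^ 2 + (b ^ 2) ^ 2)⁻¹ = b ^ 4 / (a ^ 4 * (a ^ 4 + b ^ 4)) := by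
    field_simp; ring
  rw [e2, div_mul_eq_mul_div, ← div_eq_mul_inv, div_le_div_iff₀ (by positivity) (by positivity)]
  have := mul_le_mul_of_nonneg_left key (by positivity : 0 ≤ b * a ^ 4)
  nlinarith

theorem abs_ke_sub_kl_le {ε : ℝ} (hε : 0 < ε) {x : Plane} (hx : x ≠ 0) :
    |ke ε x - kl x| ≤ ε * ‖x‖ ^ (-1 : ℝ) := by
  have h : 0 < ‖x‖ := norm_pos_iff.2 hx
  have e : ke ε x - kl x = -(1 / 2 * (Real.log (‖x‖ ^ 2 + ε ^ 2) - 2 * Real.log ‖x‖)) := by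
    rw [ke, kl, Real.log_div (by norm_num) h.ne']; ring
  have e2 : Real.log (‖x‖ ^ 2 + ε ^ 2) - 2 * Real.log ‖x‖ = Real.log (1 + (ε / ‖x‖) ^ 2) := by
    have : 2 * Real.log ‖x‖ = Real.log (‖x‖ ^ 2) := by rw [Real.log_pow]; norm_num
    rw [this, ← Real.log_div (by positivity) (by positivity)]
    congr 1; field_simp
  have ht : 0 < ε / ‖x‖ := by positivity
  have h1 : Real.log (1 + (ε / ‖x‖) ^ 2) ≤ 2 * (ε / ‖x‖) := by
    calc _ ≤ Real.log ((1 + ε / ‖x‖) ^ 2) := Real.log_le_log (by positivity) (by nlinarith)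
      _ = 2 * Real.log (1 + ε / ‖x‖) := by rw [Real.log_pow]; norm_num
      _ ≤ 2 * (ε / ‖x‖) := by
        have := Real.log_le_sub_one_of_pos (x := 1 + ε / ‖x‖) (by positivity)
        linarith
  have h0 : 0 ≤ Real.log (1 + (ε / ‖x‖) ^ 2) := Real.log_nonneg (by nlinarith)
  rw [e, e2, abs_neg, abs_of_nonneg (by positivity), Real.rpow_neg_one, ← div_eq_mul_inv]
  linarith

theorem continuous_dke {ε : ℝ} (hε : 0 < ε) : Continuous (dke ε) := by
  have h : Continuous fun x : Plane => -(‖x‖ ^ 2 + ε ^ 2)⁻¹ :=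
    (Continuous.inv₀ (by fun_prop) fun x => by positivity).neg
  exact h.smul (innerSL ℝ (E := Plane)).continuous

theorem measurable_dke_zero : Measurable (dke 0) := by
  have h : Measurable fun x : Plane => -(‖x‖ ^ 2 + (0 : ℝ) ^ 2)⁻¹ := by fun_prop
  exact h.smul (innerSL ℝ (E := Plane)).continuous.measurable

theorem tg_ke_sub {ε : ℝ} (hε : 0 < ε) (X : Plane) : TG 1 fun X' => ke ε (X - X') := by
  have hd : ∀ X', HasFDerivAt (fun X' => ke ε (X - X')) (-dke ε (X - X')) X' := fun X' => by
    have := (hasFDerivAt_ke hε (X - X')).comp X' ((hasFDerivAt_id X').const_sub X)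
    refine this.congr_fderiv ?_
    ext v; simp
  have hpd : ∀ i, pd i (fun X' => ke ε (X - X')) =
      fun X' => -dke ε (X - X') (EuclideanSpace.single i 1) := fun i => by
    funext X'; rw [pd, (hd X').fderiv]; rfl
  refine ⟨fun X' => (hd X').differentiableAt, ?_, fun i => ?_⟩
  · obtain ⟨C, hC⟩ : ∃ C, ∀ t : ℝ, ε ^ 2 ≤ t → |Real.log t| ≤ C + t := by
      refine ⟨|Real.log (ε ^ 2)|, fun t ht => abs_le.2 ⟨?_, ?_⟩⟩
      · have := Real.log_le_log (by positivity) ht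
        have := neg_abs_le (Real.log (ε ^ 2))
        have : 0 < t := lt_of_lt_of_le (by positivity) ht
        linarith
      · have := Real.log_le_sub_one_of_pos (lt_of_lt_of_le (by positivity : 0 < ε ^ 2) ht)
        linarith [abs_nonneg (Real.log (ε ^ 2))]
    refine PB.mono (u := fun X' => |Real.log 8| + (C + ε ^ 2 + 2 * ‖X‖ ^ 2) + 2 * (‖X'‖ * ‖X'‖))
      ((PB.const _).add ((PB.const 2).mul (PB.norm.mul PB.norm))) fun X' => ?_
    refine le_trans ?_ (le_abs_self _)
    have h1 := hC (‖X - X'‖ ^ 2 + ε ^ 2) (by nlinarith [sq_nonneg ‖X - X'‖])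
    have h2 := norm_sub_le X X'
    have h3 : ‖X - X'‖ ^ 2 ≤ 2 * ‖X‖ ^ 2 + 2 * (‖X'‖ * ‖X'‖) := by
      have := pow_le_pow_left₀ (norm_nonneg _) h2 2
      nlinarith [sq_nonneg (‖X‖ - ‖X'‖)]
    have h4 := abs_sub (Real.log 8) (1 / 2 * Real.log (‖X - X'‖ ^ 2 + ε ^ 2))
    rw [abs_mul, abs_of_pos (by norm_num : (0 : ℝ) < 1 / 2)] at h4
    have h5 := abs_nonneg (Real.log (‖X - X'‖ ^ 2 + ε ^ 2))
    rw [ke]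
    linarith
  · rw [hpd]
    refine ⟨?_, PB.of_bound (C := ε⁻¹) fun X' => ?_⟩
    · exact (((continuous_dke hε).comp (continuous_const.sub continuous_id)).clm_apply
        continuous_const).neg
    · rw [abs_neg]
      refine ((dke ε (X - X')).le_opNorm _).trans ?_
      rw [PiLp.norm_single]; simpa using norm_dke_le hε (X - X')

section regularity

variable {w : Plane → ℝ}

theorem exists_bound_gs_mul (hw : TG 0 w) : ∃ M, ∀ X, |gs X * w X| ≤ M := by
  obtain ⟨C, N, hC, h⟩ := hw.pb.exists_pos
  obtain ⟨D, hD, h2⟩ := one_add_pow_le N (c := 1 / 4) (by norm_num)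
  refine ⟨C * D, fun X => ?_⟩
  rw [abs_mul, abs_of_pos (gs_pos X)]
  have h3 := h2 ‖X‖ (norm_nonneg X)
  have e : gs X * Real.exp (1 / 4 * ‖X‖ ^ 2) = 1 := by
    rw [gs, ← Real.exp_add, Real.exp_eq_one_iff]; ring
  calc gs X * |w X| ≤ gs X * (C * (D * Real.exp (1 / 4 * ‖X‖ ^ 2))) := by
        refine mul_le_mul_of_nonneg_left ((h X).trans ?_) (gs_pos X).le
        gcongr
    _ = C * D * (gs X * Real.exp (1 / 4 * ‖X‖ ^ 2)) := by ring
    _ = C * D := by rw [e, mul_one]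

/-- The gradient of the potential of `e^{-|X|²/4} w`, with the regularized kernel. -/
def gradPot (ε : ℝ) (w : Plane → ℝ) (X : Plane) : Plane →L[ℝ] ℝ :=
  ∫ X', (gs X' * w X') • dke ε (X - X')

theorem integrable_gradPot {ε : ℝ} (hε : 0 < ε) (hw : TG 0 w) (X : Plane) :
    Integrable fun X' => (gs X' * w X') • dke ε (X - X') := by
  refine (hw.integrable.norm.mul_const ε⁻¹).mono' ?_ (Filter.Eventually.of_forall fun X' => ?_)
  · exact ((continuous_gs.mul hw.continuous).smul
      ((continuous_dke hε).comp (continuous_const.sub continuous_id))).aestronglyMeasurable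
  · rw [norm_smul]; exact mul_le_mul_of_nonneg_left (norm_dke_le hε _) (norm_nonneg _)

theorem integrable_gradPot_zero (hw : TG 0 w) (X : Plane) :
    Integrable fun X' => (gs X' * w X') • dke 0 (X - X') := by
  obtain ⟨M, hM⟩ := exists_bound_gs_mul hw
  refine ((singular_integral (α := 1) (by norm_num) (by norm_num) hM hw.integrable X).1).mono'
    ?_ (Filter.Eventually.of_forall fun X' => ?_)
  · refine AEStronglyMeasurable.smul hw.integrable.1 ?_
    exact (measurable_dke_zero.comp (measurable_const.sub measurable_id)).aestronglyMeasurable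
  · rw [norm_smul, mul_comm, Real.norm_eq_abs]
    exact mul_le_mul_of_nonneg_right (norm_dke_zero_le _) (abs_nonneg _)

theorem exists_norm_gradPot_le (hw : TG 0 w) : ∃ C, ∀ X, ‖gradPot 0 w X‖ ≤ C := by
  obtain ⟨M, hM⟩ := exists_bound_gs_mul hw
  refine ⟨M * diskInt 1 + ∫ X', |gs X' * w X'|, fun X => ?_⟩
  obtain ⟨h1, h2⟩ := singular_integral (α := 1) (by norm_num) (by norm_num) hM hw.integrable X
  refine (norm_integral_le_of_norm_le h1 (Filter.Eventually.of_forall fun X' => ?_)).trans h2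
  rw [norm_smul, mul_comm, Real.norm_eq_abs]
  exact mul_le_mul_of_nonneg_right (norm_dke_zero_le _) (abs_nonneg _)

theorem exists_norm_gradPot_sub_le (hw : TG 0 w) : ∃ C, ∀ ε, 0 < ε → ∀ X,
    ‖gradPot 0 w X - gradPot ε w X‖ ≤ √ε * C := by
  obtain ⟨M, hM⟩ := exists_bound_gs_mul hw
  refine ⟨M * diskInt (3 / 2) + ∫ X', |gs X' * w X'|, fun ε hε X => ?_⟩
  obtain ⟨h1, h2⟩ := singular_integral (α := 3 / 2) (by norm_num) (by norm_num) hM hw.integrable X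
  rw [gradPot, gradPot, ← integral_sub (integrable_gradPot_zero hw X) (integrable_gradPot hε hw X)]
  refine (norm_integral_le_of_norm_le (h1.const_mul (√ε))
    (Filter.Eventually.of_forall fun X' => ?_)).trans ?_
  · have e : (gs X' * w X') • dke 0 (X - X') - (gs X' * w X') • dke ε (X - X') =
        (gs X' * w X') • (dke 0 (X - X') - dke ε (X - X')) := (smul_sub _ _ _).symm
    rw [e, norm_smul, mul_comm, Real.norm_eq_abs, norm_sub_rev, ← mul_assoc]
    exact mul_le_mul_of_nonneg_right (norm_dke_sub_le hε _) (abs_nonneg _)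
  · rw [integral_const_mul]
    exact mul_le_mul_of_nonneg_left h2 (Real.sqrt_nonneg _)

theorem exists_abs_ke_integral_sub_le (hw : TG 0 w) : ∃ C, ∀ ε, 0 < ε → ∀ X,
    |(∫ X', gs X' * (w X' * ke ε (X - X'))) - logPot (fun X => gs X * w X) X| ≤ ε * C := by
  obtain ⟨M, hM⟩ := exists_bound_gs_mul hw
  refine ⟨M * diskInt 1 + ∫ X', |gs X' * w X'|, fun ε hε X => ?_⟩
  obtain ⟨h1, h2⟩ := singular_integral (α := 1) (by norm_num) (by norm_num) hM hw.integrable X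
  have i1 := (hw.mul (tg_ke_sub hε X).zero_of).integrable
  have i2 : Integrable fun X' => kl (X - X') * (gs X' * w X') := by
    refine (integrable_kl_mul (toY w) X).congr ?_
    filter_upwards [toY_ae hw.adm] with X' h
    rw [h]
  rw [logPot_eq, ← integral_sub i1 i2, ← Real.norm_eq_abs]
  have hne : ∀ᵐ X' : Plane, X' ≠ X := by simp [ae_iff]
  refine (norm_integral_le_of_norm_le (h1.const_mul ε) ?_).trans ?_
  · filter_upwards [hne] with X' hX'
    have := abs_ke_sub_kl_le hε (sub_ne_zero.2 hX'.symm)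
    have e : gs X' * (w X' * ke ε (X - X')) - kl (X - X') * (gs X' * w X') =
      (ke ε (X - X') - kl (X - X')) * (gs X' * w X') := by ring
    rw [e, norm_mul, Real.norm_eq_abs, Real.norm_eq_abs, ← mul_assoc]
    exact mul_le_mul_of_nonneg_right this (abs_nonneg _)
  · rw [integral_const_mul]
    exact mul_le_mul_of_nonneg_left h2 hε.le

theorem hasFDerivAt_ke_integral {ε : ℝ} (hε : 0 < ε) (hw : TG 0 w) (X : Plane) :
    HasFDerivAt (fun X => ∫ X', gs X' * (w X' * ke ε (X - X'))) (gradPot ε w X) X := by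
  refine hasFDerivAt_integral_of_dominated_of_fderiv_le (s := Set.univ)
    (F' := fun X X' => (gs X' * w X') • dke ε (X - X'))
    (bound := fun X' => ‖gs X' * w X'‖ * ε⁻¹) Filter.univ_mem
    (Filter.Eventually.of_forall fun X => (hw.mul (tg_ke_sub hε X).zero_of).integrable.1)
    (hw.mul (tg_ke_sub hε X).zero_of).integrable (integrable_gradPot hε hw X).1
    (Filter.Eventually.of_forall fun X' Z _ => ?_) (hw.integrable.norm.mul_const ε⁻¹)
    (Filter.Eventually.of_forall fun X' Z _ => ?_)
  · rw [norm_smul]; exact mul_le_mul_of_nonneg_left (norm_dke_le hε _) (norm_nonneg _)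
  · have := ((hasFDerivAt_ke hε (Z - X')).comp Z ((hasFDerivAt_id Z).sub_const X')).const_mul
      (gs X' * w X')
    simp only [← mul_assoc]
    exact this

theorem continuous_gradPot {ε : ℝ} (hε : 0 < ε) (hw : TG 0 w) : Continuous (gradPot ε w) := by
  refine continuous_of_dominated (bound := fun X' => ‖gs X' * w X'‖ * ε⁻¹)
    (fun X => (integrable_gradPot hε hw X).1)
    (fun X => Filter.Eventually.of_forall fun X' => ?_) (hw.integrable.norm.mul_const ε⁻¹)
    (Filter.Eventually.of_forall fun X' => ?_)
  · rw [norm_smul]; exact mul_le_mul_of_nonneg_left (norm_dke_le hε _) (norm_nonneg _)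
  · exact ((continuous_dke hε).comp (continuous_id.sub continuous_const)).const_smul (gs X' * w X')

/-- A sequence of positive numbers converging to zero. -/
def epsSeq (m : ℕ) : ℝ := 1 / ((m : ℝ) + 1)

theorem epsSeq_pos (m : ℕ) : 0 < epsSeq m := by unfold epsSeq; positivity

theorem tendsto_epsSeq : Filter.Tendsto epsSeq Filter.atTop (nhds 0) :=
  tendsto_one_div_add_atTop_nhds_zero_nat

theorem tendstoUniformly_gradPot (hw : TG 0 w) :
    TendstoUniformly (fun m => gradPot (epsSeq m) w) (gradPot 0 w) Filter.atTop := by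
  obtain ⟨C, hC⟩ := exists_norm_gradPot_sub_le hw
  rw [Metric.tendstoUniformly_iff]
  intro δ hδ
  have : Filter.Tendsto (fun m => √(epsSeq m) * C) Filter.atTop (nhds (√0 * C)) :=
    ((Real.continuous_sqrt.tendsto 0).comp tendsto_epsSeq).mul_const C
  rw [Real.sqrt_zero, zero_mul] at this
  filter_upwards [this.eventually (gt_mem_nhds hδ)] with m hm X
  rw [dist_eq_norm]
  exact (hC _ (epsSeq_pos m) X).trans_lt hm

theorem tendsto_ke_integral (hw : TG 0 w) (X : Plane) :
    Filter.Tendsto (fun m => ∫ X', gs X' * (w X' * ke (epsSeq m) (X - X'))) Filter.atTop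
      (nhds (logPot (fun X => gs X * w X) X)) := by
  obtain ⟨C, hC⟩ := exists_abs_ke_integral_sub_le hw
  have : Filter.Tendsto (fun m => epsSeq m * C) Filter.atTop (nhds (0 * C)) :=
    tendsto_epsSeq.mul_const C
  rw [zero_mul] at this
  rw [tendsto_iff_norm_sub_tendsto_zero]
  exact squeeze_zero (fun _ => norm_nonneg _) (fun m => hC _ (epsSeq_pos m) X) this

/-- The regularized potentials converge pointwise and their gradients uniformly, so the limit is
differentiable with the limiting gradient, though the kernel itself is singular. -/
theorem hasFDerivAt_logPot (hw : TG 0 w) (X : Plane) :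
    HasFDerivAt (logPot fun X => gs X * w X) (gradPot 0 w X) X :=
  hasFDerivAt_of_tendstoUniformly (tendstoUniformly_gradPot hw)
    (fun m X => hasFDerivAt_ke_integral (epsSeq_pos m) hw X) (tendsto_ke_integral hw) X

theorem pb_logPot_gs_mul (hw : TG 0 w) : PB (logPot fun X => gs X * w X) := by
  rw [← logPot_toY hw.adm]; exact pb_logPot _

theorem tg_logPot_one (hw : TG 0 w) : TG 1 (logPot fun X => gs X * w X) := by
  refine ⟨fun X => (hasFDerivAt_logPot hw X).differentiableAt, pb_logPot_gs_mul hw, fun i => ?_⟩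
  have e : pd i (logPot fun X => gs X * w X) =
      fun X => gradPot 0 w X (EuclideanSpace.single i 1) := by
    funext X; rw [pd, (hasFDerivAt_logPot hw X).fderiv]
  have hc : Continuous (gradPot 0 w) := (tendstoUniformly_gradPot hw).continuous
    (Filter.Eventually.of_forall fun m => continuous_gradPot (epsSeq_pos m) hw).frequently
  rw [e]
  obtain ⟨C, hC⟩ := exists_norm_gradPot_le hw
  refine ⟨hc.clm_apply continuous_const, PB.of_bound (C := C) fun X => ?_⟩
  refine ((gradPot 0 w X).le_opNorm _).trans ?_
  rw [PiLp.norm_single]; simpa using hC X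

/-- The derivative is moved from the regularized kernel onto the density by Gaussian integration by
parts; then `ε → 0`. -/
theorem pd_logPot (i : Fin 2) (hw : TG 1 w) :
    pd i (logPot fun X => gs X * w X) = logPot fun X => gs X * Dg i w X := by
  funext X
  have hw0 := hw.of_succ
  rw [pd, (hasFDerivAt_logPot hw0 X).fderiv]
  refine tendsto_nhds_unique (f := fun m => gradPot (epsSeq m) w X (EuclideanSpace.single i 1))
    (l := Filter.atTop) ?_ ((tendsto_ke_integral (hw.dg i) X).congr fun m => ?_)
  · exact ((ContinuousLinearMap.apply ℝ ℝ (EuclideanSpace.single i (1 : ℝ) : Plane)).continuous.tendsto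
      _).comp ((tendstoUniformly_gradPot hw0).tendsto_at X)
  · rw [integral_Dg_mul i hw (tg_ke_sub (epsSeq_pos m) X), gradPot,
      ContinuousLinearMap.integral_apply (integrable_gradPot (epsSeq_pos m) hw0 X), ← integral_neg]
    refine integral_congr_ae (Filter.Eventually.of_forall fun X' => ?_)
    have hd : HasFDerivAt (fun X' => ke (epsSeq m) (X - X'))
        (-dke (epsSeq m) (X - X')) X' := by
      have := (hasFDerivAt_ke (epsSeq_pos m) (X - X')).comp X' ((hasFDerivAt_id X').const_sub X)
      refine this.congr_fderiv ?_
      ext v; simp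
    simp only [pd, hd.fderiv]
    simp; ring

/-- A gain of one derivative is all the bootstrap requires: the base case is the bounded gradient,
and the step differentiates the density. -/
theorem tg_logPot {k : ℕ} (hw : TG k w) : TG (k + 1) (logPot fun X => gs X * w X) := by
  induction k generalizing w with
  | zero => exact tg_logPot_one hw
  | succ k ih =>
    refine ⟨(tg_logPot_one hw.zero_of).1, (tg_logPot_one hw.zero_of).2.1, fun i => ?_⟩
    have hw1 : TG 1 w := by
      clear ih
      induction k with
      | zero => exact hw
      | succ k ih => exact ih hw.of_succ
    rw [pd_logPot i hw1]
    exact ih (hw.dg i)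

end regularity

/-! ### Polar coordinates and the Fourier coefficients of the logarithm. -/

/-- The measure preserving identification of `ℝ × ℝ` with the plane. -/
def ofProd : ℝ × ℝ ≃ᵐ Plane :=
  (MeasurableEquiv.finTwoArrow (α := ℝ)).symm.trans (MeasurableEquiv.toLp 2 (Fin 2 → ℝ))

theorem measurePreserving_ofProd : MeasurePreserving ofProd volume volume :=
  ((EuclideanSpace.volume_preserving_symm_measurableEquiv_toLp (Fin 2)).symm _).comp
    ((volume_preserving_finTwoArrow ℝ).symm _)

theorem ofProd_polarCoord_symm (p : ℝ × ℝ) : ofProd (polarCoord.symm p) = polar p.1 p.2 := by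
  ext i; fin_cases i <;> rfl

theorem continuous_polar : Continuous fun p : ℝ × ℝ => polar p.1 p.2 := by
  rw [← (PiLp.homeomorph 2 fun _ : Fin 2 => ℝ).comp_continuous_iff]
  refine continuous_pi fun i => ?_
  fin_cases i
  · change Continuous fun p : ℝ × ℝ => p.1 * Real.cos p.2
    fun_prop
  · change Continuous fun p : ℝ × ℝ => p.1 * Real.sin p.2
    fun_prop

theorem integral_polar {f : Plane → ℝ} (hm : Measurable f) (hi : Integrable f) :
    ∫ X, f X = ∫ r in Set.Ioi (0 : ℝ), ∫ θ in (-Real.pi)..Real.pi, r * f (polar r θ) := by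
  have hvol : (volume : Measure (ℝ × ℝ)).restrict polarCoord.target =
      ((volume : Measure ℝ).restrict (Set.Ioi 0)).prod
        ((volume : Measure ℝ).restrict (Set.Ioo (-Real.pi) Real.pi)) := by
    rw [Measure.prod_restrict]; rfl
  have hmeas : Measurable fun p : ℝ × ℝ => p.1 * f (polar p.1 p.2) :=
    measurable_fst.mul (hm.comp continuous_polar.measurable)
  have hint : Integrable (fun p : ℝ × ℝ => p.1 * f (polar p.1 p.2))
      ((volume : Measure (ℝ × ℝ)).restrict polarCoord.target) := by
    refine ⟨hmeas.aestronglyMeasurable, ?_⟩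
    have h1 : Integrable fun p : ℝ × ℝ => f (ofProd p) :=
      (measurePreserving_ofProd.integrable_comp_emb ofProd.measurableEmbedding).2 hi
    have h2 := h1.2
    rw [HasFiniteIntegral, ← lintegral_comp_polarCoord_symm] at h2
    rw [HasFiniteIntegral]
    refine lt_of_le_of_lt (le_of_eq ?_) h2
    refine setLIntegral_congr_fun polarCoord.open_target.measurableSet fun p hp => ?_
    have hp1 : 0 < p.1 := hp.1
    simp only [ofProd_polarCoord_symm, smul_eq_mul]
    rw [enorm_mul, Real.enorm_of_nonneg hp1.le]
  rw [← measurePreserving_ofProd.integral_comp ofProd.measurableEmbedding f,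
    ← integral_comp_polarCoord_symm]
  simp only [ofProd_polarCoord_symm, smul_eq_mul]
  rw [hvol] at hint ⊢
  rw [integral_prod _ hint]
  refine integral_congr_ae (Filter.Eventually.of_forall fun r => ?_)
  simp only
  rw [intervalIntegral.integral_of_le (by linarith [Real.pi_pos]),
    ← integral_Ioc_eq_integral_Ioo]

theorem integral_cos_int {k : ℤ} (hk : k ≠ 0) :
    ∫ θ in (-Real.pi)..Real.pi, Real.cos (k * θ) = 0 := by
  have hk' : (k : ℝ) ≠ 0 := by exact_mod_cast hk
  have h := intervalIntegral.integral_comp_mul_left (a := -Real.pi) (b := Real.pi) Real.cos hk'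
  rw [h, integral_cos, mul_neg, Real.sin_neg, Real.sin_int_mul_pi]; simp

theorem integral_cos_mul_cos (k : ℕ) {n : ℕ} (hn : 1 ≤ n) :
    ∫ θ in (-Real.pi)..Real.pi, Real.cos (k * θ) * Real.cos (n * θ) =
      if k = n then Real.pi else 0 := by
  have e : ∀ θ : ℝ, Real.cos (k * θ) * Real.cos (n * θ) =
      1 / 2 * (Real.cos (((k : ℤ) + n : ℤ) * θ) + Real.cos (((k : ℤ) - n : ℤ) * θ)) := fun θ => by
    push_cast
    rw [add_mul, sub_mul, Real.cos_add, Real.cos_sub]; ring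
  simp only [e]
  rw [intervalIntegral.integral_const_mul, intervalIntegral.integral_add
    (Continuous.intervalIntegrable (by fun_prop) _ _)
    (Continuous.intervalIntegrable (by fun_prop) _ _), integral_cos_int (by omega)]
  split_ifs with h
  · subst h; simp; ring
  · rw [integral_cos_int (by omega)]; simp

theorem one_sub_mul_cos_pos {t : ℝ} (h0 : 0 ≤ t) (h1 : t < 1) (θ : ℝ) :
    0 < 1 - 2 * t * Real.cos θ + t ^ 2 := by
  have := Real.cos_le_one θ
  nlinarith [mul_nonneg h0 (sub_nonneg.2 this)]

/-- The real part of the Taylor series of `-log (1 - z)` at `z = t e^{iθ}`. -/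
theorem hasSum_log_one_sub {t : ℝ} (h0 : 0 ≤ t) (h1 : t < 1) (θ : ℝ) :
    HasSum (fun k : ℕ => t ^ k * Real.cos (k * θ) / k)
      (-(1 / 2 * Real.log (1 - 2 * t * Real.cos θ + t ^ 2))) := by
  set z : ℂ := t * Complex.exp (θ * Complex.I) with hz
  have hzn : ‖z‖ < 1 := by
    rw [hz, norm_mul, Complex.norm_exp_ofReal_mul_I, mul_one, Complex.norm_real,
      Real.norm_of_nonneg h0]
    exact h1
  have hre : z.re = t * Real.cos θ := by
    rw [hz, Complex.re_ofReal_mul, Complex.exp_ofReal_mul_I_re]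
  have him : z.im = t * Real.sin θ := by
    rw [hz, Complex.im_ofReal_mul, Complex.exp_ofReal_mul_I_im]
  have h := Complex.hasSum_re (Complex.hasSum_taylorSeries_neg_log hzn)
  convert h using 1
  · funext k
    have : z ^ k / k = ((t ^ k / k : ℝ) : ℂ) * Complex.exp ((k * θ : ℝ) * Complex.I) := by
      rw [hz, mul_pow, ← Complex.exp_nat_mul]; push_cast; ring_nf
    rw [this, Complex.re_ofReal_mul, Complex.exp_ofReal_mul_I_re]; ring
  · have hsq : ‖1 - z‖ ^ 2 = 1 - 2 * t * Real.cos θ + t ^ 2 := by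
      rw [Complex.sq_norm, Complex.normSq_apply]
      simp [hre, him]
      linear_combination t ^ 2 * Real.sin_sq_add_cos_sq θ
    rw [Complex.neg_re, Complex.log_re, ← hsq, Real.log_pow]; push_cast; ring

theorem integral_log_mul_cos {t : ℝ} (h0 : 0 ≤ t) (h1 : t < 1) {n : ℕ} (hn : 1 ≤ n) :
    ∫ θ in (-Real.pi)..Real.pi,
      Real.log (1 - 2 * t * Real.cos θ + t ^ 2) * Real.cos (n * θ) = -(2 * Real.pi / n * t ^ n) := by
  have hs := intervalIntegral.hasSum_integral_of_dominated_convergence (μ := volume)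
    (a := -Real.pi) (b := Real.pi)
    (F := fun (k : ℕ) θ => t ^ k * Real.cos (k * θ) / k * Real.cos (n * θ))
    (f := fun θ => -(1 / 2 * Real.log (1 - 2 * t * Real.cos θ + t ^ 2)) * Real.cos (n * θ))
    (fun k _ => t ^ k)
    (fun k => (Continuous.aestronglyMeasurable (by fun_prop)))
    (fun k => Filter.Eventually.of_forall fun θ _ => by
      rw [Real.norm_eq_abs, abs_mul, abs_div, abs_mul, abs_of_nonneg (pow_nonneg h0 k),
        Nat.abs_cast]
      have a1 := Real.abs_cos_le_one (k * θ)
      have a2 := Real.abs_cos_le_one (n * θ)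
      have hp := pow_nonneg h0 k
      have a3 : t ^ k * |Real.cos (k * θ)| / k ≤ t ^ k := by
        rcases Nat.eq_zero_or_pos k with rfl | hk
        · simp
        · have : (1 : ℝ) ≤ k := by exact_mod_cast hk
          rw [div_le_iff₀ (by positivity)]
          nlinarith [mul_le_mul_of_nonneg_left a1 hp, mul_le_mul_of_nonneg_left this hp]
      calc _ ≤ t ^ k * 1 := mul_le_mul a3 a2 (abs_nonneg _) hp
        _ = t ^ k := mul_one _)
    (Filter.Eventually.of_forall fun _ _ => summable_geometric_of_lt_one h0 h1)
    (by simp)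
    (Filter.Eventually.of_forall fun θ _ => (hasSum_log_one_sub h0 h1 θ).mul_right _)
  have he : ∀ k : ℕ, ∫ θ in (-Real.pi)..Real.pi, t ^ k * Real.cos (k * θ) / k * Real.cos (n * θ) =
      if k = n then t ^ n / n * Real.pi else 0 := fun k => by
    have : ∀ θ : ℝ, t ^ k * Real.cos (k * θ) / k * Real.cos (n * θ) =
      t ^ k / k * (Real.cos (k * θ) * Real.cos (n * θ)) := fun θ => by ring
    simp only [this]
    rw [intervalIntegral.integral_const_mul, integral_cos_mul_cos k hn]
    split_ifs with h
    · rw [h]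
    · simp
  simp only [he] at hs
  have h3 := hs.unique (hasSum_ite_eq n (t ^ n / n * Real.pi))
  have h4 : ∀ θ : ℝ, -(1 / 2 * Real.log (1 - 2 * t * Real.cos θ + t ^ 2)) * Real.cos (n * θ) =
    -(1 / 2) * (Real.log (1 - 2 * t * Real.cos θ + t ^ 2) * Real.cos (n * θ)) := fun θ => by ring
  simp only [h4] at h3
  rw [intervalIntegral.integral_const_mul] at h3
  linear_combination (-2) * h3

theorem kl_polar {M m : ℝ} (hM : 0 < M) (hm : 0 ≤ m) (hlt : m < M) {r ρ : ℝ}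
    (h : r = m ∧ ρ = M ∨ r = M ∧ ρ = m) (θ : ℝ) :
    kl (polar ρ 0 - polar r θ) =
      Real.log (8 / M) - 1 / 2 * Real.log (1 - 2 * (m / M) * Real.cos θ + (m / M) ^ 2) := by
  have hp := one_sub_mul_cos_pos (div_nonneg hm hM.le) ((div_lt_one hM).2 hlt) θ
  have hsq : ‖polar ρ 0 - polar r θ‖ ^ 2 =
      M ^ 2 * (1 - 2 * (m / M) * Real.cos θ + (m / M) ^ 2) := by
    have : M ^ 2 * (1 - 2 * (m / M) * Real.cos θ + (m / M) ^ 2) =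
      M ^ 2 - 2 * m * M * Real.cos θ + m ^ 2 := by field_simp
    rw [this, EuclideanSpace.real_norm_sq_eq]
    simp only [Fin.sum_univ_two, PiLp.sub_apply, polar_zero, polar_one, Real.cos_zero,
      Real.sin_zero]
    rcases h with ⟨rfl, rfl⟩ | ⟨rfl, rfl⟩ <;> linear_combination r ^ 2 * Real.sin_sq_add_cos_sq θ
  have hpos : 0 < ‖polar ρ 0 - polar r θ‖ := by
    have h0 : 0 < ‖polar ρ 0 - polar r θ‖ ^ 2 := by rw [hsq]; positivity
    refine (norm_nonneg _).lt_of_ne' fun e => ?_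
    rw [e] at h0; simp at h0
  have h2 : Real.log ‖polar ρ 0 - polar r θ‖ =
      1 / 2 * (2 * Real.log M + Real.log (1 - 2 * (m / M) * Real.cos θ + (m / M) ^ 2)) := by
    have := congrArg Real.log hsq
    rw [Real.log_pow, Real.log_mul (by positivity) hp.ne', Real.log_pow] at this
    push_cast at this
    linarith
  rw [kl, Real.log_div (by norm_num) hpos.ne', Real.log_div (by norm_num) hM.ne', h2]; ring

theorem continuous_kl_polar {r ρ : ℝ} (hr : 0 ≤ r) (hρ : 0 ≤ ρ) (h : r ≠ ρ) :
    Continuous fun θ => kl (polar ρ 0 - polar r θ) := by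
  have : ∀ θ, ‖polar ρ 0 - polar r θ‖ ≠ 0 := fun θ h0 => by
    rw [norm_eq_zero, sub_eq_zero] at h0
    apply h
    rw [← norm_polar hr θ, ← norm_polar hρ 0, h0]
  have hc : Continuous fun θ => polar r θ := continuous_polar.comp (by fun_prop : Continuous
    fun θ : ℝ => (r, θ))
  unfold kl
  refine Continuous.log (continuous_const.div ?_ this) fun θ => div_ne_zero (by norm_num) (this θ)
  exact (continuous_const.sub hc).norm

theorem integral_kl_mul_cos {n : ℕ} (hn : 1 ≤ n) {r ρ : ℝ} (hr : 0 < r) (hρ : 0 < ρ) (h : r ≠ ρ) :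
    ∫ θ in (-Real.pi)..Real.pi, kl (polar ρ 0 - polar r θ) * Real.cos (n * θ) =
      Real.pi / n * (min r ρ / max r ρ) ^ n := by
  have hlt : min r ρ < max r ρ := min_lt_max.2 h
  have hm : 0 < min r ρ := lt_min hr hρ
  have hM : 0 < max r ρ := hm.trans hlt
  have ht0 := div_nonneg hm.le hM.le
  have ht1 := (div_lt_one hM).2 hlt
  have hc : r = min r ρ ∧ ρ = max r ρ ∨ r = max r ρ ∧ ρ = min r ρ := by
    rcases le_total r ρ with h | h
    · left; simp [h]
    · right; simp [h]
  simp only [kl_polar hM hm.le hlt hc, sub_mul, mul_assoc]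
  simp only [← mul_assoc (2 : ℝ)]
  have hcont : Continuous fun θ : ℝ => Real.log (1 - 2 * (min r ρ / max r ρ) * Real.cos θ +
      (min r ρ / max r ρ) ^ 2) * Real.cos (n * θ) :=
    (Continuous.log (by fun_prop) fun θ => (one_sub_mul_cos_pos ht0 ht1 θ).ne').mul (by fun_prop)
  rw [intervalIntegral.integral_sub (Continuous.intervalIntegrable (by fun_prop) _ _)
    ((hcont.const_mul (1 / 2)).intervalIntegrable _ _), intervalIntegral.integral_const_mul,
    intervalIntegral.integral_const_mul, integral_log_mul_cos ht0 ht1 hn]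
  have := integral_cos_int (k := n) (by omega)
  push_cast at this
  rw [this]; ring

/-- The distance from a point on the axis is even in θ. -/
theorem integral_kl_mul_sin (n : ℕ) (r ρ : ℝ) :
    ∫ θ in (-Real.pi)..Real.pi, kl (polar ρ 0 - polar r θ) * Real.sin (n * θ) = 0 := by
  have h := intervalIntegral.integral_comp_neg (a := -Real.pi) (b := Real.pi)
    fun θ => kl (polar ρ 0 - polar r θ) * Real.sin (n * θ)
  have e : ∀ θ, kl (polar ρ 0 - polar r (-θ)) = kl (polar ρ 0 - polar r θ) := fun θ => by
    rw [kl, kl]; congr 2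
    rw [← sq_eq_sq₀ (norm_nonneg _) (norm_nonneg _), EuclideanSpace.real_norm_sq_eq,
      EuclideanSpace.real_norm_sq_eq]
    simp [polar_zero, polar_one]
  simp only [e, mul_neg, Real.sin_neg, intervalIntegral.integral_neg, neg_neg] at h
  linarith

/-! ### Potentials within one angular mode. -/

/-- Functions with angular dependence `a cos (nϑ) + b sin (nϑ)`. -/
def Equi (n : ℕ) (w : Plane → ℝ) : Prop := ∀ θ X,
  w (rot θ X) = Real.cos (n * θ) * w X + Real.sin (n * θ) * w (rot (Real.pi / (2 * n)) X)

theorem Equi.comp_rot {n : ℕ} {w : Plane → ℝ} (h : Equi n w) (ϑ : ℝ) :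
    Equi n fun X => w (rot ϑ X) := fun θ X => by
  simp only
  rw [rot_rot, add_comm, ← rot_rot, h θ (rot ϑ X), rot_rot, rot_rot, add_comm ϑ]

theorem integral_kl_equi {n : ℕ} (hn : 1 ≤ n) {w : Plane → ℝ} (hw : Equi n w) {r ρ : ℝ}
    (hr : 0 < r) (hρ : 0 < ρ) (h : r ≠ ρ) :
    ∫ θ in (-Real.pi)..Real.pi, kl (polar ρ 0 - polar r θ) * w (polar r θ) =
      Real.pi / n * (min r ρ / max r ρ) ^ n * w (polar r 0) := by
  have e : ∀ θ, kl (polar ρ 0 - polar r θ) * w (polar r θ) =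
      w (polar r 0) * (kl (polar ρ 0 - polar r θ) * Real.cos (n * θ)) +
        w (rot (Real.pi / (2 * n)) (polar r 0)) *
          (kl (polar ρ 0 - polar r θ) * Real.sin (n * θ)) := fun θ => by
    have h1 := hw θ (polar r 0)
    rw [rot_polar, zero_add] at h1
    rw [h1]; ring
  have hc := continuous_kl_polar hr.le hρ.le h
  simp only [e]
  rw [intervalIntegral.integral_add, intervalIntegral.integral_const_mul,
    intervalIntegral.integral_const_mul, integral_kl_mul_cos hn hr hρ h, integral_kl_mul_sin]
  · ring
  · exact ((hc.mul (by fun_prop)).const_mul _).intervalIntegrable _ _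
  · exact ((hc.mul (by fun_prop)).const_mul _).intervalIntegrable _ _

theorem logPot_polar_zero {n : ℕ} (hn : 1 ≤ n) {w : Plane → ℝ} (hc : TG 0 w) (hw : Equi n w) {ρ : ℝ}
    (hρ : 0 < ρ) :
    logPot (fun X => gs X * w X) (polar ρ 0) = Real.pi / n *
      ∫ r in Set.Ioi (0 : ℝ), (min r ρ / max r ρ) ^ n * (gs (polar r 0) * w (polar r 0)) * r := by
  have hi : Integrable fun X' => kl (polar ρ 0 - X') * (gs X' * w X') := by
    refine (integrable_kl_mul (toY w) (polar ρ 0)).congr ?_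
    filter_upwards [toY_ae hc.adm] with X' h
    rw [h]
  have hm : Measurable fun X' => kl (polar ρ 0 - X') * (gs X' * w X') :=
    (measurable_kl.comp (measurable_const.sub measurable_id)).mul
      (continuous_gs.mul hc.continuous).measurable
  rw [logPot_eq, integral_polar hm hi, ← integral_const_mul]
  refine integral_congr_ae ?_
  have h1 : ∀ᵐ r : ℝ ∂volume.restrict (Set.Ioi 0), r ≠ ρ :=
    ae_restrict_of_ae (by simp [ae_iff])
  filter_upwards [h1, ae_restrict_mem measurableSet_Ioi] with r h2 h3
  have h3' : 0 < r := h3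
  have e : ∀ θ, r * (kl (polar ρ 0 - polar r θ) * (gs (polar r θ) * w (polar r θ))) =
      r * gs (polar r 0) * (kl (polar ρ 0 - polar r θ) * w (polar r θ)) := fun θ => by
    rw [gs_radial (X := polar r θ) (X' := polar r 0) (by rw [norm_polar h3'.le, norm_polar h3'.le])]
    ring
  simp only [e]
  rw [intervalIntegral.integral_const_mul, integral_kl_equi hn hw h3' hρ h2]; ring

/-- On the `n`-th mode the kernel reduces to its `n`-th Fourier coefficient, and the potential on a
ray involves only the density on that ray. Rotating `w` reduces the claim to the ray of angle 0. -/
theorem logPot_polar {n : ℕ} (hn : 1 ≤ n) {w : Plane → ℝ} (hc : TG 0 w) (hw : Equi n w) {ρ : ℝ}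
    (hρ : 0 < ρ) (ϑ : ℝ) :
    logPot (fun X => gs X * w X) (polar ρ ϑ) = Real.pi / n *
      ∫ r in Set.Ioi (0 : ℝ), (min r ρ / max r ρ) ^ n * (gs (polar r ϑ) * w (polar r ϑ)) * r := by
  have hc' : TG 0 fun X => w (rot ϑ X) := by
    refine ⟨hc.continuous.comp (rot ϑ).continuous, ?_⟩
    obtain ⟨C, N, hC, h⟩ := hc.pb.exists_pos
    exact ⟨C, N, fun X => by rw [← norm_rot ϑ X]; exact h _⟩
  have h := logPot_polar_zero hn hc' (hw.comp_rot ϑ) hρ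
  have e : (fun X => gs X * w (rot ϑ X)) = fun X => (fun X => gs X * w X) (rot ϑ X) := by
    funext X; simp only [gs_radial (norm_rot ϑ X)]
  rw [e, logPot_comp_rot ϑ fun X => gs X * w X, rot_polar, zero_add] at h
  rw [h]
  congr 1
  refine setIntegral_congr_fun measurableSet_Ioi fun r hr => ?_
  simp only [rot_polar, zero_add]
  have : gs (polar r 0) = gs (polar r ϑ) := gs_radial (by
    rw [norm_polar (le_of_lt hr), norm_polar (le_of_lt hr)])
  rw [this]

theorem integral_ker {n : ℕ} (hn : 1 ≤ n) {ρ : ℝ} (hρ : 0 < ρ) :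
    IntegrableOn (fun r => (min r ρ / max r ρ) ^ n * r⁻¹) (Set.Ioi 0) ∧
      ∫ r in Set.Ioi (0 : ℝ), (min r ρ / max r ρ) ^ n * r⁻¹ = 2 / n := by
  have hn' : (0 : ℝ) < n := by exact_mod_cast hn
  have e1 : Set.EqOn (fun r => (ρ ^ n)⁻¹ * r ^ (n - 1)) (fun r => (min r ρ / max r ρ) ^ n * r⁻¹)
      (Set.Ioc 0 ρ) := fun r hr => by
    have hr0 : 0 < r := hr.1
    obtain ⟨m, rfl⟩ : ∃ m, n = m + 1 := ⟨n - 1, by omega⟩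
    simp only [min_eq_left hr.2, max_eq_right hr.2, div_pow, Nat.add_sub_cancel]
    field_simp
    rw [pow_succ]
  have e2 : Set.EqOn (fun r => ρ ^ n * r ^ (-(n : ℝ) - 1))
      (fun r => (min r ρ / max r ρ) ^ n * r⁻¹) (Set.Ioi ρ) := fun r hr => by
    have hr1 : ρ < r := hr
    have hr0 : 0 < r := hρ.trans hr1
    simp only [min_eq_right hr1.le, max_eq_left hr1.le, div_pow]
    rw [Real.rpow_sub hr0, Real.rpow_neg hr0.le, Real.rpow_natCast, Real.rpow_one]
    field_simp
  have i1 : IntegrableOn (fun r => (min r ρ / max r ρ) ^ n * r⁻¹) (Set.Ioc 0 ρ) := by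
    refine IntegrableOn.congr_fun ?_ e1 measurableSet_Ioc
    exact (Continuous.integrableOn_Icc (by fun_prop)).mono_set Set.Ioc_subset_Icc_self
  have i2 : IntegrableOn (fun r => (min r ρ / max r ρ) ^ n * r⁻¹) (Set.Ioi ρ) := by
    refine IntegrableOn.congr_fun ?_ e2 measurableSet_Ioi
    exact (integrableOn_Ioi_rpow_of_lt (by linarith) hρ).const_mul _
  rw [← Set.Ioc_union_Ioi_eq_Ioi hρ.le]
  refine ⟨i1.union i2, ?_⟩
  rw [setIntegral_union (Set.Ioc_disjoint_Ioi le_rfl) measurableSet_Ioi i1 i2,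
    ← setIntegral_congr_fun measurableSet_Ioc e1, ← setIntegral_congr_fun measurableSet_Ioi e2,
    integral_const_mul, integral_const_mul, ← intervalIntegral.integral_of_le hρ.le, integral_pow,
    integral_Ioi_rpow_of_lt (by linarith) hρ]
  have e3 : ρ ^ (-(n : ℝ) - 1 + 1) = (ρ ^ n)⁻¹ := by
    rw [sub_add_cancel, Real.rpow_neg hρ.le, Real.rpow_natCast]
  obtain ⟨m, rfl⟩ : ∃ m, n = m + 1 := ⟨n - 1, by omega⟩
  rw [e3, Nat.add_sub_cancel]
  have : (m : ℝ) + 1 ≠ 0 := by positivity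
  push_cast
  rw [zero_pow (by omega), show (-((m : ℝ) + 1) - 1 + 1) = -((m : ℝ) + 1) by ring]
  field_simp
  ring

section potentials

variable {n : ℕ} {w : Plane → ℝ}

theorem Equi.apply_zero (hn : 1 ≤ n) (hw : Equi n w) : w 0 = 0 := by
  have hn' : (n : ℝ) ≠ 0 := by positivity
  have h := hw (Real.pi / n) 0
  rw [mul_div_cancel₀ _ hn', map_zero, map_zero, Real.cos_pi, Real.sin_pi] at h
  linarith

theorem integrable_kl_gs_mul (hc : TG 0 w) (X : Plane) :
    Integrable fun X' => kl (X - X') * (gs X' * w X') := by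
  refine (integrable_kl_mul (toY w) X).congr ?_
  filter_upwards [toY_ae hc.adm] with X' h
  rw [h]

theorem logPot_linear {u v : Plane → ℝ} (hu : TG 0 u) (hv : TG 0 v) (a b : ℝ) (X : Plane) :
    logPot (fun X => gs X * (a * u X + b * v X)) X =
      a * logPot (fun X => gs X * u X) X + b * logPot (fun X => gs X * v X) X := by
  rw [logPot_eq, logPot_eq, logPot_eq, ← integral_const_mul, ← integral_const_mul,
    ← integral_add ((integrable_kl_gs_mul hu X).const_mul a)
      ((integrable_kl_gs_mul hv X).const_mul b)]
  congr 1; funext X'; ring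

theorem TG.comp_rot_zero (hc : TG 0 w) (ϑ : ℝ) : TG 0 fun X => w (rot ϑ X) := by
  refine ⟨hc.continuous.comp (rot ϑ).continuous, ?_⟩
  obtain ⟨C, N, hC, h⟩ := hc.pb.exists_pos
  exact ⟨C, N, fun X => by rw [← norm_rot ϑ X]; exact h _⟩

theorem logPot_gs_rot (θ : ℝ) (w : Plane → ℝ) (X : Plane) :
    logPot (fun X => gs X * w X) (rot θ X) = logPot (fun X => gs X * w (rot θ X)) X := by
  rw [← logPot_comp_rot θ fun X => gs X * w X]
  simp only [gs_radial (norm_rot θ _)]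

theorem Equi.logPot (hc : TG 0 w) (hw : Equi n w) : Equi n (logPot fun X => gs X * w X) := by
  intro θ X
  have : (fun X => gs X * w (rot θ X)) = fun X => gs X * (Real.cos (n * θ) * w X +
      Real.sin (n * θ) * w (rot (Real.pi / (2 * n)) X)) := by
    funext X; rw [hw θ X]
  rw [logPot_gs_rot, logPot_gs_rot, this, logPot_linear hc (hc.comp_rot_zero _)]

theorem Equi.linear {u v : Plane → ℝ} (hu : Equi n u) (hv : Equi n v) (a b : ℝ) :
    Equi n fun X => a * u X + b * v X := fun θ X => by
  simp only [hu θ X, hv θ X]; ring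

theorem Equi.mul_radial {g : Plane → ℝ} (hw : Equi n w)
    (hg : ∀ X X', ‖X‖ = ‖X'‖ → g X = g X') : Equi n fun X => w X * g X := fun θ X => by
  simp only [hw θ X, hg _ _ (norm_rot _ X)]; ring

/-- The weight `|X|²` is the scale-invariant one: the radial integral becomes `M ∫ (min/max)^n dr/r
= 2M/n`, with no dependence on ρ. One power of `1/n` comes from this integral and the other from the
kernel. -/
theorem abs_logPot_le (hn : 1 ≤ n) (hc : TG 0 w) (hw : Equi n w) {M : ℝ}
    (hM : ∀ X, |gs X * w X| * ‖X‖ ^ 2 ≤ M) (X : Plane) :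
    |logPot (fun X => gs X * w X) X| ≤ 2 * Real.pi * M / n ^ 2 := by
  have hn' : (0 : ℝ) < n := by exact_mod_cast hn
  have hM0 : 0 ≤ M := le_trans (by simp) (hM 0)
  rcases eq_or_ne X 0 with rfl | hX
  · rw [(hw.logPot hc).apply_zero hn, abs_zero]; positivity
  obtain ⟨ϑ, hϑ⟩ := exists_polar X
  have hρ : 0 < ‖X‖ := norm_pos_iff.2 hX
  rw [hϑ, logPot_polar hn hc hw hρ, abs_mul, abs_of_pos (by positivity)]
  obtain ⟨i1, i2⟩ := integral_ker hn hρ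
  have h := norm_integral_le_of_norm_le (i1.const_mul M)
    (f := fun r => (min r ‖X‖ / max r ‖X‖) ^ n * (gs (polar r ϑ) * w (polar r ϑ)) * r) (by
    filter_upwards [ae_restrict_mem measurableSet_Ioi] with r hr
    have hr0 : 0 < r := hr
    have h1 := hM (polar r ϑ)
    rw [norm_polar hr0.le] at h1
    have h2 : 0 ≤ (min r ‖X‖ / max r ‖X‖) ^ n :=
      pow_nonneg (div_nonneg (le_min hr0.le hρ.le) (le_max_of_le_left hr0.le)) _
    rw [norm_mul, norm_mul, Real.norm_of_nonneg h2, Real.norm_of_nonneg hr0.le, Real.norm_eq_abs,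
      mul_left_comm, mul_assoc]
    refine mul_le_mul_of_nonneg_left ?_ h2
    rw [← div_eq_mul_inv, le_div_iff₀ hr0]
    nlinarith)
  rw [integral_const_mul, i2, Real.norm_eq_abs] at h
  refine (mul_le_mul_of_nonneg_left h (by positivity)).trans (le_of_eq ?_)
  field_simp

/-- The kernel is split at ρ. Prescribing the antiderivatives, `F` vanishing at the origin and `H`
at infinity, leaves users of the formula only differentiations to check. -/
theorem integral_ker_one {a F H : ℝ → ℝ} {ρ : ℝ} (hρ : 0 < ρ)
    (hF : ∀ r, 0 < r → HasDerivAt F (r ^ 2 * a r) r)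
    (hF0 : Filter.Tendsto F (nhdsWithin 0 (Set.Ioi 0)) (nhds 0))
    (hH : ∀ r, 0 < r → HasDerivAt H (-a r) r) (hHt : Filter.Tendsto H Filter.atTop (nhds 0))
    (hc : Continuous a) {M : ℝ} (hM : ∀ r, 0 < r → |a r| * r ^ 2 ≤ M) :
    ∫ r in Set.Ioi (0 : ℝ), (min r ρ / max r ρ) ^ 1 * a r * r = F ρ / ρ + ρ * H ρ := by
  have e1 : Set.EqOn (fun r => ρ⁻¹ * (r ^ 2 * a r)) (fun r => (min r ρ / max r ρ) ^ 1 * a r * r)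
      (Set.Ioc 0 ρ) := fun r hr => by
    have hr0 : 0 < r := hr.1
    simp only [min_eq_left hr.2, max_eq_right hr.2]
    field_simp
  have e2 : Set.EqOn (fun r => ρ * a r) (fun r => (min r ρ / max r ρ) ^ 1 * a r * r)
      (Set.Ioi ρ) := fun r hr => by
    have hr1 : ρ < r := hr
    have hr0 : 0 < r := hρ.trans hr1
    simp only [min_eq_right hr1.le, max_eq_left hr1.le]
    field_simp
  have j1 : Continuous fun r => r ^ 2 * a r := by fun_prop
  have j2 : IntegrableOn a (Set.Ioi ρ) := by
    refine Integrable.mono' ((integrableOn_Ioi_rpow_of_lt (a := -2) (by norm_num) hρ).const_mul M)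
      hc.aestronglyMeasurable ?_
    filter_upwards [ae_restrict_mem measurableSet_Ioi] with r hr
    have hr0 : 0 < r := hρ.trans hr
    rw [Real.rpow_neg hr0.le, ← div_eq_mul_inv, le_div_iff₀ (by positivity), Real.rpow_two]
    exact hM r hr0
  have i1 : IntegrableOn (fun r => (min r ρ / max r ρ) ^ 1 * a r * r) (Set.Ioc 0 ρ) := by
    refine IntegrableOn.congr_fun ?_ e1 measurableSet_Ioc
    exact (Continuous.integrableOn_Icc (by fun_prop)).mono_set Set.Ioc_subset_Icc_self
  have i2 : IntegrableOn (fun r => (min r ρ / max r ρ) ^ 1 * a r * r) (Set.Ioi ρ) :=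
    IntegrableOn.congr_fun (j2.const_mul _) e2 measurableSet_Ioi
  rw [← Set.Ioc_union_Ioi_eq_Ioi hρ.le,
    setIntegral_union (Set.Ioc_disjoint_Ioi le_rfl) measurableSet_Ioi i1 i2,
    ← setIntegral_congr_fun measurableSet_Ioc e1, ← setIntegral_congr_fun measurableSet_Ioi e2,
    integral_const_mul, integral_const_mul, ← intervalIntegral.integral_of_le hρ.le,
    intervalIntegral.integral_eq_sub_of_hasDerivAt_of_tendsto hρ (fun r hr => hF r hr.1)
      (j1.intervalIntegrable _ _) hF0
      ((hF ρ hρ).continuousAt.tendsto.mono_left nhdsWithin_le_nhds)]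
  have h2 := integral_Ioi_of_hasDerivAt_of_tendsto (hH ρ hρ).continuousAt.continuousWithinAt
    (fun r hr => hH r (hρ.trans hr)) j2.neg hHt
  have h3 : ∫ r in Set.Ioi ρ, -a r = -∫ r in Set.Ioi ρ, a r := integral_neg _
  rw [h3] at h2
  have h4 : ∫ r in Set.Ioi ρ, a r = H ρ := by linarith
  rw [h4]; field_simp; ring

end potentials

/-! ### Explicit potentials of `X_i e^{-|X|²/4}` and of `η₀`. -/

/-- The radial Gaussian profile. -/
def gr (r : ℝ) : ℝ := Real.exp (-(r ^ 2 / 4))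

theorem gs_polar {r : ℝ} (ϑ : ℝ) : gs (polar r ϑ) = gr r := by
  have : ‖polar r ϑ‖ ^ 2 = r ^ 2 := by
    rw [EuclideanSpace.real_norm_sq_eq]
    simp only [Fin.sum_univ_two, polar_zero, polar_one]
    linear_combination r ^ 2 * Real.sin_sq_add_cos_sq ϑ
  rw [gs, gr, this]

theorem hasDerivAt_gr (r : ℝ) : HasDerivAt gr (-(r / 2) * gr r) r := by
  have h : HasDerivAt (fun r : ℝ => -(r ^ 2 / 4)) (-(r / 2)) r := by
    have := ((hasDerivAt_pow 2 r).div_const 4).neg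
    refine this.congr_deriv ?_
    push_cast; ring
  refine h.exp.congr_deriv ?_
  rw [gr]; ring

theorem tendsto_pow_mul_gr (k : ℕ) :
    Filter.Tendsto (fun r => r ^ k * gr r) Filter.atTop (nhds 0) := by
  have h := (Real.tendsto_pow_mul_exp_neg_atTop_nhds_zero k)
  refine squeeze_zero_norm' ?_ h
  filter_upwards [Filter.eventually_ge_atTop (4 : ℝ)] with r hr
  have : 0 ≤ r ^ k := pow_nonneg (by linarith) k
  rw [gr, Real.norm_of_nonneg (mul_nonneg this (Real.exp_pos _).le)]
  refine mul_le_mul_of_nonneg_left (Real.exp_le_exp.2 ?_) this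
  nlinarith

theorem equi_coord (i : Fin 2) : Equi 1 fun X => X i := fun θ X => by
  have e : Real.pi / (2 * (1 : ℕ)) = Real.pi / 2 := by simp
  rw [e]
  fin_cases i
  · simp [rot_zero_coord, Real.cos_pi_div_two, Real.sin_pi_div_two]; ring
  · simp [rot_one_coord, Real.cos_pi_div_two, Real.sin_pi_div_two]; ring

/-- Up to constants this is the derivative of `L η₀`. It identifies the velocity of the vortex and
puts `X_i e^{-|X|²/4}` in the kernel of `S`. -/
theorem logPot_gs_coord (i : Fin 2) (X : Plane) :
    logPot (fun X => gs X * X i) X = 8 * Real.pi * phi X * X i := by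
  rcases eq_or_ne X 0 with rfl | hX
  · have := ((equi_coord i).logPot (TG.coord i)).apply_zero le_rfl
    rw [this]; simp
  obtain ⟨ϑ, hϑ⟩ := exists_polar X
  set ρ := ‖X‖ with hρd
  have hρ : 0 < ρ := norm_pos_iff.2 hX
  set c := polar 1 ϑ i with hc
  have hpc : ∀ r, polar r ϑ i = r * c := fun r => by
    rw [hc]; fin_cases i
    · simp [polar_zero]
    · simp [polar_one]
  obtain ⟨M, hM⟩ := exists_bound_gs_mul (w := fun X => X i * ‖X‖ ^ 2)
    ((TG.coord i).mul TG.normSq)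
  have hcont : Continuous gr := by unfold gr; fun_prop
  -- Since `gr' = -(r/2) gr`, explicit antiderivatives of `r³ gr` and `-r gr` are `8 - 8 gr - 2 r²
  -- gr` and `2 gr`.
  have h := integral_ker_one (a := fun r => gr r * (r * c)) (M := M)
    (F := fun r => c * (8 - (8 * gr r + 2 * (r ^ 2 * gr r)))) (H := fun r => c * (2 * gr r)) hρ
    (fun r _ => by
      have h1 := (hasDerivAt_gr r)
      refine ((((h1.const_mul 8).add (((hasDerivAt_pow 2 r).mul h1).const_mul 2)).const_sub
        8).const_mul c).congr_deriv ?_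
      push_cast; ring)
    (by
      have : Continuous fun r => c * (8 - (8 * gr r + 2 * (r ^ 2 * gr r))) := by fun_prop
      have := this.tendsto 0
      simp only [gr] at this ⊢
      simp only [ne_eq, OfNat.ofNat_ne_zero, not_false_eq_true, zero_pow, zero_div, neg_zero,
        Real.exp_zero, mul_one, mul_zero, add_zero, sub_self] at this
      exact this.mono_left nhdsWithin_le_nhds)
    (fun r _ => by
      refine (((hasDerivAt_gr r).const_mul 2).const_mul c).congr_deriv ?_
      ring)
    (by
      have := ((tendsto_pow_mul_gr 0).const_mul 2).const_mul c
      simpa using this)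
    (by fun_prop)
    (fun r hr => by
      have := hM (polar r ϑ)
      rw [gs_polar, hpc, norm_polar hr.le, ← mul_assoc, abs_mul, abs_of_nonneg (sq_nonneg r)] at this
      exact this)
  have hφ := phi_mul X
  rw [hϑ, logPot_polar le_rfl (TG.coord i) (equi_coord i) hρ ϑ, ← hϑ]
  simp only [gs_polar, hpc, h]
  have hgX : gs X = gr ρ := by rw [hϑ, gs_polar]
  have hXi : X i = ρ * c := by rw [← hpc, ← hϑ]
  have hφ' : phi X = (1 - gr ρ) / ρ ^ 2 := by
    rw [← hgX, ← hφ, ← hρd]; field_simp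
  rw [hXi, hφ']
  push_cast
  field_simp
  ring

theorem pd_logPot_eta0 (i : Fin 2) (X : Plane) : pd i (logPot eta0) X = -(phi X * X i) := by
  have e : eta0 = fun X => gs X * (1 / (4 * Real.pi)) := by
    funext X; rw [eta0_eq]; ring
  rw [e, pd_logPot i (TG.const _)]
  have e2 : (fun X => gs X * Dg i (fun _ => 1 / (4 * Real.pi)) X) =
      fun X : Plane => gs X * (-(1 / (8 * Real.pi)) * X i + 0 * X i) := by
    funext X; rw [Dg, pd_const]; field_simp; ring
  rw [e2, logPot_linear (TG.coord i) (TG.coord i), logPot_gs_coord]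
  have := Real.pi_ne_zero
  field_simp; ring

/-! ### Inverting `S` for `n ≥ 2` by contraction. -/

theorem sq_le_mul_exp_sub_one {s : ℝ} (hs : 0 ≤ s) : s ^ 2 ≤ 0.76 * (Real.exp s - 1) := by
  have h := Real.sum_le_exp_of_nonneg hs 4
  norm_num [Finset.sum_range_succ, Nat.factorial] at h
  -- With the cubic Taylor polynomial the claim is `s` times a quadratic of slightly negative
  -- discriminant whose vertex is near 2.4.
  nlinarith [mul_nonneg hs (sq_nonneg (s - 2.4))]

/-- With `s = |X|²/4` and `X ≠ 0` the left side is `16 s²/(e^s - 1)`, and `12.16 = 16 · 0.76`. -/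
theorem gs_mul_inv_phi_mul_le (X : Plane) : gs X * (phi X)⁻¹ * ‖X‖ ^ 2 ≤ 12.16 := by
  rcases eq_or_ne X 0 with rfl | hX
  · simp; norm_num
  have hX2 : 0 < ‖X‖ ^ 2 := by have := norm_pos_iff.2 hX; positivity
  have h := sq_le_mul_exp_sub_one (s := ‖X‖ ^ 2 / 4) (by positivity)
  have h1 := phi_mul X
  have h2 := gs_mul_exp X
  have h3 := mul_le_mul_of_nonneg_left h (gs_pos X).le
  have h4 : gs X * ‖X‖ ^ 2 * ‖X‖ ^ 2 ≤ 12.16 * phi X * ‖X‖ ^ 2 := by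
    rw [mul_assoc 12.16, h1]
    nlinarith
  have h5 := le_of_mul_le_mul_right h4 hX2
  rw [mul_right_comm, ← div_eq_mul_inv, div_le_iff₀ (phi_pos X)]
  exact h5

/-- The function `w` such that `Φ w - (8π)⁻¹ ψ = G`. -/
def srcOf (G ψ : Plane → ℝ) (X : Plane) : ℝ := (G X + 1 / (8 * Real.pi) * ψ X) * (phi X)⁻¹

section

variable {G ψ : Plane → ℝ} {k n : ℕ}

theorem TG.srcOf (hG : TG k G) (hψ : TG k ψ) : TG k (srcOf G ψ) :=
  (hG.add (hψ.smul _)).mul (SM.inv_phi k)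

theorem inv_phi_radial {X X' : Plane} (h : ‖X‖ = ‖X'‖) : (phi X)⁻¹ = (phi X')⁻¹ := by
  rw [phi_radial h]

theorem Equi.srcOf (hG : Equi n G) (hψ : Equi n ψ) : Equi n (srcOf G ψ) := by
  have := (hG.linear hψ 1 (1 / (8 * Real.pi))).mul_radial (g := fun X => (phi X)⁻¹)
    fun X X' h => inv_phi_radial h
  simp only [one_mul] at this
  exact this

/-- Bootstrap: `srcOf G ψ` is as regular as ψ, and the potential of it, which is ψ, is one
derivative better. -/
theorem SM.srcOf (hG : SM G) (h0 : TG 0 ψ) (h : ψ = logPot fun X => gs X * srcOf G ψ X) :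
    SM (srcOf G ψ) := by
  have key : ∀ k, TG k ψ := fun k => by
    induction k with
    | zero => exact h0
    | succ k ih => rw [h]; exact tg_logPot ((hG k).srcOf ih)
  exact fun k => (hG k).srcOf (key k)

theorem srcOf_spec (h : ψ = logPot fun X => gs X * srcOf G ψ X) (X : Plane) :
    phi X * srcOf G ψ X - 1 / (8 * Real.pi) * logPot (fun X => gs X * srcOf G ψ X) X = G X := by
  rw [← h, VortexRing.srcOf]
  have := (phi_pos X).ne'
  field_simp; ring

/-- Banach's theorem on the closed set of `n`-equivariant bounded continuous functions. Only the
image of the map needs to be bounded: `G` may grow, since the Gaussian tames it. -/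
theorem exists_fixed_point (hn : 2 ≤ n) (hG : TG 0 G) (hGe : Equi n G) :
    ∃ ψ, TG 0 ψ ∧ Equi n ψ ∧ ψ = logPot fun X => gs X * srcOf G ψ X := by
  have hn1 : 1 ≤ n := by omega
  have tg0 : ∀ ψ : BoundedContinuousFunction Plane ℝ, TG 0 ψ := fun ψ =>
    ⟨ψ.continuous, PB.of_bound (C := ‖ψ‖) fun X => ψ.norm_coe_le_norm X⟩
  let S : Set (BoundedContinuousFunction Plane ℝ) := {ψ | Equi n ψ}
  have hS : IsClosed S := by
    have : S = ⋂ θ : ℝ, ⋂ X : Plane, {ψ | ψ (rot θ X) =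
        Real.cos (n * θ) * ψ X + Real.sin (n * θ) * ψ (rot (Real.pi / (2 * n)) X)} := by
      ext ψ; simp [S, Equi]
    rw [this]
    refine isClosed_iInter fun θ => isClosed_iInter fun X => isClosed_eq
      (ContinuousEvalConst.continuous_eval_const _) ?_
    exact ((ContinuousEvalConst.continuous_eval_const _).const_mul _).add
      ((ContinuousEvalConst.continuous_eval_const _).const_mul _)
  have hcomp : CompleteSpace S := hS.completeSpace_coe
  have hne : Nonempty S := ⟨⟨0, fun θ X => by simp⟩⟩
  have hb : ∀ ψ : S, ∃ C, ∀ X, ‖logPot (fun X => gs X * srcOf G ψ.1 X) X‖ ≤ C := fun ψ => by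
    have h0 := hG.srcOf (tg0 ψ.1)
    obtain ⟨M, hM⟩ := exists_bound_gs_mul (w := fun X => srcOf G ψ.1 X * ‖X‖ ^ 2)
      (h0.mul TG.normSq)
    refine ⟨_, abs_logPot_le hn1 h0 (hGe.srcOf ψ.2) (M := M) fun X => ?_⟩
    have := hM X
    rwa [← mul_assoc, abs_mul, abs_of_nonneg (sq_nonneg ‖X‖)] at this
  choose C hC using hb
  let T : S → S := fun ψ => ⟨BoundedContinuousFunction.ofNormedAddCommGroup
    (logPot fun X => gs X * srcOf G ψ.1 X) (tg_logPot (hG.srcOf (tg0 ψ.1))).zero_of.continuous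
    (C ψ) (hC ψ), (hGe.srcOf ψ.2).logPot (hG.srcOf (tg0 ψ.1))⟩
  -- The Lipschitz bound is `(2π/n²) · 12.16/(8π) = 3.04/n²`, at most 0.76 when `n ≥ 2`. For `n = 1`
  -- it exceeds 1.
  have hT : ContractingWith 0.76 T := by
    refine ⟨by norm_num [← NNReal.coe_lt_coe], LipschitzWith.of_dist_le_mul fun ψ₁ ψ₂ => ?_⟩
    have hd : 0 ≤ dist ψ₁ ψ₂ := dist_nonneg
    refine (BoundedContinuousFunction.dist_le (by positivity)).2 fun X => ?_
    have hu := hG.srcOf (tg0 ψ₁.1)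
    have hv := hG.srcOf (tg0 ψ₂.1)
    have hl := logPot_linear hu hv 1 (-1) X
    have hδ0 : TG 0 fun X => 1 * srcOf G ψ₁.1 X + -1 * srcOf G ψ₂.1 X :=
      (hu.smul 1).add (hv.smul (-1))
    have hδ := abs_logPot_le (M := 12.16 / (8 * Real.pi) * dist ψ₁ ψ₂) hn1 hδ0
      ((hGe.srcOf ψ₁.2).linear (hGe.srcOf ψ₂.2) 1 (-1)) (fun X => by
        have e : gs X * (1 * srcOf G ψ₁.1 X + -1 * srcOf G ψ₂.1 X) =
            gs X * (phi X)⁻¹ * (1 / (8 * Real.pi) * (ψ₁.1 X - ψ₂.1 X)) := by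
          simp only [VortexRing.srcOf]; ring
        have h1 : |ψ₁.1 X - ψ₂.1 X| ≤ dist ψ₁ ψ₂ :=
          BoundedContinuousFunction.dist_coe_le_dist (f := ψ₁.1) (g := ψ₂.1) X
        have h2 := gs_mul_inv_phi_mul_le X
        have h3 : 0 ≤ gs X * (phi X)⁻¹ := mul_nonneg (gs_pos X).le (inv_nonneg.2 (phi_pos X).le)
        rw [e, abs_mul, abs_of_nonneg h3, abs_mul, abs_of_pos (by positivity), mul_right_comm]
        calc gs X * (phi X)⁻¹ * ‖X‖ ^ 2 * (1 / (8 * Real.pi) * |ψ₁.1 X - ψ₂.1 X|) ≤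
            12.16 * (1 / (8 * Real.pi) * dist ψ₁ ψ₂) := by gcongr
          _ = _ := by ring) X
    have hn2 : (2 : ℝ) ≤ n := by exact_mod_cast hn
    have e3 : dist ((T ψ₁).1 X) ((T ψ₂).1 X) =
        |logPot (fun X => gs X * (1 * srcOf G ψ₁.1 X + -1 * srcOf G ψ₂.1 X)) X| := by
      rw [hl, Real.dist_eq]
      congr 1
      simp only [T, BoundedContinuousFunction.coe_ofNormedAddCommGroup]; ring
    rw [e3]
    refine hδ.trans ?_
    have e4 : 2 * Real.pi * (12.16 / (8 * Real.pi) * dist ψ₁ ψ₂) / (n : ℝ) ^ 2 =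
      3.04 * dist ψ₁ ψ₂ / (n : ℝ) ^ 2 := by
      have := Real.pi_ne_zero
      field_simp; ring
    rw [e4, div_le_iff₀ (by positivity)]
    have : ((0.76 : NNReal) : ℝ) = 0.76 := by norm_num
    rw [this]
    nlinarith [mul_nonneg hd (by nlinarith : (0 : ℝ) ≤ (n : ℝ) ^ 2 - 4)]
  let ψ := ContractingWith.fixedPoint T hT
  have hfix : T ψ = ψ := hT.fixedPoint_isFixedPt
  refine ⟨ψ.1, tg0 ψ.1, ψ.2, ?_⟩
  conv_lhs => rw [← hfix]
  rfl

end

/-! ### Inverting `S` for `n = 1` by quadrature. -/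

/-- The mass of the radial profile `b`, with weight `2πr²`. -/
def massOf (b : ℝ → ℝ) (r : ℝ) : ℝ := ∫ t in (0 : ℝ)..r, 2 * Real.pi * t ^ 2 * b t

/-- Minus the derivative of `velOf`. -/
def fluxOf (b : ℝ → ℝ) (r : ℝ) : ℝ := massOf b r * r / (1 - gr r) ^ 2

/-- The quotient of the solution of the first angular mode by the one of the homogeneous
equation. -/
def velOf (b : ℝ → ℝ) (r : ℝ) : ℝ := -∫ t in (0 : ℝ)..r, fluxOf b t

theorem continuous_gr : Continuous gr := by unfold gr; fun_prop

theorem sq_le_mul_one_sub_gr (r : ℝ) : r ^ 2 ≤ (4 + r ^ 2) * (1 - gr r) := by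
  have h := Real.add_one_le_exp (r ^ 2 / 4)
  have h1 : gr r * Real.exp (r ^ 2 / 4) = 1 := by rw [gr, ← Real.exp_add]; simp
  have h2 : 0 < gr r := Real.exp_pos _
  nlinarith [mul_le_mul_of_nonneg_left h h2.le]

theorem gr_lt_one {r : ℝ} (hr : 0 < r) : 0 < 1 - gr r := by
  have := sq_le_mul_one_sub_gr r
  by_contra h
  have h2 : 0 < r ^ 2 := by positivity
  nlinarith [mul_nonneg (by positivity : 0 ≤ 4 + r ^ 2) (by linarith : 0 ≤ -(1 - gr r))]

section quadrature

variable {b : ℝ → ℝ}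

theorem hasDerivAt_massOf (hb : Continuous b) (r : ℝ) :
    HasDerivAt (massOf b) (2 * Real.pi * r ^ 2 * b r) r :=
  ((by fun_prop : Continuous fun t => 2 * Real.pi * t ^ 2 * b t)).integral_hasStrictDerivAt 0 r
    |>.hasDerivAt

theorem continuous_massOf (hb : Continuous b) : Continuous (massOf b) :=
  continuous_iff_continuousAt.2 fun r => (hasDerivAt_massOf hb r).continuousAt

theorem abs_massOf_le {M : ℝ} (hM : ∀ r, |b r| ≤ M) (r : ℝ) :
    |massOf b r| ≤ 2 * Real.pi * M * |r| ^ 3 := by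
  have hM0 : 0 ≤ M := (abs_nonneg _).trans (hM 0)
  have h := intervalIntegral.norm_integral_le_of_norm_le_const (a := 0) (b := r)
    (f := fun t => 2 * Real.pi * t ^ 2 * b t) (C := 2 * Real.pi * r ^ 2 * M) fun t ht => by
      have h1 : |t| ≤ |r| := by
        have := Set.abs_sub_left_of_mem_uIcc (Set.uIoc_subset_uIcc ht)
        simpa using this
      have h2 : t ^ 2 ≤ r ^ 2 := sq_le_sq.2 h1
      rw [Real.norm_eq_abs, abs_mul, abs_of_nonneg (by positivity)]
      exact mul_le_mul (by nlinarith [Real.pi_pos]) (hM t) (abs_nonneg _) (by positivity)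
  rw [Real.norm_eq_abs, sub_zero] at h
  refine h.trans (le_of_eq ?_)
  rw [← sq_abs r]; ring

/-- The mass is `O(|r|³)`, which together with the factor `r` compensates the vanishing of `(1 - gr
r)²` to order `r⁴`. Hence `velOf` is continuous up to the origin and grows polynomially. -/
theorem abs_fluxOf_le {M : ℝ} (hM : ∀ r, |b r| ≤ M) (r : ℝ) :
    |fluxOf b r| ≤ 2 * Real.pi * M * (4 + r ^ 2) ^ 2 := by
  have hM0 : 0 ≤ M := (abs_nonneg _).trans (hM 0)
  rcases eq_or_ne r 0 with rfl | hr
  · simp [fluxOf]; positivity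
  have hr2 : 0 < r ^ 2 := by positivity
  have h1 := sq_le_mul_one_sub_gr r
  have hp : 0 < 1 - gr r := by
    by_contra h
    nlinarith [mul_nonneg (by positivity : 0 ≤ 4 + r ^ 2) (by linarith : 0 ≤ -(1 - gr r))]
  rw [fluxOf, abs_div, abs_mul, abs_of_nonneg (sq_nonneg (1 - gr r)), div_le_iff₀ (by positivity)]
  have h2 := mul_le_mul_of_nonneg_right (abs_massOf_le hM r) (abs_nonneg r)
  have h3 := pow_le_pow_left₀ hr2.le h1 2
  have h4 : |r| ^ 3 * |r| = (r ^ 2) ^ 2 := by rw [← sq_abs r]; ring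
  calc |massOf b r| * |r| ≤ 2 * Real.pi * M * (|r| ^ 3 * |r|) := by linarith
    _ ≤ 2 * Real.pi * M * ((4 + r ^ 2) * (1 - gr r)) ^ 2 := by rw [h4]; gcongr
    _ = _ := by ring

theorem intervalIntegrable_fluxOf (hb : Continuous b) {M : ℝ} (hM : ∀ r, |b r| ≤ M) (x y : ℝ) :
    IntervalIntegrable (fluxOf b) volume x y := by
  have hm : Measurable (fluxOf b) :=
    ((continuous_massOf hb).measurable.mul measurable_id).div
      ((measurable_const.sub continuous_gr.measurable).pow_const 2)
  exact (Continuous.intervalIntegrable (by fun_prop : Continuous fun r : ℝ =>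
    2 * Real.pi * M * (4 + r ^ 2) ^ 2) x y).mono_fun hm.aestronglyMeasurable
    (Filter.Eventually.of_forall fun r => (abs_fluxOf_le hM r).trans (le_abs_self _))

theorem continuous_velOf (hb : Continuous b) {M : ℝ} (hM : ∀ r, |b r| ≤ M) :
    Continuous (velOf b) :=
  (intervalIntegral.continuous_primitive (intervalIntegrable_fluxOf hb hM) 0).neg

theorem hasDerivAt_velOf (hb : Continuous b) {M : ℝ} (hM : ∀ r, |b r| ≤ M) {r : ℝ} (hr : 0 < r) :
    HasDerivAt (velOf b) (-fluxOf b r) r := by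
  have hc : ∀ r, 0 < r → ContinuousAt (fluxOf b) r := fun r hr =>
    (((continuous_massOf hb).mul continuous_id).continuousAt).div
      ((continuous_const.sub continuous_gr).pow 2).continuousAt
      (pow_ne_zero 2 (gr_lt_one hr).ne')
  refine (intervalIntegral.integral_hasDerivAt_right (intervalIntegrable_fluxOf hb hM 0 r) ?_
    (hc r hr)).neg
  exact ContinuousAt.stronglyMeasurableAtFilter isOpen_Ioi (fun x hx => hc x hx) r hr

theorem abs_velOf_le {M : ℝ} (hM : ∀ r, |b r| ≤ M) (r : ℝ) :
    |velOf b r| ≤ 2 * Real.pi * M * (4 + r ^ 2) ^ 2 * |r| := by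
  have hM0 : 0 ≤ M := (abs_nonneg _).trans (hM 0)
  have h := intervalIntegral.norm_integral_le_of_norm_le_const (a := 0) (b := r)
    (f := fluxOf b) (C := 2 * Real.pi * M * (4 + r ^ 2) ^ 2) fun t ht => by
      have h1 : |t| ≤ |r| := by
        have := Set.abs_sub_left_of_mem_uIcc (Set.uIoc_subset_uIcc ht)
        simpa using this
      have h2 : t ^ 2 ≤ r ^ 2 := sq_le_sq.2 h1
      refine (abs_fluxOf_le hM t).trans ?_
      gcongr
  rw [velOf, abs_neg]
  simpa using h

/-- Reduction of order: `h = (1 - gr)/r` solves the homogeneous radial equation, and seeking ψ as `h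
v` leads to `(r h² v')' = -2π r² b`, that is `v' = -fluxOf b`. The lemma verifies the integral form
of this equation. -/
theorem integral_ker_one_eq (hb : Continuous b) {M : ℝ} (hM : ∀ r, |b r| ≤ M)
    (hlim : Filter.Tendsto (massOf b) Filter.atTop (nhds 0)) {a : ℝ → ℝ} (hac : Continuous a)
    (ha : ∀ r, 0 < r → a r = b r * r ^ 2 / (1 - gr r) + gr r * r * velOf b r / (8 * Real.pi))
    {M' : ℝ} (haM : ∀ r, 0 < r → |a r| * r ^ 2 ≤ M') {ρ : ℝ} (hρ : 0 < ρ) :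
    ∫ r in Set.Ioi (0 : ℝ), (min r ρ / max r ρ) ^ 1 * a r * r =
      1 / Real.pi * ((1 - gr ρ) / ρ * velOf b ρ) := by
  have hpi := Real.pi_ne_zero
  have hv := continuous_velOf hb hM
  have hm := continuous_massOf hb
  have hgc := continuous_gr
  have hM0 : 0 ≤ M := (abs_nonneg _).trans (hM 0)
  rw [integral_ker_one (M := M') hρ
    -- In `F/ρ + ρ H` the mass terms and the terms `ρ gr v` cancel, leaving only the multiple of `(1
    -- - gr ρ)/ρ · v`.
    (F := fun r => 1 / (2 * Real.pi) * ((2 * (1 - gr r) - r ^ 2 * gr r / 2) * velOf b r +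
      massOf b r * (r ^ 2 / (1 - gr r))))
    (H := fun r => 1 / (2 * Real.pi) * (gr r * velOf b r / 2 - massOf b r / (1 - gr r)))
    ?_ ?_ ?_ ?_ hac haM]
  · have := (gr_lt_one hρ).ne'
    field_simp; ring
  · intro r hr
    have hg := hasDerivAt_gr r
    have hne := (gr_lt_one hr).ne'
    refine (((((hg.const_sub 1).const_mul 2).sub
      (((hasDerivAt_pow 2 r).mul hg).div_const 2)).mul (hasDerivAt_velOf hb hM hr)).add
      ((hasDerivAt_massOf hb r).mul ((hasDerivAt_pow 2 r).div (hg.const_sub 1) hne))).const_mul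
      (1 / (2 * Real.pi)) |>.congr_deriv ?_
    rw [ha r hr, fluxOf]
    simp only [Pi.mul_apply, Pi.sub_apply, Pi.div_apply]
    push_cast
    field_simp
    ring
  · have h1 : Filter.Tendsto (fun r => (2 * (1 - gr r) - r ^ 2 * gr r / 2) * velOf b r)
        (nhdsWithin 0 (Set.Ioi 0)) (nhds 0) := by
      have hc : Continuous fun r => (2 * (1 - gr r) - r ^ 2 * gr r / 2) * velOf b r := by fun_prop
      have := hc.tendsto 0
      have e : velOf b 0 = 0 := by simp [velOf]
      simp only [e, mul_zero] at this
      exact this.mono_left nhdsWithin_le_nhds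
    have h2 : Filter.Tendsto (fun r => massOf b r * (r ^ 2 / (1 - gr r)))
        (nhdsWithin 0 (Set.Ioi 0)) (nhds 0) := by
      have hc : Continuous fun r => |massOf b r| * (4 + r ^ 2) := by fun_prop
      have := hc.tendsto 0
      have e : massOf b 0 = 0 := by simp [massOf]
      simp only [e, abs_zero, zero_mul] at this
      refine squeeze_zero_norm' ?_ (this.mono_left nhdsWithin_le_nhds)
      filter_upwards [self_mem_nhdsWithin] with r hr
      have hp := gr_lt_one hr
      rw [norm_mul, Real.norm_eq_abs, Real.norm_of_nonneg (by positivity)]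
      refine mul_le_mul_of_nonneg_left ?_ (abs_nonneg _)
      rw [div_le_iff₀ hp]; exact sq_le_mul_one_sub_gr r
    simpa using (h1.add h2).const_mul (1 / (2 * Real.pi))
  · intro r hr
    have hg := hasDerivAt_gr r
    have hne := (gr_lt_one hr).ne'
    refine (((hg.mul (hasDerivAt_velOf hb hM hr)).div_const 2).sub
      ((hasDerivAt_massOf hb r).div (hg.const_sub 1) hne)).const_mul
      (1 / (2 * Real.pi)) |>.congr_deriv ?_
    rw [ha r hr, fluxOf]
    field_simp
    ring
  · have h1 : Filter.Tendsto (fun r => gr r * velOf b r / 2) Filter.atTop (nhds 0) := by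
      -- The coefficients expand `r (4 + r²)²`, the growth allowed to `velOf`.
      have := ((((tendsto_pow_mul_gr 1).const_mul 16).add
        (((tendsto_pow_mul_gr 3).const_mul 8).add (tendsto_pow_mul_gr 5))).const_mul
        (2 * Real.pi * M / 2))
      simp only [mul_zero, add_zero] at this
      refine squeeze_zero_norm' ?_ this
      filter_upwards [Filter.eventually_ge_atTop (0 : ℝ)] with r hr
      have h := abs_velOf_le hM r
      rw [abs_of_nonneg hr] at h
      have hg : 0 < gr r := Real.exp_pos _
      rw [norm_div, norm_mul, Real.norm_of_nonneg hg.le, Real.norm_eq_abs, Real.norm_eq_abs,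
        abs_two]
      have := mul_le_mul_of_nonneg_left h hg.le
      linarith
    -- The solvability condition enters here: `H` decays at infinity only because the total mass is
    -- zero.
    have h2 : Filter.Tendsto (fun r => massOf b r / (1 - gr r)) Filter.atTop (nhds 0) := by
      have h3 : Filter.Tendsto (fun r => 1 - gr r) Filter.atTop (nhds (1 - 0)) := by
        have := (tendsto_pow_mul_gr 0).const_sub 1
        simpa using this
      have := hlim.div h3 (by norm_num)
      rwa [zero_div] at this
    simpa using (h1.sub h2).const_mul (1 / (2 * Real.pi))

end quadrature

section modeOne

variable {G : Plane → ℝ}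

theorem integrableOn_gr_mul {u : Plane → ℝ} (hu : TG 0 u) (ϑ : ℝ) :
    IntegrableOn (fun r => gr r * u (polar r ϑ)) (Set.Ioi 0) := by
  obtain ⟨M, hM⟩ := exists_bound_gs_mul (w := fun X => u X * ‖X‖ ^ 2) (hu.mul TG.normSq)
  have hp : Continuous fun r => polar r ϑ :=
    continuous_polar.comp (by fun_prop : Continuous fun r : ℝ => (r, ϑ))
  have hc : Continuous fun r => gr r * u (polar r ϑ) := continuous_gr.mul (hu.continuous.comp hp)
  rw [← Set.Ioc_union_Ioi_eq_Ioi (zero_le_one (α := ℝ))]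
  refine (hc.integrableOn_Icc.mono_set Set.Ioc_subset_Icc_self).union ?_
  refine Integrable.mono' ((integrableOn_Ioi_rpow_of_lt (a := -2) (by norm_num)
    one_pos).const_mul M) hc.aestronglyMeasurable ?_
  filter_upwards [ae_restrict_mem measurableSet_Ioi] with r hr
  have hr0 : 0 < r := lt_trans one_pos hr
  have h := hM (polar r ϑ)
  rw [gs_polar, norm_polar hr0.le, ← mul_assoc, abs_mul, abs_of_nonneg (sq_nonneg r)] at h
  rwa [Real.rpow_neg hr0.le, ← div_eq_mul_inv, le_div_iff₀ (by positivity), Real.rpow_two]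

theorem Equi.apply_polar (hG : Equi 1 G) (r ϑ : ℝ) :
    G (polar r ϑ) = Real.cos ϑ * G (polar r 0) + Real.sin ϑ * G (polar r (Real.pi / 2)) := by
  have h := hG ϑ (polar r 0)
  rw [rot_polar, rot_polar] at h
  simpa using h

theorem integral_gs_mul_coord (hG : TG 0 G) (hGe : Equi 1 G) (i : Fin 2) :
    ∫ X, gs X * (G X * X i) = Real.pi * ∫ r in Set.Ioi (0 : ℝ),
      gr r * (G (polar r (if i = 0 then 0 else Real.pi / 2)) * r ^ 2) := by
  have hc : Continuous fun X : Plane => gs X * (G X * X i) :=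
    continuous_gs.mul (hG.continuous.mul (TG.coord (k := 0) i).continuous)
  rw [integral_polar hc.measurable (hG.mul (TG.coord i)).integrable, ← integral_const_mul]
  refine integral_congr_ae (Filter.Eventually.of_forall fun r => ?_)
  simp only [gs_polar]
  have s1 : ∫ θ in (-Real.pi)..Real.pi, Real.cos θ ^ 2 = Real.pi := by
    rw [integral_cos_sq]; simp
  have s2 : ∫ θ in (-Real.pi)..Real.pi, Real.sin θ ^ 2 = Real.pi := by
    rw [integral_sin_sq]; simp
  have s3 : ∫ θ in (-Real.pi)..Real.pi, Real.sin θ * Real.cos θ = 0 := by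
    rw [integral_sin_mul_cos₁]; simp
  have lin : ∀ c d : ℝ, ∀ f g : ℝ → ℝ, Continuous f → Continuous g →
      ∫ θ in (-Real.pi)..Real.pi, (c * f θ + d * g θ) =
        c * (∫ θ in (-Real.pi)..Real.pi, f θ) + d * ∫ θ in (-Real.pi)..Real.pi, g θ :=
    fun c d f g hf hg => by
      rw [intervalIntegral.integral_add ((hf.const_mul c).intervalIntegrable _ _)
        ((hg.const_mul d).intervalIntegrable _ _), intervalIntegral.integral_const_mul,
        intervalIntegral.integral_const_mul]
  fin_cases i
  · have e : ∀ θ, r * (gr r * (G (polar r θ) * polar r θ 0)) =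
        r ^ 2 * gr r * G (polar r 0) * Real.cos θ ^ 2 +
          r ^ 2 * gr r * G (polar r (Real.pi / 2)) * (Real.sin θ * Real.cos θ) := fun θ => by
      rw [hGe.apply_polar r θ, polar_zero]; ring
    simp only [Fin.zero_eta, e, if_true]
    rw [lin _ _ _ _ (by fun_prop) (by fun_prop), s1, s3]; ring
  · have e : ∀ θ, r * (gr r * (G (polar r θ) * polar r θ 1)) =
        r ^ 2 * gr r * G (polar r (Real.pi / 2)) * Real.sin θ ^ 2 +
          r ^ 2 * gr r * G (polar r 0) * (Real.sin θ * Real.cos θ) := fun θ => by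
      rw [hGe.apply_polar r θ, polar_one]; ring
    simp only [Fin.mk_one, e]
    rw [lin _ _ _ _ (by fun_prop) (by fun_prop), s2, s3]; simp; ring

/-- In the first mode the angular integration of `G X_i` isolates one amplitude, read on the ray of
angle 0 or π/2. The limiting mass is twice the corresponding first moment. -/
theorem tendsto_massOf (hG : TG 0 G) (hGe : Equi 1 G) (i : Fin 2)
    (h0 : ∫ X, gs X * (G X * X i) = 0) :
    Filter.Tendsto (massOf fun r => gr r * G (polar r (if i = 0 then 0 else Real.pi / 2)))
      Filter.atTop (nhds 0) := by
  set ϑ := if i = 0 then 0 else Real.pi / 2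
  have hi := integrableOn_gr_mul (hG.mul TG.normSq) ϑ
  have e : Set.EqOn (fun r => 2 * Real.pi * (gr r * (G (polar r ϑ) * ‖polar r ϑ‖ ^ 2)))
      (fun r => 2 * Real.pi * r ^ 2 * (gr r * G (polar r ϑ))) (Set.Ioi 0) := fun r hr => by
    simp only [norm_polar (le_of_lt hr)]; ring
  have h1 := intervalIntegral_tendsto_integral_Ioi 0
    (IntegrableOn.congr_fun (hi.const_mul (2 * Real.pi)) e measurableSet_Ioi) Filter.tendsto_id
  rw [integral_gs_mul_coord hG hGe i] at h0
  have h2 : ∫ r in Set.Ioi (0 : ℝ), 2 * Real.pi * r ^ 2 * (gr r * G (polar r ϑ)) = 0 := by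
    have : ∀ r, 2 * Real.pi * r ^ 2 * (gr r * G (polar r ϑ)) =
      2 * (Real.pi * (gr r * (G (polar r ϑ) * r ^ 2))) := fun r => by ring
    simp only [this]
    rw [integral_const_mul, integral_const_mul, h0, mul_zero]
  rw [h2] at h1
  exact h1

theorem massOf_linear {b b' : ℝ → ℝ} (hb : Continuous b) (hb' : Continuous b') (c d r : ℝ) :
    massOf (fun r => c * b r + d * b' r) r = c * massOf b r + d * massOf b' r := by
  rw [massOf, massOf, massOf, ← intervalIntegral.integral_const_mul,
    ← intervalIntegral.integral_const_mul, ← intervalIntegral.integral_add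
    (Continuous.intervalIntegrable (by fun_prop) _ _)
    (Continuous.intervalIntegrable (by fun_prop) _ _)]
  congr 1; funext t; ring

theorem velOf_linear {b b' : ℝ → ℝ} (hb : Continuous b) (hb' : Continuous b') {M M' : ℝ}
    (hM : ∀ r, |b r| ≤ M) (hM' : ∀ r, |b' r| ≤ M') (c d r : ℝ) :
    velOf (fun r => c * b r + d * b' r) r = c * velOf b r + d * velOf b' r := by
  have e : ∀ t, fluxOf (fun r => c * b r + d * b' r) t = c * fluxOf b t + d * fluxOf b' t :=
    fun t => by rw [fluxOf, massOf_linear hb hb', fluxOf, fluxOf]; ring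
  rw [velOf, velOf, velOf]
  simp only [e]
  rw [intervalIntegral.integral_add ((intervalIntegrable_fluxOf hb hM _ _).const_mul c)
    ((intervalIntegrable_fluxOf hb' hM' _ _).const_mul d), intervalIntegral.integral_const_mul,
    intervalIntegral.integral_const_mul]
  ring

theorem exists_fixed_point_one (hG : TG 0 G) (hGe : Equi 1 G)
    (h0 : ∀ i, ∫ X, gs X * (G X * X i) = 0) :
    ∃ ψ, TG 0 ψ ∧ Equi 1 ψ ∧ ψ = logPot fun X => gs X * srcOf G ψ X := by
  obtain ⟨M, hM⟩ := exists_bound_gs_mul hG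
  let b : ℝ → ℝ → ℝ := fun ϑ r => gr r * G (polar r ϑ)
  have hp : ∀ ϑ, Continuous fun r => polar r ϑ := fun ϑ =>
    continuous_polar.comp (by fun_prop : Continuous fun r : ℝ => (r, ϑ))
  have hb : ∀ ϑ, Continuous (b ϑ) := fun ϑ => continuous_gr.mul (hG.continuous.comp (hp ϑ))
  have hbM : ∀ ϑ r, |b ϑ r| ≤ M := fun ϑ r => by
    have := hM (polar r ϑ); rwa [gs_polar] at this
  have hM0 : 0 ≤ M := (abs_nonneg _).trans (hM 0)
  have hbl : ∀ ϑ, b ϑ = fun r => Real.cos ϑ * b 0 r + Real.sin ϑ * b (Real.pi / 2) r := fun ϑ => by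
    funext r; simp only [b]; rw [hGe.apply_polar r ϑ]; ring
  have hvl : ∀ ϑ r, velOf (b ϑ) r =
      Real.cos ϑ * velOf (b 0) r + Real.sin ϑ * velOf (b (Real.pi / 2)) r := fun ϑ r => by
    rw [hbl ϑ]; exact velOf_linear (hb _) (hb _) (hbM _) (hbM _) _ _ _
  have hlim : ∀ ϑ, Filter.Tendsto (massOf (b ϑ)) Filter.atTop (nhds 0) := fun ϑ => by
    have h1 := tendsto_massOf hG hGe 0 (h0 0)
    have h2 := tendsto_massOf hG hGe 1 (h0 1)
    have h3 := (h1.const_mul (Real.cos ϑ)).add (h2.const_mul (Real.sin ϑ))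
    rw [mul_zero, mul_zero, add_zero] at h3
    refine h3.congr fun r => ?_
    rw [hbl ϑ]
    exact (massOf_linear (hb _) (hb _) _ _ r).symm
  -- Two scalar quadratures, for the cosine and sine amplitudes, combined in Cartesian form so that
  -- continuity at the origin is immediate.
  let ψ : Plane → ℝ := fun X =>
    1 * (X 0 * (phi X * velOf (b 0) ‖X‖)) + 1 * (X 1 * (phi X * velOf (b (Real.pi / 2)) ‖X‖))
  have htg : ∀ ϑ, TG 0 fun X => velOf (b ϑ) ‖X‖ := fun ϑ => by
    refine ⟨(continuous_velOf (hb ϑ) (hbM ϑ)).comp continuous_norm, ?_⟩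
    have hs : TG 0 fun X : Plane => 2 * Real.pi * M * ((4 + ‖X‖ ^ 2) * (4 + ‖X‖ ^ 2)) :=
      ((TG.const 4).add TG.normSq |>.mul ((TG.const 4).add TG.normSq)).smul _
    refine PB.mono (hs.pb.mul PB.norm) fun X => ?_
    refine ((abs_velOf_le (hbM ϑ) ‖X‖).trans (le_of_eq ?_)).trans (le_abs_self _)
    rw [abs_norm]; ring
  have hψ : TG 0 ψ :=
    (((TG.coord 0).mul ((SM.phi 0).mul (htg 0))).smul 1).add
      (((TG.coord 1).mul ((SM.phi 0).mul (htg _))).smul 1)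
  have hψe : Equi 1 ψ :=
    ((equi_coord 0).mul_radial (g := fun X => phi X * velOf (b 0) ‖X‖)
      fun X X' h => by rw [phi_radial h, h]).linear
    ((equi_coord 1).mul_radial (g := fun X => phi X * velOf (b (Real.pi / 2)) ‖X‖)
      fun X X' h => by rw [phi_radial h, h]) 1 1
  have hψp : ∀ ϑ r, 0 < r → ψ (polar r ϑ) = phi (polar r ϑ) * r * velOf (b ϑ) r := fun ϑ r hr => by
    simp only [ψ, norm_polar hr.le, hvl ϑ r, polar_zero, polar_one]; ring
  have hs := hG.srcOf hψ
  have hse := hGe.srcOf hψe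
  refine ⟨ψ, hψ, hψe, funext fun X => ?_⟩
  rcases eq_or_ne X 0 with rfl | hX
  · rw [hψe.apply_zero le_rfl, (hse.logPot hs).apply_zero le_rfl]
  obtain ⟨ϑ, hϑ⟩ := exists_polar X
  have hρ : 0 < ‖X‖ := norm_pos_iff.2 hX
  obtain ⟨M', hM'⟩ := exists_bound_gs_mul (w := fun X => srcOf G ψ X * ‖X‖ ^ 2)
    (hs.mul TG.normSq)
  have hφ : ∀ r, 0 < r → phi (polar r ϑ) = (1 - gr r) / r ^ 2 := fun r hr => by
    have := phi_mul (polar r ϑ)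
    rw [gs_polar, norm_polar hr.le] at this
    rw [← this]; field_simp
  have key := integral_ker_one_eq (hb ϑ) (hbM ϑ) (hlim ϑ) (M' := M')
    (a := fun r => gs (polar r ϑ) * srcOf G ψ (polar r ϑ))
    ((continuous_gs.comp (hp ϑ)).mul (hs.continuous.comp (hp ϑ)))
    (fun r hr => by
      have hne := (gr_lt_one hr).ne'
      have := Real.pi_ne_zero
      simp only [srcOf, hψp ϑ r hr, gs_polar, hφ r hr, b]
      field_simp)
    (fun r hr => by
      have := hM' (polar r ϑ)
      rwa [norm_polar hr.le, ← mul_assoc, abs_mul, abs_of_nonneg (sq_nonneg r)] at this) hρ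
  conv_rhs => rw [hϑ, logPot_polar le_rfl hs hse hρ ϑ, key]
  conv_lhs => rw [hϑ, hψp ϑ _ hρ, hφ _ hρ]
  have := Real.pi_ne_zero
  push_cast
  field_simp

end modeOne

/-! ### The operator `S` on smooth elements, its kernel and its range. -/

theorem mem_YnS_toY_iff {n : ℕ} {w : Plane → ℝ} (hw : TG 0 w) : toY w ∈ YnS n ↔ Equi n w := by
  have e : ∀ θ, (Real.cos (n * θ) • toY w + Real.sin (n * θ) • Jn n (toY w) : Y) =
      toY fun X => Real.cos (n * θ) * w X +
        Real.sin (n * θ) * w (rot (Real.pi / (2 * n)) X) := fun θ => by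
    have h := U_eq_toY (Real.pi / (2 * n)) hw.adm
    rw [Jn, h.2, ← toY_smul _ hw.adm, ← toY_smul _ h.1,
      ← toY_add (hw.smul _).adm (adm_const_mul _ h.1)]
  constructor
  · intro h θ
    have h1 := h θ
    rw [e, (U_eq_toY θ hw.adm).2] at h1
    have c1 : TG 0 fun X => w (rot θ X) := hw.comp_rot_zero θ
    have c2 : TG 0 fun X => Real.cos (n * θ) * w X +
        Real.sin (n * θ) * w (rot (Real.pi / (2 * n)) X) :=
      (hw.smul _).add ((hw.comp_rot_zero _).smul _)
    have h2 : (fun X => w (rot θ X)) =ᵐ[volume] fun X => Real.cos (n * θ) * w X +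
        Real.sin (n * θ) * w (rot (Real.pi / (2 * n)) X) := by
      have h3 := toY_ae c1.adm
      rw [h1] at h3
      filter_upwards [h3, toY_ae c2.adm] with X h3 h4
      exact mul_left_cancel₀ (gs_pos X).ne' (h3.symm.trans h4)
    exact congrFun ((Continuous.ae_eq_iff_eq volume c1.continuous c2.continuous).1 h2)
  · intro h θ
    rw [e, (U_eq_toY θ hw.adm).2]
    congr 1; funext X; exact h θ X

theorem Sop_toY {w : Plane → ℝ} (hw : TG 0 w) :
    Sop (toY w) = toY fun X => phi X * w X -
      1 / (8 * Real.pi) * logPot (fun X => gs X * w X) X := by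
  refine (eq_toY ?_).2
  rw [Sop_apply, Kop_apply]
  filter_upwards [Y_sub_ae (PhiOp (toY w)) ((1 / 2 : ℝ) • toY fun X => 1 / (4 * Real.pi) *
    logPot (toY w) X), Y_smul_ae (1 / 2 : ℝ) (toY fun X => 1 / (4 * Real.pi) * logPot (toY w) X),
    PhiOp_ae (toY w), toY_ae (adm_const_mul (1 / (4 * Real.pi)) (adm_logPot (toY w))),
    toY_ae hw.adm] with X h1 h2 h3 h4 h5
  rw [h1, h2, h3, h4, h5, logPot_toY hw.adm]
  have := Real.pi_ne_zero
  field_simp; ring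

theorem Sop_toY_coord (i : Fin 2) : Sop (toY fun X => X i) = 0 := by
  rw [Sop_toY (TG.coord i)]
  have : (fun X : Plane => phi X * X i - 1 / (8 * Real.pi) * logPot (fun X => gs X * X i) X) =
      fun X => (0 : ℝ) * X i := by
    funext X
    rw [logPot_gs_coord]
    have := Real.pi_ne_zero
    field_simp; ring
  rw [this, toY_smul 0 (TG.coord (k := 0) i).adm, zero_smul]

theorem toY_coord_mem (i : Fin 2) : toY (fun X => X i) ∈ YnS 1 :=
  (mem_YnS_toY_iff (TG.coord i)).2 (equi_coord i)

theorem exists_Sop_eq {n : ℕ} {G : Plane → ℝ} (hG : SM G) (hGn : toY G ∈ YnS n)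
    (hn : 2 ≤ n ∨ n = 1 ∧ ∀ i : Fin 2, inner ℝ (toY G) (toY fun X => X i) = 0) :
    ∃ w, SM w ∧ toY w ∈ YnS n ∧ Sop (toY w) = toY G := by
  have hGe := (mem_YnS_toY_iff (hG 0)).1 hGn
  obtain ⟨ψ, h0, he, h⟩ : ∃ ψ, TG 0 ψ ∧ Equi n ψ ∧ ψ = logPot fun X => gs X * srcOf G ψ X := by
    rcases hn with hn | ⟨rfl, hn⟩
    · exact exists_fixed_point hn (hG 0) hGe
    · refine exists_fixed_point_one (hG 0) hGe fun i => ?_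
      rw [← inner_toY_toY hG.adm (TG.coord (k := 0) i).adm, hn i]
  have hw := hG.srcOf h0 h
  refine ⟨_, hw, (mem_YnS_toY_iff (hw 0)).2 (hGe.srcOf he), ?_⟩
  rw [Sop_toY (hw 0)]
  congr 1; funext X; exact srcOf_spec h X

/-! ### Identification of the distributional `Λ` with `LamOp`. -/

/-- The angular derivative. -/
def dang (χ : Plane → ℝ) (X : Plane) : ℝ := X 0 * pd 1 χ X - X 1 * pd 0 χ X

theorem hasDerivAt_comp_rot {χ : Plane → ℝ} (hχ : Differentiable ℝ χ) (X : Plane) (θ : ℝ) :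
    HasDerivAt (fun θ => χ (rot θ X)) (dang χ (rot θ X)) θ := by
  have e : ∀ θ, rot θ X = Real.cos θ • X + Real.sin θ • rot (Real.pi / 2) X := fun θ => by
    have h0 : ∀ X : Plane, rot (Real.pi / 2) X 0 = -X 1 := fun X => by simp [rot_zero_coord]
    have h1 : ∀ X : Plane, rot (Real.pi / 2) X 1 = X 0 := fun X => by simp [rot_one_coord]
    ext i; fin_cases i
    · simp only [Fin.zero_eta, PiLp.add_apply, PiLp.smul_apply, smul_eq_mul, h0]
      rw [rot_zero_coord]; ring
    · simp only [Fin.mk_one, PiLp.add_apply, PiLp.smul_apply, smul_eq_mul, h1]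
      rw [rot_one_coord]; ring
  have h : HasDerivAt (fun θ => rot θ X) (-Real.sin θ • X + Real.cos θ • rot (Real.pi / 2) X) θ := by
    rw [show (fun θ => rot θ X) = _ from funext e]
    exact ((Real.hasDerivAt_cos θ).smul_const X).add ((Real.hasDerivAt_sin θ).smul_const _)
  refine ((hχ (rot θ X)).hasFDerivAt.comp_hasDerivAt θ h).congr_deriv ?_
  have h0 : (-Real.sin θ • X + Real.cos θ • rot (Real.pi / 2) X) 0 = -rot θ X 1 := by
    simp [rot_zero_coord, rot_one_coord]; ring
  have h1 : (-Real.sin θ • X + Real.cos θ • rot (Real.pi / 2) X) 1 = rot θ X 0 := by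
    simp [rot_zero_coord, rot_one_coord]; ring
  generalize -Real.sin θ • X + Real.cos θ • rot (Real.pi / 2) X = v at h0 h1 ⊢
  have h2 : fderiv ℝ χ (rot θ X) v = pd 0 χ (rot θ X) * v 0 + pd 1 χ (rot θ X) * v 1 := by
    rw [fderiv_eq_pd]
    simp [Fin.sum_univ_two]
  rw [h2, h0, h1, dang]; ring

theorem IsTest.dang {χ : Plane → ℝ} (h : IsTest χ) : IsTest (dang χ) := by
  have hc : ∀ i : Fin 2, ContDiff ℝ ∞ fun X : Plane => X i := fun i => by fun_prop
  exact ⟨((hc 0).mul (h.pd 1).1).sub ((hc 1).mul (h.pd 0).1),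
    ((h.pd 1).2.mul_left).sub ((h.pd 0).2.mul_left)⟩

/-- Differentiate `θ ↦ ∫ u χ(rot θ X)` at 0 in two ways: under the integral, and after moving the
rotation onto `u`, where the mode structure gives an explicit trigonometric function. So `∂_ϑ = n J`
weakly, without any regularity of `u`. -/
theorem integral_mul_dang {n : ℕ} {u : Y} (hu : u ∈ YnS n) {χ : Plane → ℝ} (hχ : IsTest χ) :
    ∫ X, u X * dang χ X = -n * ∫ X, Jn n u X * χ X := by
  obtain ⟨C, hC⟩ := hχ.dang.2.exists_bound_of_continuous hχ.dang.1.continuous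
  have ha : ∀ θ, Adm fun X => χ (rot θ X) := fun θ => (hχ.comp_rot θ).sm.adm
  have h1 : HasDerivAt (fun θ => ∫ X, u X * χ (rot θ X)) (∫ X, u X * dang χ (rot 0 X)) 0 := by
    refine (hasDerivAt_integral_of_dominated_loc_of_deriv_le (s := Set.univ)
      (F := fun θ X => u X * χ (rot θ X)) (F' := fun θ X => u X * dang χ (rot θ X))
      (bound := fun X => |u X| * C) Filter.univ_mem
      (Filter.Eventually.of_forall fun θ => (integrable_mul_adm u (ha θ)).1)
      (integrable_mul_adm u (ha 0)) (integrable_mul_adm u (hχ.dang.comp_rot 0).sm.adm).1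
      (Filter.Eventually.of_forall fun X θ _ => ?_) ((Y_integrable u).abs.mul_const C)
      (Filter.Eventually.of_forall fun X θ _ => ?_)).2
    · rw [norm_mul]; exact mul_le_mul_of_nonneg_left (hC _) (abs_nonneg _)
    · exact (hasDerivAt_comp_rot (hχ.1.differentiable (by simp)) X θ).const_mul _
  have e : (fun θ => ∫ X, u X * χ (rot θ X)) = fun θ => Real.cos (n * θ) * (∫ X, u X * χ X) -
      Real.sin (n * θ) * ∫ X, Jn n u X * χ X := by
    funext θ
    have h2 := integral_U_mul (-θ) u χ
    rw [neg_neg] at h2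
    rw [← h2, hu (-θ), ← inner_toY _ hχ.sm.adm, ← inner_toY _ hχ.sm.adm, ← inner_toY _ hχ.sm.adm,
      inner_add_left, inner_smul_left, inner_smul_left, mul_neg, Real.cos_neg, Real.sin_neg]
    simp; ring
  rw [e] at h1
  have hl : HasDerivAt (fun θ : ℝ => (n : ℝ) * θ) n 0 := by
    simpa using (hasDerivAt_id (0 : ℝ)).const_mul (n : ℝ)
  have h3 := (hl.cos.mul_const (∫ X, u X * χ X)).sub (hl.sin.mul_const (∫ X, Jn n u X * χ X))
  have h4 := h1.unique h3
  simp only [rot_zero] at h4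
  rw [h4]; simp

theorem bracket_logPot_eta0 (χ : Plane → ℝ) (X : Plane) :
    bracket (logPot eta0) χ X = -(phi X * dang χ X) := by
  rw [bracket, pd_logPot_eta0, pd_logPot_eta0, dang]; ring

theorem bracket_eta0 (χ : Plane → ℝ) (X : Plane) :
    bracket eta0 χ X = -(eta0 X / 2 * dang χ X) := by
  have e : eta0 = fun X => 1 / (4 * Real.pi) * gs X := funext fun X => eta0_eq X
  have h : ∀ i, pd i eta0 X = -(X i / 2) * eta0 X := fun i => by
    rw [e, pd_const_mul i _ (differentiable_gs X), pd_gs]; ring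
  rw [bracket, h, h, dang]; ring

theorem isWeakBracket_logPot_eta0_iff {n : ℕ} {η : Y} (h : η ∈ YnS n) (a : Y) :
    IsWeakBracket (logPot eta0) η a ↔ a = (-n : ℝ) • Jn n (PhiOp η) := by
  have key : ∀ χ, IsTest χ → -∫ X, η X * bracket (logPot eta0) χ X =
      ∫ X, ((-n : ℝ) • Jn n (PhiOp η) : Y) X * χ X := fun χ hχ => by
    rw [← inner_toY _ hχ.sm.adm, inner_smul_left, inner_toY _ hχ.sm.adm]
    refine Eq.trans ?_ (integral_mul_dang (mem_YnS_of_commute U_PhiOp h) hχ)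
    rw [← integral_neg]
    refine integral_congr_ae ?_
    filter_upwards [PhiOp_ae η] with X hX
    rw [hX, bracket_logPot_eta0]; ring
  constructor
  · intro ha
    exact Y_eq_of_test fun χ hχ => (ha χ hχ).trans (key χ hχ)
  · rintro rfl χ hχ
    exact (key χ hχ).symm

theorem isWeakBracket_eta0_iff {n : ℕ} {η : Y} (h : η ∈ YnS n) (b : Y) :
    IsWeakBracket eta0 (logPot η) b ↔ b = (-n / 2 : ℝ) • Jn n (Kop η) := by
  have key : ∀ χ, IsTest χ → -∫ X, logPot η X * bracket eta0 χ X =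
      ∫ X, ((-n / 2 : ℝ) • Jn n (Kop η) : Y) X * χ X := fun χ hχ => by
    rw [← inner_toY _ hχ.sm.adm, inner_smul_left, inner_toY _ hχ.sm.adm]
    have h2 := integral_mul_dang (mem_YnS_of_commute U_Kop h) hχ
    have h3 : -∫ X, logPot η X * bracket eta0 χ X = 1 / 2 * ∫ X, Kop η X * dang χ X := by
      rw [← integral_neg, ← integral_const_mul]
      refine integral_congr_ae ?_
      have := toY_ae (adm_const_mul (1 / (4 * Real.pi)) (adm_logPot η))
      rw [← Kop_apply] at this
      filter_upwards [this] with X hX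
      rw [hX, bracket_eta0, eta0_eq]; ring
    rw [h3, h2]
    simp; ring
  constructor
  · intro ha
    exact Y_eq_of_test fun χ hχ => (ha χ hχ).trans (key χ hχ)
  · rintro rfl χ hχ
    exact (key χ hχ).symm

/-- Each weak bracket is determined by its angular-derivative formula. In particular the whole mode
lies in `D(Λ)`, so the domain condition on `Λ` is automatic there. -/
theorem isLambda_iff {n : ℕ} {η g : Y} (h : η ∈ YnS n) : IsLambda η g ↔ g = LamOp n η := by
  have e : LamOp n η = (1 / (2 * Real.pi)) •
      ((-n : ℝ) • Jn n (PhiOp η) + -((-n / 2 : ℝ) • Jn n (Kop η))) := by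
    rw [LamOp_apply, Sop_apply, map_sub, map_smul]
    have := Real.pi_ne_zero
    match_scalars <;> field_simp
  constructor
  · rintro ⟨a, b, ha, hb, rfl⟩
    rw [(isWeakBracket_logPot_eta0_iff h a).1 ha, e, ← (isWeakBracket_eta0_iff h _).1 hb, neg_neg]
  · rintro rfl
    exact ⟨_, _, (isWeakBracket_logPot_eta0_iff h _).2 rfl,
      (isWeakBracket_eta0_iff h _).2 (neg_neg _), e⟩

/-! ### Subspaces invariant under `ℒ`, its resolvent and `Λ`. -/

theorem TG.comp_rot {k : ℕ} {u : Plane → ℝ} (h : TG k u) (θ : ℝ) : TG k fun X => u (rot θ X) := by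
  induction k generalizing u with
  | zero => exact h.comp_rot_zero θ
  | succ k ih =>
    obtain ⟨e0, e1⟩ := pd_comp_rot θ h.1
    refine ⟨h.1.comp (rot θ).toContinuousLinearEquiv.differentiable,
      (h.zero_of.comp_rot_zero θ).pb, fun i => ?_⟩
    fin_cases i
    · exact e0 ▸ ((ih (h.pd 0)).smul _).add ((ih (h.pd 1)).smul _)
    · exact e1 ▸ ((ih (h.pd 0)).smul _).add ((ih (h.pd 1)).smul _)

theorem IsWeakL.mem_YnS {n : ℕ} {η l : Y} (h : IsWeakL η l) (hη : η ∈ YnS n) : l ∈ YnS n :=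
  fun θ => by
  have h1 := h.rot θ
  rw [hη θ] at h1
  exact h1.unique (h.add_smul (h.rot _) _ _)

/-- The defect in the rotation law for `η` solves the homogeneous resolvent equation, hence
vanishes. -/
theorem mem_YnS_of_resolvent {n : ℕ} {κ : ℝ} (hκ : 0 < κ) {η f : Y} (h : IsWeakL η (κ • η - f))
    (hf : f ∈ YnS n) : η ∈ YnS n := fun θ => by
  have h1 := (h.rot θ).add_smul (h.add_smul (h.rot (Real.pi / (2 * n))) (Real.cos (n * θ))
    (Real.sin (n * θ))) 1 (-1)
  rw [map_sub, map_sub, hf θ, map_smul, map_smul, Jn] at h1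
  refine sub_eq_zero.1 (IsWeakL.eq_zero hκ ?_)
  convert h1 using 1
  · rw [Jn]; module
  · rw [Jn]; module

theorem ou_coord (i : Fin 2) : ou (fun X => X i) = fun X : Plane => -(1 / 2) * X i := by
  have h : ∀ j : Fin 2, pd j (fun X => X i) = fun _ => if i = j then 1 else 0 :=
    fun j => funext fun X => pd_coord j i
  funext X
  rw [ou, h, h, pd_const, pd_const]
  fin_cases i <;> simp

/-- First moments are eigenfunctionals of `ℒ` with eigenvalue `-1/2`, so the condition that they
vanish is compatible with `ℒ` and its resolvent. -/
theorem IsWeakL.inner_coord {η l : Y} (h : IsWeakL η l) (i : Fin 2) :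
    inner ℝ l (toY fun X => X i) = -(1 / 2) * inner ℝ η (toY fun X => X i) := by
  rw [h.inner_eq fun k => TG.coord i, ou_coord, toY_smul _ (TG.coord (k := 0) i).adm,
    inner_smul_right]

/-- The subspace of the first angular mode defined by vanishing first moments. -/
def Y1S : Submodule ℝ Y where
  carrier := {η | η ∈ YnS 1 ∧ ∀ i : Fin 2, inner ℝ η (toY fun X => X i) = 0}
  add_mem' {η ζ} h1 h2 := ⟨add_mem h1.1 h2.1, fun i => by
    rw [inner_add_left, h1.2 i, h2.2 i, add_zero]⟩
  zero_mem' := ⟨zero_mem _, fun i => inner_zero_left _⟩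
  smul_mem' c η h := ⟨(YnS 1).smul_mem c h.1, fun i => by
    rw [inner_smul_left, h.2 i, mul_zero]⟩

theorem mem_Y1' {η : Y} : η ∈ Y1' ↔ η ∈ Y1S := by
  have e : ∀ i : Fin 2, inner ℝ η (toY fun X => X i) = ∫ X, η X * X i := fun i =>
    inner_toY η (TG.coord (k := 0) i).adm
  constructor
  · rintro ⟨h, h0, h1⟩
    refine ⟨(mem_Yn_iff le_rfl).1 h, fun i => ?_⟩
    rw [e]; fin_cases i
    · exact h0
    · exact h1
  · rintro ⟨h, h0⟩
    exact ⟨(mem_Yn_iff le_rfl).2 h, by rw [← e, h0], by rw [← e, h0]⟩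

/-- Closed subspaces of the `n`-th angular mode on which the equation can be solved. -/
structure IsMode (n : ℕ) (V : Submodule ℝ Y) : Prop where
  one_le : 1 ≤ n
  le : V ≤ YnS n
  isClosed : IsClosed (V : Set Y)
  lamOp_mem : ∀ η ∈ V, LamOp n η ∈ V
  weakL_mem : ∀ {η l : Y}, IsWeakL η l → η ∈ V → l ∈ V
  resolvent_mem : ∀ {κ : ℝ} {η f : Y}, 0 < κ → IsWeakL η (κ • η - f) → f ∈ V → η ∈ V
  exists_lamOp_eq : ∀ f ∈ V, f ∈ Z → ∃ η ∈ V, η ∈ Z ∧ LamOp n η = f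

theorem exists_lamOp_eq {n : ℕ} {G : Plane → ℝ} (hG : SM G) (hGn : toY G ∈ YnS n)
    (hn : 2 ≤ n ∨ n = 1 ∧ ∀ i : Fin 2, inner ℝ (toY G) (toY fun X => X i) = 0) :
    ∃ w, SM w ∧ toY w ∈ YnS n ∧ LamOp n (toY w) = toY G := by
  have hn1 : 1 ≤ n := by omega
  have hn0 : (n : ℝ) ≠ 0 := by positivity
  obtain ⟨w, hw, hwn, h⟩ := exists_Sop_eq hG hGn hn
  have hJ := (U_eq_toY (Real.pi / (2 * n)) hw.adm).2
  have hr : SM fun X => w (rot (Real.pi / (2 * n)) X) := fun k => (hw k).comp_rot _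
  -- Up to the factor, `LamOp` is `-J S`; the rotated function supplies a second `J`, and `-J² = 1`
  -- on the mode.
  refine ⟨fun X => 2 * Real.pi / n * w (rot (Real.pi / (2 * n)) X), fun k => (hr k).smul _, ?_, ?_⟩
  · rw [toY_smul _ hr.adm, ← hJ]
    exact (YnS n).smul_mem _ (U_mem_YnS hwn _)
  · rw [toY_smul _ hr.adm, ← hJ, map_smul, LamOp_apply, ← U_Sop, h]
    change (2 * Real.pi / n) • (-(n / (2 * Real.pi)) : ℝ) • Jn n (Jn n (toY G)) = _
    rw [Jn_Jn hn1 hGn, smul_smul, smul_neg, ← neg_smul]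
    have := Real.pi_ne_zero
    rw [show -(2 * Real.pi / n * -(n / (2 * Real.pi))) = 1 by field_simp, one_smul]

theorem isMode_YnS {n : ℕ} (hn : 2 ≤ n) : IsMode n (YnS n) where
  one_le := by omega
  le := le_rfl
  isClosed := isClosed_YnS n
  lamOp_mem _ h := LamOp_mem h
  weakL_mem h hη := h.mem_YnS hη
  resolvent_mem hκ h hf := mem_YnS_of_resolvent hκ h hf
  exists_lamOp_eq f hf hfZ := by
    obtain ⟨G, hG, rfl⟩ := mem_Z_iff.1 hfZ
    obtain ⟨w, hw, hwn, h⟩ := exists_lamOp_eq hG hf (Or.inl hn)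
    exact ⟨_, hwn, mem_Z_iff.2 ⟨w, hw, rfl⟩, h⟩

theorem inner_toY_coord_coord : inner ℝ (toY fun X => X 0) (toY fun X : Plane => X 1) = 0 := by
  rw [inner_toY_toY (TG.coord (k := 0) 0).adm (TG.coord (k := 0) 1).adm]
  have h := integral_rot (Real.pi / 2) fun X => gs X * (X 0 * X 1)
  simp only [gs_radial (norm_rot _ _), rot_zero_coord, rot_one_coord, Real.cos_pi_div_two,
    Real.sin_pi_div_two, zero_mul, one_mul, zero_sub, add_zero] at h
  have e : ∀ X : Plane, gs X * (-X 1 * X 0) = -(gs X * (X 0 * X 1)) := fun X => by ring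
  simp only [e, integral_neg] at h
  linarith

theorem LamOp_toY_coord (i : Fin 2) : LamOp 1 (toY fun X => X i) = 0 := by
  rw [LamOp_apply, Sop_toY_coord, map_zero, smul_zero]

theorem isMode_Y1S : IsMode 1 Y1S where
  one_le := le_rfl
  le := fun _ h => h.1
  isClosed := by
    have : (Y1S : Set Y) = (YnS 1 : Set Y) ∩
        ⋂ i : Fin 2, {η : Y | inner ℝ η (toY fun X => X i) = 0} := by
      ext η; simp [Y1S]
    rw [this]
    exact (isClosed_YnS 1).inter (isClosed_iInter fun i =>
      isClosed_eq (continuous_id.inner continuous_const) continuous_const)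
  lamOp_mem η h := ⟨LamOp_mem h.1, fun i => by
    rw [inner_LamOp le_rfl h.1, LamOp_toY_coord, inner_zero_right, neg_zero]⟩
  weakL_mem h hη := ⟨h.mem_YnS hη.1, fun i => by rw [h.inner_coord, hη.2 i, mul_zero]⟩
  resolvent_mem {κ η f} hκ h hf := ⟨mem_YnS_of_resolvent hκ h hf.1, fun i => by
    have h1 := h.inner_coord i
    rw [inner_sub_left, inner_smul_left, hf.2 i, sub_zero] at h1
    have h2 : (κ + 1 / 2) * inner ℝ η (toY fun X => X i) = 0 := by
      rw [RCLike.conj_to_real] at h1; linarith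
    exact (mul_eq_zero.1 h2).resolve_left (by positivity)⟩
  exists_lamOp_eq f hf hfZ := by
    obtain ⟨G, hG, rfl⟩ := mem_Z_iff.1 hfZ
    obtain ⟨w, hw, hwn, h⟩ := exists_lamOp_eq hG hf.1 (Or.inr ⟨rfl, hf.2⟩)
    let x : Fin 2 → Y := fun i => toY fun X => X i
    -- The preimage may have nonzero moments. Its orthogonal projection onto the span of the `x i`,
    -- which lies in the kernel of `Λ`, is subtracted; the two vectors are orthogonal, so the
    -- coefficients decouple.
    let c : Fin 2 → ℝ := fun i => inner ℝ (toY w) (x i) / inner ℝ (x i) (x i)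
    have hc : ∀ i, c i * inner ℝ (x i) (x i) = inner ℝ (toY w) (x i) := fun i => by
      rcases eq_or_ne (inner ℝ (x i) (x i)) 0 with h0 | h0
      · rw [inner_self_eq_zero.1 h0]; simp
      · exact div_mul_cancel₀ _ h0
    have hx : ∀ i, Adm fun X : Plane => X i := fun i => (TG.coord (k := 0) i).adm
    have hsm : ∀ i, SM fun X : Plane => c i * X i := fun i k => (TG.coord i).smul _
    have e : toY (fun X => w X - (c 0 * X 0 + c 1 * X 1)) =
        toY w - (c 0 • x 0 + c 1 • x 1) := by
      rw [toY_sub hw.adm ((hsm 0 0).add (hsm 1 0)).adm, toY_add (hsm 0).adm (hsm 1).adm,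
        toY_smul _ (hx 0), toY_smul _ (hx 1)]
    have h01 : inner ℝ (x 0) (x 1) = 0 := inner_toY_coord_coord
    have h10 : inner ℝ (x 1) (x 0) = 0 := by rw [real_inner_comm, h01]
    refine ⟨toY w - (c 0 • x 0 + c 1 • x 1), ⟨?_, fun i => ?_⟩, ?_, ?_⟩
    · exact sub_mem hwn (add_mem ((YnS 1).smul_mem _ (toY_coord_mem 0))
        ((YnS 1).smul_mem _ (toY_coord_mem 1)))
    · change inner ℝ _ (x i) = 0
      rw [inner_sub_left, inner_add_left, inner_smul_left, inner_smul_left, ← hc i]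
      fin_cases i
      · simp only [Fin.zero_eta, h10, RCLike.conj_to_real]; ring
      · simp only [Fin.mk_one, h01, RCLike.conj_to_real]; ring
    · exact mem_Z_iff.2 ⟨_, fun k => (hw k).sub ((hsm 0 k).add (hsm 1 k)), e.symm⟩
    · rw [map_sub, map_add, map_smul, map_smul, LamOp_toY_coord, LamOp_toY_coord, h]; simp

/-! ### Solving the equation and expanding in `δ`. -/

/-- The equation `δ (κ - ℒ) η + s Λ η = g` on the `n`-th angular mode. -/
def Eqn (n : ℕ) (δ κ s : ℝ) (η g : Y) : Prop :=
  ∃ l, IsWeakL η l ∧ δ • (κ • η - l) + s • LamOp n η = g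

section equation

variable {n : ℕ} {δ κ s : ℝ} {η ζ f g : Y}

theorem Eqn.add_smul (h : Eqn n δ κ s η f) (h' : Eqn n δ κ s ζ g) (c c' : ℝ) :
    Eqn n δ κ s (c • η + c' • ζ) (c • f + c' • g) := by
  obtain ⟨l, h, rfl⟩ := h
  obtain ⟨l', h', rfl⟩ := h'
  refine ⟨_, h.add_smul h' c c', ?_⟩
  rw [map_add, map_smul, map_smul]; module

/-- Pairing with `η` kills the skew term and gives `ℒ` a favourable sign. The bound is independent
of `s` and of the size of `Λ`. -/
theorem Eqn.norm_le (hn : 1 ≤ n) (hδ : 0 < δ) (hκ : 0 < κ) (hη : η ∈ YnS n)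
    (h : Eqn n δ κ s η g) : ‖η‖ ≤ 1 / (δ * κ) * ‖g‖ := by
  obtain ⟨l, h, rfl⟩ := h
  set g := δ • (κ • η - l) + s • LamOp n η with hg
  have h1 := h.isL_and_inner_nonpos.2
  have h2 : inner ℝ g η = δ * (κ * ‖η‖ ^ 2 - inner ℝ l η) := by
    rw [hg, inner_add_left, inner_smul_left, inner_smul_left, inner_sub_left, inner_smul_left,
      inner_LamOp_self hn hη, real_inner_self_eq_norm_sq]
    simp
  have h3 := real_inner_le_norm g η
  have h4 : δ * κ * ‖η‖ * ‖η‖ ≤ ‖g‖ * ‖η‖ := by nlinarith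
  rw [one_div, inv_mul_eq_div, le_div_iff₀ (by positivity), mul_comm]
  rcases (norm_nonneg η).eq_or_lt with h0 | h0
  · rw [← h0, mul_zero]; exact norm_nonneg _
  · exact le_of_mul_le_mul_right h4 h0

theorem Eqn.norm_sub_le (hn : 1 ≤ n) (hδ : 0 < δ) (hκ : 0 < κ) (hη : η ∈ YnS n) (hζ : ζ ∈ YnS n)
    (h : Eqn n δ κ s η f) (h' : Eqn n δ κ s ζ g) : ‖η - ζ‖ ≤ 1 / (δ * κ) * ‖f - g‖ := by
  have h1 := h.add_smul h' 1 (-1)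
  have e : ∀ a b : Y, (1 : ℝ) • a + (-1 : ℝ) • b = a - b := fun a b => by module
  rw [e, e] at h1
  exact h1.norm_le hn hδ hκ (sub_mem hη hζ)

theorem exists_perturbed {V : Submodule ℝ Y} (hV : IsClosed (V : Set Y)) {P : Y → Y → Prop} {c : ℝ}
    (hc : 0 ≤ c) (hex : ∀ g ∈ V, ∃ η ∈ V, P η g)
    (hlip : ∀ η ∈ V, ∀ ζ ∈ V, ∀ f g, P η f → P ζ g → ‖η - ζ‖ ≤ c * ‖f - g‖) (B : Y →L[ℝ] Y)
    (hB : ∀ η ∈ V, B η ∈ V) (hcB : c * ‖B‖ < 1) (f : Y) (hf : f ∈ V) :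
    ∃ η ∈ V, P η (f + B η) := by
  choose! R hR hRP using hex
  have hmem : ∀ η : V, f + B η ∈ V := fun η => add_mem hf (hB _ η.2)
  let T : V → V := fun η => ⟨R (f + B η), hR _ (hmem η)⟩
  have hcomp : CompleteSpace V := hV.completeSpace_coe
  have hT : ContractingWith (Real.toNNReal (c * ‖B‖)) T := by
    refine ⟨by rwa [Real.toNNReal_lt_one], LipschitzWith.of_dist_le_mul fun η ζ => ?_⟩
    rw [Real.coe_toNNReal _ (by positivity)]
    have h1 := hlip _ (hR _ (hmem η)) _ (hR _ (hmem ζ)) _ _ (hRP _ (hmem η)) (hRP _ (hmem ζ))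
    rw [add_sub_add_left_eq_sub, ← map_sub] at h1
    have h2 := B.le_opNorm ((η : Y) - ζ)
    calc dist (T η) (T ζ) = ‖R (f + B η) - R (f + B ζ)‖ := dist_eq_norm _ _
      _ ≤ c * ‖B (η - ζ)‖ := h1
      _ ≤ c * (‖B‖ * ‖(η : Y) - ζ‖) := by gcongr
      _ = c * ‖B‖ * dist η ζ := by rw [Subtype.dist_eq, dist_eq_norm]; ring
  let η := ContractingWith.fixedPoint T hT
  have hfix : T η = η := hT.fixedPoint_isFixedPt
  refine ⟨η, η.2, ?_⟩
  have h := hRP _ (hmem η)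
  have e : R (f + B η) = η := congrArg Subtype.val hfix
  rwa [e] at h

/-- For small `δ`, `Λ` is not a small perturbation of `δ(κ - ℒ)`. So `κ` is first enlarged until it
is, and the enlargement is then removed, the bound being insensitive to the presence of `Λ`. -/
theorem IsMode.exists_eqn {V : Submodule ℝ Y} (hV : IsMode n V) (hδ : 0 < δ) (hκ : 0 < κ)
    (hf : f ∈ V) : ∃ η ∈ V, Eqn n δ κ 1 η f := by
  -- With `δκ' = δκ + b`, both perturbations, `-LamOp n` and `b` times the identity, have norm at
  -- most `b`. Each contraction factor is then at most `b/(δκ + b) < 1`.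
  set b := ‖LamOp n‖ with hb
  have hb0 : 0 ≤ b := norm_nonneg _
  set κ' := κ + b / δ with hκ'
  have hκ'0 : 0 < κ' := by positivity
  have hδκ : δ * κ' = δ * κ + b := by rw [hκ']; field_simp
  have s0 : ∀ g ∈ V, ∃ η ∈ V, Eqn n δ κ' 0 η g := fun g hg => by
    obtain ⟨η, hη, -⟩ := exists_resolvent hκ'0 (δ⁻¹ • g)
    refine ⟨η, hV.resolvent_mem hκ'0 hη.isWeakL (V.smul_mem _ hg), _, hη.isWeakL, ?_⟩
    rw [sub_sub_cancel, smul_inv_smul₀ hδ.ne', zero_smul, add_zero]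
  have s1 : ∀ g ∈ V, ∃ η ∈ V, Eqn n δ κ' 1 η g := fun g hg => by
    obtain ⟨η, hη, l, hl, h⟩ := exists_perturbed hV.isClosed (c := 1 / (δ * κ')) (by positivity) s0
      (fun η hη ζ hζ f g h h' =>
        h.norm_sub_le hV.one_le hδ hκ'0 (hV.le hη) (hV.le hζ) h') (-LamOp n)
      (fun η hη => V.neg_mem (hV.lamOp_mem η hη)) (by
        rw [norm_neg, ← hb, hδκ, one_div, inv_mul_eq_div, div_lt_one (by positivity)]
        have := mul_pos hδ hκ
        linarith) g hg
    refine ⟨η, hη, l, hl, ?_⟩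
    rw [zero_smul, add_zero] at h
    rw [h, one_smul, neg_apply]; abel
  obtain ⟨η, hη, l, hl, h⟩ := exists_perturbed hV.isClosed (c := 1 / (δ * κ')) (by positivity) s1
    (fun η hη ζ hζ f g h h' => h.norm_sub_le hV.one_le hδ hκ'0 (hV.le hη) (hV.le hζ) h')
    (b • ContinuousLinearMap.id ℝ Y) (fun η hη => V.smul_mem b hη) (by
      have h1 : ‖b • ContinuousLinearMap.id ℝ Y‖ ≤ b := by
        rw [norm_smul, Real.norm_of_nonneg hb0]
        exact mul_le_of_le_one_right hb0 ContinuousLinearMap.norm_id_le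
      rw [hδκ, one_div, inv_mul_eq_div, div_lt_one (by positivity)]
      have := mul_pos hδ hκ
      linarith) f hf
  refine ⟨η, hη, l, hl, ?_⟩
  have h2 : (b • ContinuousLinearMap.id ℝ Y) η = b • η := rfl
  rw [h2, smul_sub, smul_smul, hδκ] at h
  rw [smul_sub, smul_smul, ← sub_eq_zero, ← sub_eq_zero.2 h]
  module

theorem solves_iff (hη : η ∈ YnS n) : Solves κ δ f η ↔ Eqn n δ κ 1 η f := by
  constructor
  · rintro ⟨l, v, hl, hv, h⟩
    refine ⟨l, hl.isWeakL, ?_⟩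
    rw [one_smul, ← (isLambda_iff hη).1 hv, h]
  · rintro ⟨l, hl, h⟩
    refine ⟨l, LamOp n η, hl.isL_and_inner_nonpos.1, (isLambda_iff hη).2 rfl, ?_⟩
    rw [← h, one_smul]

theorem IsMode.existsUnique_solves {V : Submodule ℝ Y} (hV : IsMode n V) (hδ : 0 < δ) (hκ : 0 < κ)
    (hf : f ∈ V) : ∃! η : Y, η ∈ (V : Set Y) ∧ Solves κ δ f η := by
  obtain ⟨η, hη, h⟩ := hV.exists_eqn hδ hκ hf
  refine ⟨η, ⟨hη, (solves_iff (hV.le hη)).2 h⟩, ?_⟩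
  rintro ζ ⟨hζ, h'⟩
  have := ((solves_iff (hV.le hζ)).1 h').norm_sub_le hV.one_le hδ hκ (hV.le hζ) (hV.le hη) h
  rw [sub_self, norm_zero, mul_zero] at this
  exact sub_eq_zero.1 (norm_le_zero_iff.1 this)

theorem Z_sub (hη : η ∈ Z) (hζ : ζ ∈ Z) : η - ζ ∈ Z := by
  obtain ⟨u, hu, rfl⟩ := mem_Z_iff.1 hη
  obtain ⟨w, hw, rfl⟩ := mem_Z_iff.1 hζ
  exact mem_Z_iff.2 ⟨_, fun k => (hu k).sub (hw k), (toY_sub hu.adm hw.adm).symm⟩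

theorem exists_isL_of_mem_Z (κ : ℝ) (hη : η ∈ Z) : ∃ l, IsL η l ∧ l - κ • η ∈ Z := by
  obtain ⟨u, hu, rfl⟩ := mem_Z_iff.1 hη
  refine ⟨_, isL_toY (hu 2), ?_⟩
  have h : SM fun X => κ * u X := fun k => (hu k).smul _
  rw [← toY_smul _ hu.adm]
  exact Z_sub (mem_Z_iff.2 ⟨_, hu.ou, rfl⟩) (mem_Z_iff.2 ⟨_, h, rfl⟩)

/-- The difference is itself `Λ ξ` for some ξ, so by skewness its squared norm is minus the pairing
of `Λ(η - ζ) = 0` with ξ. -/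
theorem IsMode.lamOp_injOn {V : Submodule ℝ Y} (hV : IsMode n V) (hη : η ∈ V) (hηZ : η ∈ Z)
    (hζ : ζ ∈ V) (hζZ : ζ ∈ Z) (h : LamOp n η = LamOp n ζ) : η = ζ := by
  obtain ⟨ξ, hξ, -, hξ'⟩ := hV.exists_lamOp_eq _ (sub_mem hη hζ) (Z_sub hηZ hζZ)
  have h1 := inner_LamOp hV.one_le (ζ := ξ) (hV.le (sub_mem hη hζ))
  rw [map_sub, h, sub_self, inner_zero_left, hξ', real_inner_self_eq_norm_sq] at h1
  have h2 : ‖η - ζ‖ = 0 := pow_eq_zero_iff (two_ne_zero) |>.1 (by linarith)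
  exact sub_eq_zero.1 (norm_eq_zero.1 h2)

theorem IsMode.existsUnique_profileSeq {V : Submodule ℝ Y} (hV : IsMode n V) (κ : ℝ) (hf : f ∈ V)
    (hfZ : f ∈ Z) : ∃! p : ℕ → Y, IsProfileSeq κ V f p := by
  have step : ∀ q : {η : Y // η ∈ V ∧ η ∈ Z}, ∃ q' : {η : Y // η ∈ V ∧ η ∈ Z},
      ∃ l, IsL q.1 l ∧ LamOp n q'.1 = l - κ • q.1 := fun q => by
    obtain ⟨l, hl, hlZ⟩ := exists_isL_of_mem_Z κ q.2.2
    obtain ⟨η, hη, hηZ, h⟩ := hV.exists_lamOp_eq _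
      (sub_mem (hV.weakL_mem hl.isWeakL q.2.1) (V.smul_mem κ q.2.1)) hlZ
    exact ⟨⟨η, hη, hηZ⟩, l, hl, h⟩
  choose F hF using step
  obtain ⟨η₀, h0, h0Z, h0'⟩ := hV.exists_lamOp_eq f hf hfZ
  let q : ℕ → {η : Y // η ∈ V ∧ η ∈ Z} := fun m => Nat.rec ⟨η₀, h0, h0Z⟩ (fun _ => F) m
  refine ⟨fun m => (q m).1, ⟨fun m => (q m).2, ?_, fun m => ?_⟩, ?_⟩
  · exact (isLambda_iff (hV.le h0)).2 h0'.symm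
  · obtain ⟨l, hl, h⟩ := hF (q m)
    exact ⟨l, hl, (isLambda_iff (hV.le (q (m + 1)).2.1)).2 h.symm⟩
  · rintro p ⟨hp, hp0, hps⟩
    funext m
    induction m with
    | zero =>
      refine hV.lamOp_injOn (hp 0).1 (hp 0).2 h0 h0Z ?_
      rw [← (isLambda_iff (hV.le (hp 0).1)).1 hp0]
      exact h0'.symm
    | succ m ih =>
      obtain ⟨l, hl, h⟩ := hF (q m)
      obtain ⟨l', hl', h'⟩ := hps m
      rw [ih] at hl' h'
      refine hV.lamOp_injOn (hp (m + 1)).1 (hp (m + 1)).2 (q (m + 1)).2.1 (q (m + 1)).2.2 ?_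
      rw [← (isLambda_iff (hV.le (hp (m + 1)).1)).1 h', hl'.isWeakL.unique hl.isWeakL]
      exact h.symm

/-- Telescoping: subtracting `δ^N p_N` cancels the source `δ^N Λ p_N` and creates `δ^{N+1} (ℒ - κ)
p_N`, which is `δ^{N+1} Λ p_{N+1}`. -/
theorem IsMode.eqn_remainder {V : Submodule ℝ Y} (hV : IsMode n V) {p : ℕ → Y}
    (hp : IsProfileSeq κ V f p) (hη : η ∈ V) (h : Solves κ δ f η) (N : ℕ) :
    Eqn n δ κ 1 (η - ∑ m ∈ Finset.range N, δ ^ m • p m) (δ ^ N • LamOp n (p N)) := by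
  obtain ⟨hp, hp0, hps⟩ := hp
  induction N with
  | zero =>
    rw [← (isLambda_iff (hV.le (hp 0).1)).1 hp0]
    simpa using (solves_iff (hV.le hη)).1 h
  | succ N ih =>
    obtain ⟨l, hl, h'⟩ := hps N
    have h1 : Eqn n δ κ 1 (p N) (δ • (κ • p N - l) + (1 : ℝ) • LamOp n (p N)) :=
      ⟨l, hl.isWeakL, rfl⟩
    have h2 := ih.add_smul h1 1 (-δ ^ N)
    rw [Finset.sum_range_succ, ← (isLambda_iff (hV.le (hp (N + 1)).1)).1 h']
    convert h2 using 1
    · module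
    · module

theorem IsMode.exists_remainder_le {V : Submodule ℝ Y} (hV : IsMode n V) (hκ : 0 < κ) {p : ℕ → Y}
    (hp : IsProfileSeq κ V f p) (N : ℕ) : ∃ C : ℝ, 0 < C ∧ ∀ δ : ℝ, 0 < δ → ∀ η : Y, η ∈ (V : Set Y) →
      Solves κ δ f η → ‖η - ∑ m ∈ Finset.range N, δ ^ m • p m‖ ≤ C * δ ^ N := by
  refine ⟨‖LamOp n (p (N + 1))‖ / κ + ‖p N‖ + 1, by positivity, fun δ hδ η hη h => ?_⟩
  -- One extra term is included because the a priori bound costs `1/(δκ)`; the term `δ^N p_N` is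
  -- then added back and already has the right size.
  have hmem : η - ∑ m ∈ Finset.range (N + 1), δ ^ m • p m ∈ V :=
    sub_mem hη (sum_mem fun m _ => V.smul_mem _ (hp.1 m).1)
  have h1 := (hV.eqn_remainder hp hη h (N + 1)).norm_le hV.one_le hδ hκ (hV.le hmem)
  have e : η - ∑ m ∈ Finset.range N, δ ^ m • p m =
      (η - ∑ m ∈ Finset.range (N + 1), δ ^ m • p m) + δ ^ N • p N := by
    rw [Finset.sum_range_succ]; module
  have hδN : 0 < δ ^ N := pow_pos hδ N
  rw [norm_smul, Real.norm_of_nonneg (pow_pos hδ _).le] at h1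
  have h2 : 1 / (δ * κ) * (δ ^ (N + 1) * ‖LamOp n (p (N + 1))‖) =
      ‖LamOp n (p (N + 1))‖ / κ * δ ^ N := by field_simp; ring
  rw [e]
  refine (norm_add_le _ _).trans ?_
  rw [norm_smul, Real.norm_of_nonneg hδN.le]
  rw [h2] at h1
  linarith

end equation

end VortexRing

end

theorem proposition3p3 (W : Set VortexRing.Y)
    (hW : (∃ n : ℕ, 2 ≤ n ∧ W = VortexRing.Yn n) ∨ W = VortexRing.Y1')
    (f : VortexRing.Y) (hf : f ∈ W ∩ VortexRing.Z) (κ : ℝ) (hκ : 0 < κ) :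
    (∀ δ : ℝ, 0 < δ → ∃! η : VortexRing.Y, η ∈ W ∧ VortexRing.Solves κ δ f η) ∧
    (∃! p : ℕ → VortexRing.Y, VortexRing.IsProfileSeq κ W f p) ∧
    (∀ p : ℕ → VortexRing.Y, VortexRing.IsProfileSeq κ W f p →
      ∀ N : ℕ, N ≠ 0 → ∃ C : ℝ, 0 < C ∧
        ∀ δ : ℝ, 0 < δ → ∀ η : VortexRing.Y, η ∈ W → VortexRing.Solves κ δ f η →
          ‖η - ∑ m ∈ Finset.range N, δ ^ m • p m‖ ≤ C * δ ^ N) := by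
  obtain ⟨n, V, hV, rfl⟩ : ∃ (n : ℕ) (V : Submodule ℝ VortexRing.Y),
      VortexRing.IsMode n V ∧ W = V := by
    rcases hW with ⟨n, hn, rfl⟩ | rfl
    · exact ⟨n, _, VortexRing.isMode_YnS hn, Set.ext fun η => VortexRing.mem_Yn_iff (by omega)⟩
    · exact ⟨1, _, VortexRing.isMode_Y1S, Set.ext fun η => VortexRing.mem_Y1'⟩
  exact ⟨fun δ hδ => hV.existsUnique_solves hδ hκ hf.1,
    hV.existsUnique_profileSeq κ hf.1 hf.2,
    fun p hp N _ => hV.exists_remainder_le hκ hp N⟩
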